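/- For integers $k\ge 1$ and $n\ge 2k+2$, let $\overline{\Delta}_{k,n}$ be the multiassociahedron ($k$-associahedron): the abstract simplicial complex whose vertices are the relevant edges of the $n$-gon, i.e. the pairs $\{i,j\}\subset[n]$ with $\min\{|i-j|,\,n-|i-j|\}\ge k+1$, and whose faces are the sets of relevant edges that do not contain $k+1$ pairwise crossing edges. (Two pairs $\{i,j\}$, $\{a,b\}$ with $i<j$ and $a<b$ cross if $i<a<j<b$ or $a<i<b<j$.) **Theorem.** 1. For each $(k,n)\in\{(2,9),(2,10),(3,10)\}$, $\overline{\Delta}_{k,n}$ is a polytopal sphere: there is a simplicial polytope of dimension $k(n-2k-1)$ whose poset of proper faces is isomorphic to the face poset of $\overline{\Delta}_{k,n}$. 2. $\overline{\Delta}_{4,13}$ can be realized as a complete simplicial fan: there are vectors $v_e\in\mathbb{R}^{16}$, one for each vertex $e$ of $\overline{\Delta}_{4,13}$, such that $\{v_e : e\in F\}$ is linearly independent for every face $F$, distinct faces generate distinct cones $\operatorname{cone}\{v_e : e\in F\}$, and these cones form a complete simplicial fan in $\mathbb{R}^{16}$. -/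

import Mathlib

namespace Multiassoc

/-! ### The multiassociahedron -/

/-- The elements `{i, j}` (with `i < j`) of `binom([n], 2)`, i.e. the edges and diagonals of a
convex `n`-gon whose vertices are labelled cyclically by `Fin n`. -/
abbrev Edge (n : ℕ) : Type := {e : Fin n × Fin n // e.1 < e.2}

/-- The cyclic length `min (j - i, n - (j - i))` of the edge `{i, j}`. -/
def Edge.length {n : ℕ} (e : Edge n) : ℕ :=
  min (e.1.2.val - e.1.1.val) (n - (e.1.2.val - e.1.1.val))

/-- Two edges `{i, j}` and `{k, l}`, `i < j`, `k < l`, cross if `i < k < j < l` or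
`k < i < l < j`. -/
def Edge.Cross {n : ℕ} (e f : Edge n) : Prop :=
  (e.1.1 < f.1.1 ∧ f.1.1 < e.1.2 ∧ e.1.2 < f.1.2) ∨
    (f.1.1 < e.1.1 ∧ e.1.1 < f.1.2 ∧ f.1.2 < e.1.2)

/-- An `m`-crossing: a set of `m` edges that pairwise cross. -/
def IsCrossing {n : ℕ} (m : ℕ) (C : Finset (Edge n)) : Prop :=
  C.card = m ∧ ∀ e ∈ C, ∀ f ∈ C, e ≠ f → e.Cross f

/-- A set of edges is `m`-crossing-free if it contains no `m`-crossing. -/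
def CrossingFree {n : ℕ} (m : ℕ) (F : Finset (Edge n)) : Prop :=
  ∀ C ⊆ F, ¬ IsCrossing m C

/-- The multiassociahedron (`k`-associahedron) on the `n`-gon: the simplicial complex whose faces
are the `(k+1)`-crossing-free sets of relevant edges, i.e. of edges of length at least `k + 1`.
Following Mathlib's convention for simplicial complexes, the empty face is left implicit. -/
def multiassociahedron (k n : ℕ) : PreAbstractSimplicialComplex (Edge n) where
  faces := {F | F.Nonempty ∧ (∀ e ∈ F, k + 1 ≤ e.length) ∧ CrossingFree (k + 1) F}
  isRelLowerSet_faces := fun _ hF =>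
    ⟨hF.1, fun _ hGF hG => ⟨hG, fun e he => hF.2.1 e (hGF he),
      fun C hC => hF.2.2 C (hC.trans hGF)⟩⟩

/-! ### Polytopal spheres -/

/-- `B` is a nonempty proper face of the polytope `P`: the set of maximizers on `P` of some linear
functional, different from `∅` and from `P` itself. -/
def IsProperFace {D : ℕ} (P B : Set (Fin D → ℝ)) : Prop :=
  IsExposed ℝ P B ∧ B.Nonempty ∧ B ≠ P

/-- `P` is a `D`-dimensional simplicial polytope in `ℝ^D`: it is the convex hull of a finite set,
it affinely spans `ℝ^D`, and each of its proper faces is a simplex. -/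
structure IsSimplicialPolytope {D : ℕ} (P : Set (Fin D → ℝ)) : Prop where
  exists_convexHull : ∃ S : Set (Fin D → ℝ), S.Finite ∧ P = convexHull ℝ S
  affineSpan_eq_top : affineSpan ℝ P = ⊤
  simplex : ∀ B, IsProperFace P B → ∃ T : Set (Fin D → ℝ), T.Finite ∧
    AffineIndependent ℝ ((↑) : T → (Fin D → ℝ)) ∧ B = convexHull ℝ T

/-- `K` is a polytopal sphere of dimension `D - 1`: it is isomorphic to the boundary complex of a
`D`-dimensional simplicial polytope, that is, the poset of (nonempty) proper faces of some such
polytope is isomorphic to the poset of (nonempty) faces of `K`. -/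
def IsPolytopalSphere {ι : Type*} (K : PreAbstractSimplicialComplex ι) (D : ℕ) : Prop :=
  ∃ P : Set (Fin D → ℝ), IsSimplicialPolytope P ∧
    Nonempty ({B : Set (Fin D → ℝ) // IsProperFace P B} ≃o K.faces)

/-! ### Complete simplicial fans -/

/-- A complete simplicial fan in a real vector space: a finite family of simplicial cones which is
closed under taking faces, in which any two cones intersect in a common face, and which covers the
whole space. -/
structure IsCompleteSimplicialFan {E : Type*} [AddCommGroup E] [Module ℝ E]
    (Φ : Set (PointedCone ℝ E)) : Prop where
  finite : Φ.Finite
  isSimplicial : ∀ C ∈ Φ, C.IsSimplicial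
  face_mem : ∀ C ∈ Φ, ∀ C' : PointedCone ℝ E, C'.IsFaceOf C → C' ∈ Φ
  inf_isFaceOf : ∀ C ∈ Φ, ∀ C' ∈ Φ, (C ⊓ C').IsFaceOf C ∧ (C ⊓ C').IsFaceOf C'
  complete : ∀ x : E, ∃ C ∈ Φ, x ∈ C

/-- The cone generated by the vectors of the configuration `v` with labels in `F`. -/
def coneOf {ι E : Type*} [AddCommGroup E] [Module ℝ E] (v : ι → E) (F : Finset ι) :
    PointedCone ℝ E :=
  PointedCone.hull ℝ (v '' F)

/-- The vector configuration `v` realizes (embeds) the simplicial complex `K` as a complete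
simplicial fan: the vectors of each face of `K` are linearly independent, different faces generate
different cones, and the cones generated by the faces of `K` (the empty face, which generates the
cone `{0}`, included) form a complete simplicial fan. Only the vectors `v i` for which `i` is a
vertex of `K` matter. -/
structure RealizesAsCompleteFan {ι E : Type*} [AddCommGroup E] [Module ℝ E]
    (K : PreAbstractSimplicialComplex ι) (v : ι → E) : Prop where
  linearIndepOn : ∀ F ∈ K.faces, LinearIndepOn ℝ v (F : Set ι)
  injOn : Set.InjOn (coneOf v) K.faces
  isFan : IsCompleteSimplicialFan {C | ∃ F : Finset ι, (F = ∅ ∨ F ∈ K.faces) ∧ C = coneOf v F}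

/-- `K` can be realized as a complete simplicial fan in `ℝ^D`. -/
def IsRealizableAsCompleteFan {ι : Type*} (K : PreAbstractSimplicialComplex ι) (D : ℕ) : Prop :=
  ∃ v : ι → (Fin D → ℝ), RealizesAsCompleteFan K v

end Multiassoc

/-! Combinatorics. Order the relevant edges of the `n`-gon lexicographically and read `{i, j}` as
the adjacent transposition of `j - i - (k + 1)` and its successor, acting on `{0, …, m - 1}` with `m
= n - 2k`. The multiassociahedron is the subword complex of this word and the longest permutation:
its facets are the sets of edges whose complement spells a reduced word of the reversal. For each of
the four pairs this is verified by two finite searches, one showing that crossing-free sets extend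
to facets (`exists_facet_of_fillCheck`), the other that facets are crossing-free
(`crossFree_of_isFacet`). Any letter of a facet can be flipped, because the reversal inverts every
pair of values (`IsFacet.exists_flip`).

Polytopes. Explicit vectors and positive heights give points `p e`. Suppose that for each facet the
points in it are independent and span a hyperplane with all other points strictly on the side of the
origin. Together with the existence of flips this forces the convex hull to have the right faces:
the cones over the facets cover space (`exists_coord_nonneg`), the maximizers of a nonzero
functional lie in one facet (`vertices_subset`), and each face is exposed by the sum of the
supporting functionals of the facets around it (`exists_exposing`).

Fan. Here the vectors are the Gale dual of an explicit matrix with 10 rows. Coordinates with respect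
to a facet are quotients of minors on the complementary columns, so the two vectors exchanged by a
flip lie on opposite sides of their wall exactly when these minors have coherent signs
(`cofacetCoord_single`, `SignedFlips.exists_of_minors`). Such local coherence makes the number of
open cones containing a generic point constant, since a segment that leaves one cone enters its
neighbour (`openCount_eq`). The number is one because a certain point avoids all closed cones but
possibly one. The same count, restricted to the star of a face, shows that cones meet in common
faces (`subset_of_mem_cone`).

Certificates. The conditions on minors are checked along a depth-first search through all facets,
whose states are permutations; a fraction-free elimination is carried along, so that facets with a
common initial part share their pivots. A whole row is packed into one natural number. The signs of
the complementary minors are predicted by a sum of local signs attached to transitions of states,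
and coherence under flips is then a condition on pairs of states instead of pairs of facets
(`flipCheck`, `signSum_flip`). -/

open Finset

/-! ### Complete simplicial fans from flips -/

section Segment

variable {ι : Type*} [DecidableEq ι]

/-- The indices `e ∈ s` such that the affine functions with values `a` at `0` and `b` at `1` become
simultaneously positive when the function of index `e` changes its sign. -/
noncomputable def enterSet (s : Finset ι) (a b : ι → ℝ) : Finset ι :=
  {e ∈ s | a e < 0 ∧ 0 < b e ∧ ∀ f ∈ s, f ≠ e → 0 < b e * a f - a e * b f}

/-- Where function `e` vanishes on the segment, function `f` is a positive multiple of the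
determinant `b e * a f - a e * b f`. This determinant is antisymmetric in `e` and `f`, so two entry
walls would require both signs. -/
theorem card_enterSet_le_one (s : Finset ι) (a b : ι → ℝ) : #(enterSet s a b) ≤ 1 := by
  rw [card_le_one]
  intro e he f hf
  by_contra hne
  simp only [enterSet, mem_filter] at he hf
  have h1 := he.2.2.2 f hf.1 (Ne.symm hne)
  have h2 := hf.2.2.2 e he.1 hne
  linarith

omit [DecidableEq ι] in
theorem exists_pos_add_mul_pos (s : Finset ι) (a b : ι → ℝ) (h : ∀ e ∈ s, 0 < a e) :
    ∃ ε : ℝ, 0 < ε ∧ ∀ e ∈ s, 0 < a e + ε * b e := by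
  have key : ∀ᶠ ε in nhdsWithin (0 : ℝ) (Set.Ioi 0), ∀ e ∈ s, 0 < a e + ε * b e := by
    rw [Filter.eventually_all_finset]
    intro e he
    have hc : Continuous fun ε : ℝ => a e + ε * b e := by fun_prop
    have : ∀ᶠ ε in nhds (0 : ℝ), 0 < a e + ε * b e :=
      hc.continuousAt.eventually (lt_mem_nhds (by simpa using h e he))
    exact nhdsWithin_le_nhds this
  obtain ⟨ε, h1, h2⟩ := (key.and self_mem_nhdsWithin).exists
  exact ⟨ε, h2, h1⟩

/-- The parameters where all functions are positive form an interval. If it is nonempty, it either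
contains the start of the segment or begins at a single wall; `hab` excludes that two functions
vanish together. The right-hand side does not depend on the direction of the segment, which is what
allows counting from both ends. -/
theorem start_add_card_enterSet (s : Finset ι) (a b : ι → ℝ) (ha : ∀ e ∈ s, a e ≠ 0)
    (hab : ∀ e ∈ s, ∀ f ∈ s, e ≠ f → b e * a f - a e * b f ≠ 0)
    [Decidable (∀ e ∈ s, 0 < a e)]
    [Decidable (∃ l m : ℝ, 0 ≤ l ∧ 0 ≤ m ∧ ∀ e ∈ s, 0 < l * a e + m * b e)] :
    (if ∀ e ∈ s, 0 < a e then 1 else 0) + #(enterSet s a b) =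
      if ∃ l m : ℝ, 0 ≤ l ∧ 0 ≤ m ∧ ∀ e ∈ s, 0 < l * a e + m * b e then 1 else 0 := by
  by_cases hP : ∃ l m : ℝ, 0 ≤ l ∧ 0 ≤ m ∧ ∀ e ∈ s, 0 < l * a e + m * b e
  · rw [if_pos hP]
    obtain ⟨l, m, hl, hm, hlm⟩ := hP
    by_cases hA : ∀ e ∈ s, 0 < a e
    · rw [if_pos hA]
      have : enterSet s a b = ∅ := by
        rw [enterSet, filter_eq_empty_iff]
        intro e he h
        linarith [hA e he, h.1]
      simp [this]
    · rw [if_neg hA]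
      have hne : ({e ∈ s | a e < 0}).Nonempty := by
        push Not at hA
        obtain ⟨e, he, h⟩ := hA
        exact ⟨e, mem_filter.2 ⟨he, lt_of_le_of_ne h (ha e he)⟩⟩
      have hb : ∀ e ∈ s, a e < 0 → 0 < m ∧ 0 < b e := by
        intro e he h
        have h1 := hlm e he
        have h2 : 0 < m * b e := by nlinarith
        have hm' : 0 < m := lt_of_le_of_ne hm (by rintro rfl; simp at h2)
        exact ⟨hm', by
          by_contra hb
          nlinarith⟩
      -- Among the functions negative at the start, the one with the largest ratio `-a e / b e` is
      -- the last to become positive.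
      obtain ⟨e, he, hmax⟩ := exists_max_image _ (fun e => -a e / b e) hne
      rw [mem_filter] at he
      obtain ⟨hm', hbe⟩ := hb e he.1 he.2
      have hmem : e ∈ enterSet s a b := by
        refine mem_filter.2 ⟨he.1, he.2, hbe, fun f hf hfe => ?_⟩
        rcases lt_or_gt_of_ne (ha f hf) with haf | haf
        · have hbf := (hb f hf haf).2
          have h1 := hmax f (mem_filter.2 ⟨hf, haf⟩)
          rw [div_le_div_iff₀ hbf hbe] at h1
          exact lt_of_le_of_ne (by linarith) (hab e he.1 f hf (Ne.symm hfe)).symm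
        · have h1 := hlm e he.1
          have h2 := hlm f hf
          have h3 : 0 < m * (b e * a f - a e * b f) := by nlinarith
          exact (pos_iff_pos_of_mul_pos h3).1 hm'
      have := card_enterSet_le_one s a b
      have := card_pos.2 ⟨e, hmem⟩
      omega
  · rw [if_neg hP, if_neg, zero_add, card_eq_zero, enterSet, filter_eq_empty_iff]
    · rintro e he ⟨h1, h2, h3⟩
      obtain ⟨ε, hε, h⟩ := exists_pos_add_mul_pos (s.erase e) (fun f => b e * a f - a e * b f) b
        (fun f hf => h3 f (mem_of_mem_erase hf) (ne_of_mem_erase hf))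
      -- A point just beyond the wall of `e`: there function `e` has the value `ε * b e`, and the
      -- others are still positive.
      refine hP ⟨b e, -a e + ε, h2.le, by linarith, fun f hf => ?_⟩
      by_cases hfe : f = e
      · subst hfe
        nlinarith
      · have := h f (mem_erase.2 ⟨hfe, hf⟩)
        nlinarith
    · intro h
      exact hP ⟨1, 0, by simp, le_rfl, by simpa using h⟩

end Segment

/-! ### The degree of a family of simplicial cones whose flips cross walls. -/

section Fan

variable {ι E : Type*} [DecidableEq ι] [AddCommGroup E] [Module ℝ E]

/-- The vectors `v` indexed by each facet `F ∈ 𝓕` form a basis with coordinate functionals `c F`,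
every vertex of a facet can be flipped, and the two vertices exchanged by a flip lie on different
sides of the hyperplane spanned by the other vertices. -/
structure SignedFlips (v : ι → E) (𝓕 : Finset (Finset ι)) (c : Finset ι → ι → E →ₗ[ℝ] ℝ) :
    Prop where
  sum_coord : ∀ F ∈ 𝓕, ∀ x, ∑ e ∈ F, c F e x • v e = x
  coord_apply : ∀ F ∈ 𝓕, ∀ e ∈ F, ∀ f ∈ F, c F e (v f) = if f = e then 1 else 0
  exists_flip : ∀ F ∈ 𝓕, ∀ e ∈ F, ∃ p, p ∉ F ∧ insert p (F.erase e) ∈ 𝓕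
  coord_neg : ∀ F ∈ 𝓕, ∀ e ∈ F, ∀ p, p ∉ F → insert p (F.erase e) ∈ 𝓕 → c F e (v p) < 0

namespace SignedFlips

variable {v : ι → E} {𝓕 : Finset (Finset ι)} {c : Finset ι → ι → E →ₗ[ℝ] ℝ}

theorem coord_self (h : SignedFlips v 𝓕 c) {F : Finset ι} (hF : F ∈ 𝓕) {e : ι} (he : e ∈ F) :
    c F e (v e) = 1 := by
  rw [h.coord_apply F hF e he e he, if_pos rfl]

theorem coord_eq_sum (h : SignedFlips v 𝓕 c) {F G : Finset ι} (hF : F ∈ 𝓕) (g : ι) (x : E) :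
    c G g x = ∑ f ∈ F, c F f x * c G g (v f) := by
  conv_lhs => rw [← h.sum_coord F hF x]
  simp

/-- Both functionals vanish on the common wall `F.erase e`, hence are proportional; the factor is
found by evaluating at `v p`. -/
theorem coord_flip_new (h : SignedFlips v 𝓕 c) {F : Finset ι} (hF : F ∈ 𝓕) {e p : ι} (he : e ∈ F)
    (hp : p ∉ F) (hG : insert p (F.erase e) ∈ 𝓕) (x : E) :
    c (insert p (F.erase e)) p x = c F e x / c F e (v p) := by
  set G := insert p (F.erase e) with hGdef
  have key : ∀ y, c G p y = c F e y * c G p (v e) := by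
    intro y
    rw [h.coord_eq_sum hF, sum_eq_single e]
    · intro f hf hfe
      rw [h.coord_apply G hG p (mem_insert_self _ _) f
        (mem_insert_of_mem (mem_erase.2 ⟨hfe, hf⟩)), if_neg (by rintro rfl; exact hp hf), mul_zero]
    · exact fun h => (h he).elim
  have h1 := key (v p)
  rw [h.coord_self hG (mem_insert_self _ _)] at h1
  have h2 := (h.coord_neg F hF e he p hp hG).ne
  rw [key x, eq_div_iff h2]
  linear_combination (-c F e x) * h1

/-- The two coordinates of index `q` agree on the common wall, so they differ by a multiple of `c F
e`, which evaluation at `v e` determines. -/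
theorem coord_flip_old (h : SignedFlips v 𝓕 c) {F : Finset ι} (hF : F ∈ 𝓕) {e p : ι} (he : e ∈ F)
    (hG : insert p (F.erase e) ∈ 𝓕) {q : ι} (hq : q ∈ F) (hqe : q ≠ e) (x : E) :
    c (insert p (F.erase e)) q x =
      c F q x + c F e x * c (insert p (F.erase e)) q (v e) := by
  set G := insert p (F.erase e) with hGdef
  have hqG : q ∈ G := mem_insert_of_mem (mem_erase.2 ⟨hqe, hq⟩)
  rw [h.coord_eq_sum hF, ← add_sum_erase F _ he, add_comm]
  congr 1
  rw [sum_eq_single q]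
  · rw [h.coord_self hG hqG, mul_one]
  · intro f hf hfq
    rw [h.coord_apply G hG q hqG f (mem_insert_of_mem hf), if_neg hfq, mul_zero]
  · exact fun h => (h (mem_erase.2 ⟨hqe, hq⟩)).elim

/-- Both `v p` and `v q` would lie opposite to `v e`. But `p` and `q` would also be exchanged by a
flip across the same wall, hence lie opposite to each other. -/
theorem flip_unique (h : SignedFlips v 𝓕 c) {F : Finset ι} (hF : F ∈ 𝓕) {e p q : ι} (he : e ∈ F)
    (hp : p ∉ F) (hG : insert p (F.erase e) ∈ 𝓕) (hq : q ∉ F) (hH : insert q (F.erase e) ∈ 𝓕) :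
    p = q := by
  by_contra hpq
  have hp' : p ∉ F.erase e := fun h => hp (mem_of_mem_erase h)
  have h1 := h.coord_neg _ hG p (mem_insert_self _ _) q
    (by simp only [mem_insert, mem_erase, not_or]; exact ⟨Ne.symm hpq, fun h => hq h.2⟩)
    (by rwa [erase_insert hp'])
  rw [h.coord_flip_new hF he hp hG] at h1
  have h2 := h.coord_neg F hF e he p hp hG
  have h3 := h.coord_neg F hF e he q hq hH
  exact absurd (div_pos_of_neg_of_neg h3 h2) (not_lt.2 h1.le)

/-- The vertex that replaces `e` when it is flipped in `F`. -/
noncomputable def flip (h : SignedFlips v 𝓕 c) (F : Finset ι) (e : ι) : ι := by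
  classical exact if H : F ∈ 𝓕 ∧ e ∈ F then (h.exists_flip F H.1 e H.2).choose else e

theorem flip_spec (h : SignedFlips v 𝓕 c) {F : Finset ι} (hF : F ∈ 𝓕) {e : ι} (he : e ∈ F) :
    h.flip F e ∉ F ∧ insert (h.flip F e) (F.erase e) ∈ 𝓕 := by
  rw [flip, dif_pos ⟨hF, he⟩]
  exact (h.exists_flip F hF e he).choose_spec

/-- The number of facets in `𝓖` whose open cone contains `x`. -/
noncomputable def openCount (c : Finset ι → ι → E →ₗ[ℝ] ℝ) (𝓖 : Finset (Finset ι)) (x : E) : ℕ := by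
  classical exact #{F ∈ 𝓖 | ∀ e ∈ F, 0 < c F e x}

/-- Flipping exchanges the walls at which a segment enters a cone with those at which it leaves
one. -/
theorem card_enter_le (h : SignedFlips v 𝓕 c) {𝓖 : Finset (Finset ι)} (h𝓖 : 𝓖 ⊆ 𝓕) {x z : E}
    (hcl : ∀ F ∈ 𝓖, ∀ e ∈ F, ∀ p, c F e x * c F e z < 0 → p ∉ F → insert p (F.erase e) ∈ 𝓕 →
      insert p (F.erase e) ∈ 𝓖) :
    ∑ F ∈ 𝓖, #(enterSet F (fun e => c F e x) (fun e => c F e z)) ≤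
      ∑ F ∈ 𝓖, #(enterSet F (fun e => c F e z) (fun e => c F e x)) := by
  rw [← card_sigma, ← card_sigma]
  refine card_le_card_of_injOn
    (fun q => ⟨insert (h.flip q.1 q.2) (q.1.erase q.2), h.flip q.1 q.2⟩) ?_ ?_
  · rintro ⟨F, e⟩ hFe
    simp only [mem_coe, mem_sigma, enterSet, mem_filter] at hFe ⊢
    obtain ⟨hF, he, hax, hbz, hD⟩ := hFe
    obtain ⟨hp, hG⟩ := h.flip_spec (h𝓖 hF) he
    set p := h.flip F e
    have hneg := h.coord_neg F (h𝓖 hF) e he p hp hG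
    refine ⟨hcl F hF e he p (by nlinarith) hp hG, mem_insert_self _ _, ?_, ?_, ?_⟩
    · rw [h.coord_flip_new (h𝓖 hF) he hp hG]
      exact div_neg_of_pos_of_neg hbz hneg
    · rw [h.coord_flip_new (h𝓖 hF) he hp hG]
      exact div_pos_of_neg_of_neg hax hneg
    · intro q hq hqp
      obtain ⟨hqe, hqF⟩ := mem_erase.1 ((mem_insert.1 hq).resolve_left hqp)
      rw [h.coord_flip_new (h𝓖 hF) he hp hG, h.coord_flip_new (h𝓖 hF) he hp hG,
        h.coord_flip_old (h𝓖 hF) he hG hqF hqe x, h.coord_flip_old (h𝓖 hF) he hG hqF hqe z]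
      have h1 := hD q hqF hqe
      -- At the crossing point the coordinates of index `q` for the two facets coincide, so the
      -- entry condition passes to the neighbour up to the positive factor `1 / (-c F e (v p))`.
      have : c F e x / c F e (v p) * (c F q z + c F e z * c (insert p (F.erase e)) q (v e)) -
          c F e z / c F e (v p) * (c F q x + c F e x * c (insert p (F.erase e)) q (v e)) =
          (c F e z * c F q x - c F e x * c F q z) / (-c F e (v p)) := by
        field_simp
        ring
      rw [this]
      exact div_pos h1 (by linarith)
  · rintro ⟨F, e⟩ hFe ⟨F', e'⟩ hFe' heq
    simp only [mem_coe, mem_sigma, enterSet, mem_filter] at hFe hFe'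
    simp only [Sigma.mk.injEq, heq_eq_eq] at heq
    obtain ⟨hp, hG⟩ := h.flip_spec (h𝓖 hFe.1) hFe.2.1
    obtain ⟨hp', hG'⟩ := h.flip_spec (h𝓖 hFe'.1) hFe'.2.1
    obtain ⟨heq1, heq2⟩ := heq
    rw [← heq2] at heq1 hp' hG'
    set p := h.flip F e
    clear_value p
    have hpe : p ∉ F.erase e := fun h => hp (mem_of_mem_erase h)
    have hpe' : p ∉ F'.erase e' := fun h => hp' (mem_of_mem_erase h)
    have hR : F.erase e = F'.erase e' := by
      rw [← erase_insert hpe, heq1, erase_insert hpe']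
    have hFi : F = insert e ((insert p (F.erase e)).erase p) := by
      rw [erase_insert hpe, insert_erase hFe.2.1]
    have hFi' : F' = insert e' ((insert p (F.erase e)).erase p) := by
      rw [erase_insert hpe, hR, insert_erase hFe'.2.1]
    -- The pair `(F, e)` is recovered by flipping `p` back, since the result of that flip is unique.
    have hee : e = e' := by
      refine h.flip_unique hG (mem_insert_self _ _) ?_ (hFi ▸ h𝓖 hFe.1) ?_ (hFi' ▸ h𝓖 hFe'.1)
      · simp only [mem_insert, mem_erase, not_or]
        exact ⟨by rintro rfl; exact hp hFe.2.1, fun h => h.1 rfl⟩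
      · rw [heq1]
        simp only [mem_insert, mem_erase, not_or]
        exact ⟨by rintro rfl; exact hp' hFe'.2.1, fun h => h.1 rfl⟩
    have hFF : F = F' :=
      hFi.trans ((congrArg (fun a => insert a ((insert p (F.erase e)).erase p)) hee).trans
          hFi'.symm)
    rw [hee, hFF]

/-- Sum the interval identity over all facets from both ends of the segment. The walls entered in
the two directions are equinumerous by `card_enter_le` used both ways, so the numbers of cones
containing the two ends agree. Closure of `𝓖` under flips is needed only at walls separating the
ends, so that `𝓖` may be the star of a face. -/
theorem openCount_eq (h : SignedFlips v 𝓕 c) {𝓖 : Finset (Finset ι)} (h𝓖 : 𝓖 ⊆ 𝓕) {x z : E}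
    (hx : ∀ F ∈ 𝓖, ∀ e ∈ F, c F e x ≠ 0) (hz : ∀ F ∈ 𝓖, ∀ e ∈ F, c F e z ≠ 0)
    (hxz : ∀ F ∈ 𝓖, ∀ e ∈ F, ∀ f ∈ F, e ≠ f → c F e x * c F f z - c F f x * c F e z ≠ 0)
    (hcl : ∀ F ∈ 𝓖, ∀ e ∈ F, ∀ p, c F e x * c F e z < 0 → p ∉ F → insert p (F.erase e) ∈ 𝓕 →
      insert p (F.erase e) ∈ 𝓖) :
    openCount c 𝓖 x = openCount c 𝓖 z := by
  classical
  have h1 := h.card_enter_le h𝓖 hcl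
  have h2 := h.card_enter_le h𝓖 (x := z) (z := x)
    (fun F hF e he p hlt => hcl F hF e he p (by rwa [mul_comm]))
  have key : ∀ F ∈ 𝓖, (if ∀ e ∈ F, 0 < c F e x then 1 else 0) +
      #(enterSet F (fun e => c F e x) (fun e => c F e z)) =
      (if ∀ e ∈ F, 0 < c F e z then 1 else 0) +
      #(enterSet F (fun e => c F e z) (fun e => c F e x)) := by
    intro F hF
    rw [start_add_card_enterSet F (fun e => c F e x) (fun e => c F e z) (hx F hF)
      (fun e he f hf hef => by
        have := hxz F hF e he f hf hef
        intro h0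
        apply this
        linarith),
      start_add_card_enterSet F (fun e => c F e z) (fun e => c F e x) (hz F hF)
      (fun e he f hf hef => by
        have := hxz F hF e he f hf hef
        intro h0
        apply this
        linarith)]
    -- Whether the segment meets the open cone does not depend on its direction: exchange the two
    -- weights.
    congr 1
    rw [eq_iff_iff]
    constructor <;> rintro ⟨l, m, hl, hm, hh⟩ <;>
      exact ⟨m, l, hm, hl, fun e he => by linarith [hh e he]⟩
  have := sum_congr rfl key
  rw [sum_add_distrib, sum_add_distrib] at this
  simp only [openCount, card_filter]
  omega

end SignedFlips

/-- Near every point there is one at which finitely many given nonzero functionals do not vanish. -/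
theorem exists_generic_near {κ : Type*} [Finite κ] (φ : κ → E →ₗ[ℝ] ℝ) (hφ : ∀ i, φ i ≠ 0) (z : E) :
    ∃ z', ∀ i, φ i z' ≠ 0 ∧ (0 < φ i z → 0 < φ i z') ∧ (φ i z < 0 → φ i z' < 0) := by
  obtain ⟨y, hy⟩ : ∃ y, ∀ i, φ i y ≠ 0 := by
    refine Module.Dual.exists_forall_ne_zero_of_forall_exists φ fun i => ?_
    by_contra hcon
    push Not at hcon
    exact hφ i (LinearMap.ext hcon)
  have key : ∀ᶠ ε in nhdsWithin (0 : ℝ) (Set.Ioi 0), ∀ i, φ i (z + ε • y) ≠ 0 ∧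
      (0 < φ i z → 0 < φ i (z + ε • y)) ∧ (φ i z < 0 → φ i (z + ε • y) < 0) := by
    rw [Filter.eventually_all]
    intro i
    have hc : Continuous fun ε : ℝ => φ i z + ε * φ i y := by fun_prop
    simp only [map_add, map_smul, smul_eq_mul]
    rcases lt_trichotomy (φ i z) 0 with h | h | h
    · have : ∀ᶠ ε in nhds (0 : ℝ), φ i z + ε * φ i y < 0 :=
        hc.continuousAt.eventually (gt_mem_nhds (by simpa using h))
      filter_upwards [nhdsWithin_le_nhds this] with ε hε
      exact ⟨hε.ne, fun h' => absurd h' (not_lt.2 h.le), fun _ => hε⟩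
    · filter_upwards [self_mem_nhdsWithin] with ε hε
      rw [h]
      simpa using ⟨(Set.mem_Ioi.1 hε).ne', hy i⟩
    · have : ∀ᶠ ε in nhds (0 : ℝ), 0 < φ i z + ε * φ i y :=
        hc.continuousAt.eventually (lt_mem_nhds (by simpa using h))
      filter_upwards [nhdsWithin_le_nhds this] with ε hε
      exact ⟨hε.ne', fun _ => hε, fun h' => absurd h' (not_lt.2 h.le)⟩
  obtain ⟨ε, hε⟩ := key.exists
  exact ⟨_, hε⟩


namespace SignedFlips

variable {v : ι → E} {𝓕 : Finset (Finset ι)} {c : Finset ι → ι → E →ₗ[ℝ] ℝ}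

theorem coord_ne_zero (h : SignedFlips v 𝓕 c) {F : Finset ι} (hF : F ∈ 𝓕) {e : ι} (he : e ∈ F) :
    c F e ≠ 0 := fun h0 => by simpa [h0] using h.coord_self hF he

/-- A perturbation of `z` which avoids all walls and for which the segment to `x` avoids all cones
of codimension two. -/
theorem exists_generic (h : SignedFlips v 𝓕 c) {x : E} (hx : ∀ F ∈ 𝓕, ∀ e ∈ F, c F e x ≠ 0) (z : E)
    :
    ∃ z', (∀ F ∈ 𝓕, ∀ e ∈ F, c F e z' ≠ 0 ∧ (0 < c F e z → 0 < c F e z') ∧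
      (c F e z < 0 → c F e z' < 0)) ∧
      ∀ F ∈ 𝓕, ∀ e ∈ F, ∀ f ∈ F, e ≠ f → c F e x * c F f z' - c F f x * c F e z' ≠ 0 := by
  let κ₁ := {q : (F : Finset ι) × ι // q ∈ 𝓕.sigma fun F => F}
  let κ₂ := {q : (F : Finset ι) × (ι × ι) //
    q ∈ 𝓕.sigma fun F => (F ×ˢ F).filter fun r => r.1 ≠ r.2}
  have : Finite κ₁ := Finset.finite_toSet _
  have : Finite κ₂ := Finset.finite_toSet _
  obtain ⟨z', hz'⟩ := exists_generic_near (κ := κ₁ ⊕ κ₂)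
    (Sum.elim (fun q => c q.1.1 q.1.2)
      (fun q => (c q.1.1 q.1.2.1 x) • c q.1.1 q.1.2.2 - (c q.1.1 q.1.2.2 x) • c q.1.1 q.1.2.1))
    (by
      rintro (⟨⟨F, e⟩, hq⟩ | ⟨⟨F, e, f⟩, hq⟩)
      · simp only [mem_sigma] at hq
        exact h.coord_ne_zero hq.1 hq.2
      · simp only [mem_sigma, mem_filter, mem_product] at hq
        intro h0
        -- At `v f` this functional takes the value `c F e x`, which is nonzero by the genericity of
        -- `x`.
        have h1 := LinearMap.congr_fun h0 (v f)
        simp only [Sum.elim_inr, LinearMap.sub_apply, LinearMap.smul_apply, smul_eq_mul,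
          h.coord_self hq.1 hq.2.1.2, LinearMap.zero_apply,
          h.coord_apply F hq.1 e hq.2.1.1 f hq.2.1.2, if_neg (Ne.symm hq.2.2)] at h1
        exact hx F hq.1 e hq.2.1.1 (by linarith)) z
  refine ⟨z', fun F hF e he => ?_, fun F hF e he f hf hef => ?_⟩
  · exact hz' (Sum.inl ⟨⟨F, e⟩, mem_sigma.2 ⟨hF, he⟩⟩)
  · exact (hz' (Sum.inr ⟨⟨F, e, f⟩,
        mem_sigma.2 ⟨hF, mem_filter.2 ⟨mem_product.2 ⟨he, hf⟩, hef⟩⟩⟩)).1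

theorem exists_generic' (h : SignedFlips v 𝓕 c) (z : E) :
    ∃ z', ∀ F ∈ 𝓕, ∀ e ∈ F, c F e z' ≠ 0 ∧ (0 < c F e z → 0 < c F e z') ∧
      (c F e z < 0 → c F e z' < 0) := by
  let κ₁ := {q : (F : Finset ι) × ι // q ∈ 𝓕.sigma fun F => F}
  have : Finite κ₁ := Finset.finite_toSet _
  obtain ⟨z', hz'⟩ := exists_generic_near (κ := κ₁) (fun q => c q.1.1 q.1.2)
    (by
      rintro ⟨⟨F, e⟩, hq⟩
      simp only [mem_sigma] at hq
      exact h.coord_ne_zero hq.1 hq.2) z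
  exact ⟨z', fun F hF e he => hz' ⟨⟨F, e⟩, mem_sigma.2 ⟨hF, he⟩⟩⟩

/-- The segment between two generic points may still meet a cone of codimension two. Perturbing one
end avoids this without changing any sign there. -/
theorem openCount_eq_of_generic (h : SignedFlips v 𝓕 c) {x z : E}
    (hx : ∀ F ∈ 𝓕, ∀ e ∈ F, c F e x ≠ 0) (hz : ∀ F ∈ 𝓕, ∀ e ∈ F, c F e z ≠ 0) :
    openCount c 𝓕 x = openCount c 𝓕 z := by
  classical
  obtain ⟨z', hz', hxz⟩ := h.exists_generic hx z
  rw [h.openCount_eq subset_rfl hx (fun F hF e he => (hz' F hF e he).1) hxz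
    (fun F hF e he p _ _ hG => hG)]
  simp only [openCount]
  congr 1
  refine filter_congr fun F hF => forall₂_congr fun e he => ?_
  obtain ⟨h1, h2, h3⟩ := hz' F hF e he
  refine ⟨fun h0 => ?_, h2⟩
  rcases lt_or_gt_of_ne (hz F hF e he) with h' | h'
  · linarith [h3 h']
  · exact h'

/-- The degree of the fan is one as soon as some point lies in at most one closed cone. -/
theorem openCount_eq_one (h : SignedFlips v 𝓕 c) (hne : 𝓕.Nonempty) {x₀ : E} {F₀ : Finset ι}
    (h₀ : ∀ F ∈ 𝓕, F ≠ F₀ → ∃ e ∈ F, c F e x₀ < 0) {z : E}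
    (hz : ∀ F ∈ 𝓕, ∀ e ∈ F, c F e z ≠ 0) : openCount c 𝓕 z = 1 := by
  classical
  apply le_antisymm
  · obtain ⟨x, hx⟩ := h.exists_generic' x₀
    rw [← h.openCount_eq_of_generic (fun F hF e he => (hx F hF e he).1) hz, openCount, card_le_one]
    -- Strictly negative coordinates survive the perturbation of `x₀`, so only `F₀` can contain the
    -- generic point.
    have key : ∀ F ∈ ({F ∈ 𝓕 | ∀ e ∈ F, 0 < c F e x} : Finset (Finset ι)), F = F₀ := by
      intro F hF
      rw [mem_filter] at hF
      by_contra hFF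
      obtain ⟨e, he, hlt⟩ := h₀ F hF.1 hFF
      linarith [hF.2 e he, (hx F hF.1 e he).2.2 hlt]
    intro F hF G hG
    rw [key F hF, key G hG]
  · obtain ⟨F, hF⟩ := hne
    -- The sum of the generators has all coordinates equal to one, so a nearby generic point is
    -- inside the cone of `F`.
    obtain ⟨x, hx⟩ := h.exists_generic' (∑ f ∈ F, v f)
    rw [← h.openCount_eq_of_generic (fun F hF e he => (hx F hF e he).1) hz, openCount,
      Nat.one_le_iff_ne_zero, Ne, card_eq_zero, ← Ne, ← nonempty_iff_ne_empty]
    refine ⟨F, mem_filter.2 ⟨hF, fun e he => (hx F hF e he).2.1 ?_⟩⟩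
    rw [map_sum, sum_congr rfl (fun f hf => h.coord_apply F hF e he f hf), sum_ite_eq' F e,
        if_pos he]
    exact one_pos

/-- If each cone had a negative coordinate at `x`, the same would hold at a nearby generic point,
which however lies in an open cone. -/
theorem exists_forall_coord_nonneg (h : SignedFlips v 𝓕 c)
    (h1 : ∀ z, (∀ F ∈ 𝓕, ∀ e ∈ F, c F e z ≠ 0) → openCount c 𝓕 z = 1) (x : E) :
    ∃ F ∈ 𝓕, ∀ e ∈ F, 0 ≤ c F e x := by
  classical
  by_contra hcon
  push Not at hcon
  obtain ⟨z, hz⟩ := h.exists_generic' x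
  have := h1 z fun F hF e he => (hz F hF e he).1
  rw [openCount, card_eq_one] at this
  obtain ⟨F, hF⟩ := this
  have hF' := mem_filter.1 (hF ▸ mem_singleton_self F)
  obtain ⟨e, he, hlt⟩ := hcon F hF'.1
  linarith [hF'.2 e he, (hz F hF'.1 e he).2.2 hlt]

/-- The point `x` lies in the relative interior of the cone of `F₁`. Push it slightly into the cones
of `F₀` and of `G`. Between the two resulting points the coordinates indexed by `F₁` stay positive
on every facet containing `F₁`, so the segment never crosses a wall out of this star, and
`openCount_eq` holds for the star alone. The count is positive at the first point; at the second the
only open cone is that of `G`, so `G` belongs to the star. -/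
theorem subset_of_mem_cone (h : SignedFlips v 𝓕 c)
    (h1 : ∀ z, (∀ F ∈ 𝓕, ∀ e ∈ F, c F e z ≠ 0) → openCount c 𝓕 z = 1) {F₀ G F₁ : Finset ι}
    (hF₀ : F₀ ∈ 𝓕) (hG : G ∈ 𝓕) (hF₁ : F₁ ⊆ F₀) {a : ι → ℝ} (ha : ∀ e ∈ F₁, 0 < a e)
    (hx : ∀ e ∈ G, 0 ≤ c G e (∑ f ∈ F₁, a f • v f)) : F₁ ⊆ G := by
  classical
  by_contra hnot
  set x := ∑ f ∈ F₁, a f • v f with hxdef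
  set 𝓖 := {F ∈ 𝓕 | F₁ ⊆ F} with h𝓖
  have hsub : 𝓖 ⊆ 𝓕 := filter_subset _ _
  have hxF : ∀ F ∈ 𝓖, ∀ e ∈ F, c F e x = if e ∈ F₁ then a e else 0 := by
    intro F hF e he
    obtain ⟨hF, hF₁F⟩ := mem_filter.1 hF
    rw [hxdef, map_sum]
    simp only [map_smul, smul_eq_mul]
    rw [sum_congr rfl (fun f hf => by rw [h.coord_apply F hF e he f (hF₁F hf)])]
    simp
  have hFpos : ∀ F ∈ 𝓖, ∀ e ∈ F₁, 0 < c F e x := by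
    intro F hF e he
    rw [hxF F hF e ((mem_filter.1 hF).2 he), if_pos he]
    exact ha e he
  have hsum : ∀ F ∈ 𝓕, ∀ e ∈ F, c F e (∑ f ∈ F, v f) = 1 := by
    intro F hF e he
    rw [map_sum, sum_congr rfl (fun f hf => h.coord_apply F hF e he f hf), sum_ite_eq' F e,
        if_pos he]
  -- a point near `x` in the interior of a given cone that contains `x`
  have near : ∀ H ∈ 𝓕, (∀ e ∈ H, 0 ≤ c H e x) → ∃ y, (∀ e ∈ H, 0 < c H e y) ∧
      ∀ F ∈ 𝓖, ∀ e ∈ F₁, 0 < c F e y := by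
    intro H hH hHx
    obtain ⟨ε, hε, hpos⟩ := exists_pos_add_mul_pos (ι := Finset ι × ι) (𝓖 ×ˢ F₁)
      (fun q => c q.1 q.2 x) (fun q => c q.1 q.2 (∑ f ∈ H, v f))
      (fun q hq => hFpos q.1 (mem_product.1 hq).1 q.2 (mem_product.1 hq).2)
    refine ⟨x + ε • ∑ f ∈ H, v f, fun e he => ?_, fun F hF e he => ?_⟩
    · rw [map_add, map_smul, hsum H hH e he, smul_eq_mul]
      linarith [hHx e he]
    · rw [map_add, map_smul, smul_eq_mul]
      exact hpos (F, e) (mem_product.2 ⟨hF, he⟩)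
  have hF₀𝓖 : F₀ ∈ 𝓖 := mem_filter.2 ⟨hF₀, hF₁⟩
  obtain ⟨y₁, hy₁, hy₁'⟩ := near F₀ hF₀ (fun e he => by
    rw [hxF F₀ hF₀𝓖 e he]
    split_ifs with h'
    exacts [(ha e h').le, le_rfl])
  obtain ⟨z₁, hz₁⟩ := h.exists_generic' y₁
  obtain ⟨y₂, hy₂, hy₂'⟩ := near G hG hx
  obtain ⟨z₂, hz₂, hz₁₂⟩ := h.exists_generic (fun F hF e he => (hz₁ F hF e he).1) y₂
  have heq := h.openCount_eq hsub (fun F hF e he => (hz₁ F (hsub hF) e he).1)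
    (fun F hF e he => (hz₂ F (hsub hF) e he).1) (fun F hF => hz₁₂ F (hsub hF)) (by
      intro F hF e he p hlt hp hG'
      refine mem_filter.2 ⟨hG', fun f hf => ?_⟩
      have hfF := (mem_filter.1 hF).2 hf
      refine mem_insert_of_mem (mem_erase.2 ⟨?_, hfF⟩)
      rintro rfl
      have h2 := (hz₁ F (hsub hF) f he).2.1 (hy₁' F hF f hf)
      have h3 := (hz₂ F (hsub hF) f he).2.1 (hy₂' F hF f hf)
      nlinarith)
  have hpos : 0 < openCount c 𝓖 z₁ :=
    card_pos.2 ⟨F₀, mem_filter.2 ⟨hF₀𝓖, fun e he => (hz₁ F₀ hF₀ e he).2.1 (hy₁ e he)⟩⟩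
  rw [heq] at hpos
  obtain ⟨F, hF⟩ := card_pos.1 hpos
  obtain ⟨hF𝓖, hFz⟩ := mem_filter.1 hF
  have hone := h1 z₂ fun F hF e he => (hz₂ F hF e he).1
  have hle := card_le_one.1 hone.le F (mem_filter.2 ⟨hsub hF𝓖, hFz⟩) G
    (mem_filter.2 ⟨hG, fun e he => (hz₂ G hG e he).2.1 (hy₂ e he)⟩)
  exact hnot (hle ▸ (mem_filter.1 hF𝓖).2)

end SignedFlips

end Fan

/-! ### Cones, their faces and the fan axioms. -/

section ConeOf

variable {ι E : Type*} [AddCommGroup E] [Module ℝ E]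

theorem mem_coneOf {v : ι → E} {F : Finset ι} {x : E} :
    x ∈ Multiassoc.coneOf v F ↔ ∃ a : ι → ℝ, (∀ e, 0 ≤ a e) ∧ ∑ e ∈ F, a e • v e = x := by
  classical
  rw [Multiassoc.coneOf, PointedCone.hull, Submodule.mem_span_image_finset_iff_exists_fun]
  constructor
  · rintro ⟨a, ha⟩
    refine ⟨fun e => if h : e ∈ F then a ⟨e, h⟩ else 0, fun e => ?_, ?_⟩
    · dsimp only
      split_ifs
      exacts [(a _).2, le_rfl]
    · rw [← ha, ← sum_coe_sort F]
      exact sum_congr rfl fun e _ => by beta_reduce; rw [dif_pos e.2]; rfl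
  · rintro ⟨a, ha, rfl⟩
    refine ⟨fun e => ⟨a e, ha e⟩, ?_⟩
    rw [← sum_coe_sort F]
    rfl

theorem coneOf_mono {v : ι → E} {F G : Finset ι} (h : F ⊆ G) :
    Multiassoc.coneOf v F ≤ Multiassoc.coneOf v G :=
  Submodule.span_mono (Set.image_mono (by simpa using h))

theorem mem_coneOf_of_mem {v : ι → E} {F : Finset ι} {e : ι} (h : e ∈ F) :
    v e ∈ Multiassoc.coneOf v F :=
  Submodule.subset_span ⟨e, h, rfl⟩

end ConeOf

namespace SignedFlips

variable {ι E : Type*} [DecidableEq ι] [AddCommGroup E] [Module ℝ E]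
variable {v : ι → E} {𝓕 : Finset (Finset ι)} {c : Finset ι → ι → E →ₗ[ℝ] ℝ}

theorem coord_sum (h : SignedFlips v 𝓕 c) {F : Finset ι} (hF : F ∈ 𝓕) {G : Finset ι} (hG : G ⊆ F)
    (a : ι → ℝ) {e : ι} (he : e ∈ F) :
    c F e (∑ f ∈ G, a f • v f) = if e ∈ G then a e else 0 := by
  rw [map_sum]
  simp only [map_smul, smul_eq_mul]
  rw [sum_congr rfl (fun f hf => by rw [h.coord_apply F hF e he f (hG hf)])]
  simp

theorem linearIndepOn (h : SignedFlips v 𝓕 c) {F : Finset ι} (hF : F ∈ 𝓕) :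
    LinearIndepOn ℝ v (F : Set ι) := by
  rw [linearIndepOn_finset_iff]
  intro a ha e he
  have := h.coord_sum hF subset_rfl a he
  rw [ha, map_zero, if_pos he] at this
  exact this.symm

theorem mem_coneOf_iff (h : SignedFlips v 𝓕 c) {F : Finset ι} (hF : F ∈ 𝓕) {G : Finset ι}
    (hG : G ⊆ F) {x : E} : x ∈ Multiassoc.coneOf v G ↔
      (∀ e ∈ F, 0 ≤ c F e x) ∧ ∀ e ∈ F, e ∉ G → c F e x = 0 := by
  rw [mem_coneOf]
  constructor
  · rintro ⟨a, ha, rfl⟩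
    refine ⟨fun e he => ?_, fun e he heG => ?_⟩
    · rw [h.coord_sum hF hG a he]
      split_ifs
      exacts [ha e, le_rfl]
    · rw [h.coord_sum hF hG a he, if_neg heG]
  · rintro ⟨h1, h2⟩
    refine ⟨fun e => if e ∈ F then c F e x else 0, fun e => ?_, ?_⟩
    · dsimp only
      split_ifs with he
      exacts [h1 e he, le_rfl]
    · conv_rhs => rw [← h.sum_coord F hF x]
      refine (sum_congr rfl fun e he => by beta_reduce; rw [if_pos (hG he)]).trans
        (sum_subset hG fun e he heG => by rw [h2 e he heG, zero_smul])

variable (h1 : ∀ z, (∀ F ∈ 𝓕, ∀ e ∈ F, c F e z ≠ 0) → openCount c 𝓕 z = 1)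

-- The indices with positive coordinate at a common point form its minimal face `F₁`. This face lies
-- in `G'` by `subset_of_mem_cone`, and uniqueness of coordinates in `F'` and in `G'` then puts it
-- inside both `F` and `G`.
include h1 in
theorem coneOf_inf (h : SignedFlips v 𝓕 c) {F G F' G' : Finset ι}
    (hF' : F' ∈ 𝓕) (hG' : G' ∈ 𝓕) (hF : F ⊆ F') (hG : G ⊆ G') :
    Multiassoc.coneOf v F ⊓ Multiassoc.coneOf v G = Multiassoc.coneOf v (F ∩ G) := by
  apply le_antisymm
  · rintro x ⟨hxF, hxG⟩
    have hxF' := (h.mem_coneOf_iff hF' hF).1 hxF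
    have hxG' := (h.mem_coneOf_iff hG' hG).1 hxG
    set F₁ := {e ∈ F' | 0 < c F' e x} with hF₁
    have hx : ∑ f ∈ F₁, c F' f x • v f = x := by
      conv_rhs => rw [← h.sum_coord F' hF' x]
      refine sum_subset (filter_subset _ _) fun e he heF => ?_
      have : c F' e x = 0 := le_antisymm (not_lt.1 fun h0 => heF (mem_filter.2 ⟨he, h0⟩))
        (hxF'.1 e he)
      rw [this, zero_smul]
    have hsub : F₁ ⊆ G' := h.subset_of_mem_cone h1 hF' hG' (filter_subset _ _)
      (fun e he => (mem_filter.1 he).2) (by rw [hx]; exact hxG'.1)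
    have hsub' : F₁ ⊆ F ∩ G := by
      intro e he
      have hpos := (mem_filter.1 he).2
      refine mem_inter.2 ⟨?_, ?_⟩
      · by_contra heF
        exact hpos.ne' (hxF'.2 e (mem_filter.1 he).1 heF)
      · by_contra heG
        have h2 := hxG'.2 e (hsub he) heG
        rw [← hx, h.coord_sum hG' hsub _ (hsub he), if_pos he] at h2
        exact hpos.ne' h2
    refine coneOf_mono hsub'
        (mem_coneOf.2 ⟨fun e => max (c F' e x) 0, fun e => le_max_right _ _, ?_⟩)
    conv_rhs => rw [← hx]
    exact sum_congr rfl fun e he => by beta_reduce; rw [max_eq_left (mem_filter.1 he).2.le]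
  · exact le_inf (coneOf_mono inter_subset_left) (coneOf_mono inter_subset_right)

theorem coneOf_isFaceOf (h : SignedFlips v 𝓕 c) {F G F' : Finset ι} (hF' : F' ∈ 𝓕) (hF : F ⊆ F')
    (hG : G ⊆ F) : (Multiassoc.coneOf v G).IsFaceOf (Multiassoc.coneOf v F) := by
  refine ⟨coneOf_mono hG, fun {x y a} hx hy ha hxy => ?_⟩
  rw [h.mem_coneOf_iff hF' hF] at hx hy
  rw [h.mem_coneOf_iff hF' (hG.trans hF)] at hxy ⊢
  refine ⟨hx.1, fun e he heG => ?_⟩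
  have h2 := hxy.2 e he heG
  rw [map_add, map_smul, smul_eq_mul] at h2
  have h3 := hx.1 e he
  have h4 := hy.1 e he
  have h5 : 0 ≤ a * c F' e x := by positivity
  have h6 : a * c F' e x = 0 := by linarith
  exact (mul_eq_zero.1 h6).resolve_left ha.ne'

-- A face contains every generator that occurs with positive weight in one of its points, so it is
-- spanned by the generators it contains.
omit [DecidableEq ι] in
theorem eq_coneOf_of_isFaceOf {F : Finset ι} {C : PointedCone ℝ E}
    (hC : C.IsFaceOf (Multiassoc.coneOf v F)) : ∃ G ⊆ F, C = Multiassoc.coneOf v G := by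
  classical
  refine ⟨{e ∈ F | v e ∈ C}, filter_subset _ _, le_antisymm ?_ ?_⟩
  · intro x hx
    obtain ⟨a, ha, rfl⟩ := mem_coneOf.1 (hC.le hx)
    rw [← sum_coe_sort F] at hx
    refine mem_coneOf.2 ⟨fun e => a e, ha, ?_⟩
    refine sum_subset (filter_subset _ _) fun e he heC => ?_
    rcases (ha e).eq_or_lt with h0 | h0
    · beta_reduce
      rw [← h0, zero_smul]
    · exact (heC (mem_filter.2 ⟨he, hC.mem_of_sum_smul_mem (f := fun i : F => v i)
        (c := fun i : F => a i) (fun i => mem_coneOf_of_mem i.2) (fun i => ha i)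
            hx ⟨e, he⟩ h0⟩)).elim
  · refine Submodule.span_le.2 ?_
    rintro _ ⟨e, he, rfl⟩
    exact (mem_filter.1 (mem_coe.1 he)).2

theorem realizesAsCompleteFan (h : SignedFlips v 𝓕 c) (hne : 𝓕.Nonempty) {x₀ : E} {F₀ : Finset ι}
    (h₀ : ∀ F ∈ 𝓕, F ≠ F₀ → ∃ e ∈ F, c F e x₀ < 0) {K : PreAbstractSimplicialComplex ι}
    (hK : ∀ F, F ∈ K.faces ↔ F.Nonempty ∧ ∃ G ∈ 𝓕, F ⊆ G) :
    Multiassoc.RealizesAsCompleteFan K v := by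
  have h1 : ∀ z, (∀ F ∈ 𝓕, ∀ e ∈ F, c F e z ≠ 0) → openCount c 𝓕 z = 1 :=
    fun z hz => h.openCount_eq_one hne h₀ hz
  have hface : ∀ F : Finset ι, F = ∅ ∨ F ∈ K.faces ↔ ∃ G ∈ 𝓕, F ⊆ G := by
    intro F
    rw [hK]
    rcases F.eq_empty_or_nonempty with rfl | hF
    · obtain ⟨G, hG⟩ := hne
      simpa using ⟨G, hG⟩
    · simp [hF, hF.ne_empty]
  refine ⟨fun F hF => ?_, ?_, ?_⟩
  · obtain ⟨-, G, hG, hFG⟩ := (hK F).1 hF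
    exact (h.linearIndepOn hG).mono (by simpa using hFG)
  · have key : ∀ F ∈ K.faces, ∀ G ∈ K.faces, Multiassoc.coneOf v F = Multiassoc.coneOf v G →
        F ⊆ G := by
      intro F hF G hG hFG e he
      obtain ⟨-, F', hF', hFF'⟩ := (hK F).1 hF
      obtain ⟨-, G', hG', hGG'⟩ := (hK G).1 hG
      have hinf := h.coneOf_inf h1 hF' hG' hFF' hGG'
      rw [← hFG, inf_idem] at hinf
      have hv : v e ∈ Multiassoc.coneOf v F := mem_coneOf_of_mem he
      rw [hinf, h.mem_coneOf_iff hF' (inter_subset_left.trans hFF')] at hv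
      by_contra heG
      have := hv.2 e (hFF' he) (fun h' => heG (mem_inter.1 h').2)
      rw [h.coord_self hF' (hFF' he)] at this
      exact one_ne_zero this
    intro F hF G hG hFG
    exact (key F hF G hG hFG).antisymm (key G hG F hF hFG.symm)
  · refine ⟨?_, ?_, ?_, ?_, ?_⟩
    · have : {C | ∃ F : Finset ι, (F = ∅ ∨ F ∈ K.faces) ∧ C = Multiassoc.coneOf v F} ⊆
          (Multiassoc.coneOf v) '' (𝓕.biUnion powerset : Finset (Finset ι)) := by
        rintro _ ⟨F, hF, rfl⟩
        obtain ⟨G, hG, hFG⟩ := (hface F).1 hF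
        exact ⟨F, by simpa using ⟨G, hG, hFG⟩, rfl⟩
      exact ((finite_toSet _).image _).subset this
    · rintro _ ⟨F, hF, rfl⟩
      obtain ⟨G, hG, hFG⟩ := (hface F).1 hF
      exact PointedCone.IsSimplicial.hull ((finite_toSet F).image v)
        ((h.linearIndepOn hG).mono (by simpa using hFG)).id_image
    · rintro _ ⟨F, hF, rfl⟩ C' hC'
      obtain ⟨G, hG, hFG⟩ := (hface F).1 hF
      obtain ⟨F', hF', rfl⟩ := eq_coneOf_of_isFaceOf hC'
      exact ⟨F', (hface F').2 ⟨G, hG, hF'.trans hFG⟩, rfl⟩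
    · rintro _ ⟨F, hF, rfl⟩ _ ⟨G, hG, rfl⟩
      obtain ⟨F', hF', hFF'⟩ := (hface F).1 hF
      obtain ⟨G', hG', hGG'⟩ := (hface G).1 hG
      rw [h.coneOf_inf h1 hF' hG' hFF' hGG']
      exact ⟨h.coneOf_isFaceOf hF' hFF' inter_subset_left,
        h.coneOf_isFaceOf hG' hGG' inter_subset_right⟩
    · intro x
      obtain ⟨F, hF, hx⟩ := h.exists_forall_coord_nonneg h1 x
      exact ⟨_, ⟨F, (hface F).2 ⟨F, hF, subset_rfl⟩, rfl⟩,
        (h.mem_coneOf_iff hF subset_rfl).2 ⟨hx, fun e he h' => (h' he).elim⟩⟩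

end SignedFlips

/-! ### Simplicial polytopes from flips -/

section Hull

variable {ι V : Type*} [AddCommGroup V] [Module ℝ V]

theorem mem_convexHull_image_finset {p : ι → V} {L : Finset ι} {x : V} :
    x ∈ convexHull ℝ (p '' (L : Set ι)) ↔
      ∃ w : ι → ℝ, (∀ e ∈ L, 0 ≤ w e) ∧ ∑ e ∈ L, w e = 1 ∧ ∑ e ∈ L, w e • p e = x := by
  constructor
  · intro hx
    refine convexHull_min (t := {x | ∃ w : ι → ℝ, (∀ e ∈ L, 0 ≤ w e) ∧ ∑ e ∈ L, w e = 1 ∧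
      ∑ e ∈ L, w e • p e = x}) ?_ ?_ hx
    · classical
      rintro _ ⟨e, he, rfl⟩
      refine ⟨fun f => if f = e then 1 else 0, fun f _ => ?_, ?_, ?_⟩
      · dsimp only
        split_ifs <;> norm_num
      · rw [sum_ite_eq', if_pos (mem_coe.1 he)]
      · simp only [ite_smul, one_smul, zero_smul]
        rw [sum_ite_eq', if_pos (mem_coe.1 he)]
    · rintro _ ⟨w, hw, hw1, rfl⟩ _ ⟨w', hw', hw1', rfl⟩ s t hs ht hst
      refine ⟨fun e => s * w e + t * w' e, fun e he => ?_, ?_, ?_⟩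
      · have := hw e he
        have := hw' e he
        positivity
      · rw [sum_add_distrib, ← mul_sum, ← mul_sum, hw1, hw1', mul_one, mul_one, hst]
      · simp only [add_smul, mul_smul, sum_add_distrib, smul_sum]
  · rintro ⟨w, hw, hw1, rfl⟩
    exact (convex_convexHull ℝ _).sum_mem hw hw1
      fun e he => subset_convexHull ℝ _ ⟨e, he, rfl⟩

/-- At a maximizing convex combination the weighted gaps to the maximum are nonnegative with sum
zero, so only maximizing points carry weight. -/
theorem setOf_isMax_eq_convexHull (p : ι → V) (L : Finset ι) (l : V →ₗ[ℝ] ℝ) :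
    {x | x ∈ convexHull ℝ (p '' (L : Set ι)) ∧ ∀ y ∈ convexHull ℝ (p '' (L : Set ι)), l y ≤ l x} =
      convexHull ℝ (p '' {e | e ∈ L ∧ ∀ f ∈ L, l (p f) ≤ l (p e)}) := by
  classical
  have hset : {e | e ∈ L ∧ ∀ f ∈ L, l (p f) ≤ l (p e)} =
      (({e ∈ L | ∀ f ∈ L, l (p f) ≤ l (p e)} : Finset ι) : Set ι) := by
    ext e; simp
  rw [hset]
  apply Set.Subset.antisymm
  · rintro x ⟨hx, hmax⟩
    obtain ⟨w, hw, hw1, rfl⟩ := mem_convexHull_image_finset.1 hx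
    have hle : ∀ f ∈ L, l (p f) ≤ l (∑ e ∈ L, w e • p e) :=
      fun f hf => hmax _ (subset_convexHull ℝ _ ⟨f, hf, rfl⟩)
    set M := l (∑ e ∈ L, w e • p e) with hM
    have hzero : ∑ e ∈ L, w e * (M - l (p e)) = 0 := by
      simp only [mul_sub, sum_sub_distrib, ← sum_mul, hw1]
      rw [hM, map_sum]
      simp
    have hz : ∀ e ∈ L, w e * (M - l (p e)) = 0 :=
      (sum_eq_zero_iff_of_nonneg fun e he => mul_nonneg (hw e he) (sub_nonneg.2 (hle e he))).1 hzero
    have hw0 : ∀ e ∈ L, e ∉ ({e ∈ L | ∀ f ∈ L, l (p f) ≤ l (p e)} : Finset ι) → w e = 0 := by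
      intro e he hne
      rcases mul_eq_zero.1 (hz e he) with h0 | h0
      · exact h0
      · refine (hne (mem_filter.2 ⟨he, fun f hf => ?_⟩)).elim
        rw [← sub_eq_zero.1 h0]
        exact hle f hf
    refine mem_convexHull_image_finset.2 ⟨w, fun e he => hw e (mem_filter.1 he).1, ?_, ?_⟩
    · rw [← hw1]
      exact sum_subset (filter_subset _ _) fun e he hne => hw0 e he hne
    · exact sum_subset (filter_subset _ _) fun e he hne => by rw [hw0 e he hne, zero_smul]
  · intro x hx
    obtain ⟨w, hw, hw1, rfl⟩ := mem_convexHull_image_finset.1 hx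
    refine ⟨convexHull_mono (Set.image_mono fun e he => (mem_filter.1 (mem_coe.1 he)).1) hx,
        fun y hy => ?_⟩
    obtain ⟨w', hw', hw1', rfl⟩ := mem_convexHull_image_finset.1 hy
    have hne : ({e ∈ L | ∀ f ∈ L, l (p f) ≤ l (p e)} : Finset ι).Nonempty := by
      rw [nonempty_iff_ne_empty]
      intro h0
      rw [h0, sum_empty] at hw1
      exact zero_ne_one hw1
    obtain ⟨e₀, he₀⟩ := hne
    have hmax : ∀ f ∈ L, l (p f) ≤ l (p e₀) := (mem_filter.1 he₀).2
    have h1 : l (∑ e ∈ L, w' e • p e) ≤ l (p e₀) := by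
      rw [map_sum]
      calc ∑ e ∈ L, l (w' e • p e) ≤ ∑ e ∈ L, w' e * l (p e₀) :=
            sum_le_sum fun e he => by
              rw [map_smul, smul_eq_mul]
              exact mul_le_mul_of_nonneg_left (hmax e he) (hw' e he)
        _ = l (p e₀) := by rw [← sum_mul, hw1', one_mul]
    refine h1.trans (le_of_eq ?_)
    rw [map_sum]
    calc l (p e₀) = ∑ e ∈ L with ∀ f ∈ L, l (p f) ≤ l (p e), w e * l (p e₀) := by
          rw [← sum_mul, hw1, one_mul]
      _ = _ := sum_congr rfl fun e he => by
          rw [map_smul, smul_eq_mul]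
          congr 1
          exact le_antisymm ((mem_filter.1 he).2 e₀ (mem_filter.1 he₀).1)
            (hmax e (mem_filter.1 he).1)

end Hull

section Polytope

variable {ι : Type*} [DecidableEq ι] {D : ℕ}

/-- The points `p` indexed by each facet `F ∈ 𝓕` form a basis, with coordinate functionals `c F`,
and
span a hyperplane, with equation `a F = 1`, that supports all the points indexed by `L`; every
vertex
of a facet can be flipped. -/
structure SupportingFlips (p : ι → Fin D → ℝ) (L : Finset ι) (𝓕 : Finset (Finset ι))
    (c : Finset ι → ι → (Fin D → ℝ) →ₗ[ℝ] ℝ) (a : Finset ι → (Fin D → ℝ) →ₗ[ℝ] ℝ) : Prop where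
  nonempty : 𝓕.Nonempty
  facet_nonempty : ∀ F ∈ 𝓕, F.Nonempty
  subset : ∀ F ∈ 𝓕, F ⊆ L
  sum_coord : ∀ F ∈ 𝓕, ∀ x, ∑ e ∈ F, c F e x • p e = x
  linearIndepOn : ∀ F ∈ 𝓕, LinearIndepOn ℝ p (F : Set ι)
  support_eq : ∀ F ∈ 𝓕, ∀ e ∈ F, a F (p e) = 1
  support_lt : ∀ F ∈ 𝓕, ∀ e ∈ L, e ∉ F → a F (p e) < 1
  exists_flip : ∀ F ∈ 𝓕, ∀ e ∈ F, ∃ q, q ∉ F ∧ insert q (F.erase e) ∈ 𝓕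

namespace SupportingFlips

variable {p : ι → Fin D → ℝ} {L : Finset ι} {𝓕 : Finset (Finset ι)}
  {c : Finset ι → ι → (Fin D → ℝ) →ₗ[ℝ] ℝ} {a : Finset ι → (Fin D → ℝ) →ₗ[ℝ] ℝ}

theorem support_le (h : SupportingFlips p L 𝓕 c a) {F : Finset ι} (hF : F ∈ 𝓕) {e : ι} (he : e ∈ L)
    :
    a F (p e) ≤ 1 := by
  by_cases heF : e ∈ F
  · exact (h.support_eq F hF e heF).le
  · exact (h.support_lt F hF e he heF).le

theorem exists_flip' (h : SupportingFlips p L 𝓕 c a) {F : Finset ι} (hF : F ∈ 𝓕) {e : ι}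
    (he : e ∈ F) : ∃ G ∈ 𝓕, F.erase e ⊆ G ∧ e ∉ G := by
  obtain ⟨q, hq, hG⟩ := h.exists_flip F hF e he
  refine ⟨_, hG, subset_insert _ _, ?_⟩
  simp only [mem_insert, mem_erase, not_or]
  exact ⟨by rintro rfl; exact hq he, fun h => h.1 rfl⟩

/-- The cones over the facets cover the space. -/
theorem exists_coord_nonneg (h : SupportingFlips p L 𝓕 c a) (x : Fin D → ℝ) :
    ∃ F ∈ 𝓕, ∀ e ∈ F, 0 ≤ c F e x := by
  -- The facet with the largest value `a F x` is the one met by the ray through `x`: flipping an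
  -- index with negative coordinate would increase this value.
  obtain ⟨F, hF, hmax⟩ := exists_max_image 𝓕 (fun F => a F x) h.nonempty
  refine ⟨F, hF, fun e he => ?_⟩
  obtain ⟨G, hG, hsub, heG⟩ := h.exists_flip' hF he
  have h1 : a G x - a F x = c F e x * (a G (p e) - 1) := by
    conv_lhs => rw [← h.sum_coord F hF x]
    simp only [map_sum, map_smul, smul_eq_mul, ← sum_sub_distrib]
    rw [sum_eq_single e]
    · rw [h.support_eq F hF e he]
      ring
    · intro f hf hfe
      rw [h.support_eq F hF f hf, h.support_eq G hG f (hsub (mem_erase.2 ⟨hfe, hf⟩)), sub_self]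
    · exact fun h => (h he).elim
  have h2 := hmax G hG
  have h3 := h.support_lt G hG e (h.subset F hF he) heG
  by_contra hlt
  push Not at hlt
  nlinarith

theorem support_eq_sum (h : SupportingFlips p L 𝓕 c a) {F : Finset ι} (hF : F ∈ 𝓕)
    (x : Fin D → ℝ) : a F x = ∑ e ∈ F, c F e x := by
  conv_lhs => rw [← h.sum_coord F hF x]
  rw [map_sum]
  exact sum_congr rfl fun e he => by rw [map_smul, h.support_eq F hF e he, smul_eq_mul, mul_one]

/-- Since the cones cover space, the maximum of `l` is positive. Let `x` be the sum of the
maximizers and take a facet `F` whose cone contains `x`. Comparing `l` on the two expressions for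
`x` gives `a F x ≥ #S`, whereas each maximizer contributes at most one to `a F x`, and less than one
when it is outside `F`. -/
theorem vertices_subset (h : SupportingFlips p L 𝓕 c a) {l : (Fin D → ℝ) →ₗ[ℝ] ℝ} (hl : l ≠ 0) :
    ∃ F ∈ 𝓕, ∀ e ∈ L, (∀ f ∈ L, l (p f) ≤ l (p e)) → e ∈ F := by
  obtain ⟨F₀, hF₀⟩ := h.nonempty
  obtain ⟨f₀, hf₀⟩ := h.facet_nonempty F₀ hF₀
  obtain ⟨e₀, he₀, hmax⟩ := exists_max_image L (fun e => l (p e)) ⟨f₀, h.subset F₀ hF₀ hf₀⟩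
  have hpos : 0 < l (p e₀) := by
    obtain ⟨y, hy⟩ : ∃ y, 0 < l y := by
      obtain ⟨y, hy⟩ : ∃ y, l y ≠ 0 := by
        by_contra hcon
        push Not at hcon
        exact hl (LinearMap.ext hcon)
      rcases lt_or_gt_of_ne hy with hy | hy
      · exact ⟨-y, by rw [map_neg]; linarith⟩
      · exact ⟨y, hy⟩
    obtain ⟨F, hF, hc⟩ := h.exists_coord_nonneg y
    by_contra hcon
    rw [← h.sum_coord F hF y, map_sum] at hy
    refine not_le.2 hy (sum_nonpos fun e he => ?_)
    rw [map_smul, smul_eq_mul]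
    have := hmax e (h.subset F hF he)
    exact mul_nonpos_of_nonneg_of_nonpos (hc e he) (by linarith)
  set S := {e ∈ L | ∀ f ∈ L, l (p f) ≤ l (p e)} with hS
  have he₀S : e₀ ∈ S := mem_filter.2 ⟨he₀, hmax⟩
  have hSl : ∀ e ∈ S, l (p e) = l (p e₀) := fun e he =>
    le_antisymm (hmax e (mem_filter.1 he).1) ((mem_filter.1 he).2 e₀ he₀)
  obtain ⟨F, hF, hc⟩ := h.exists_coord_nonneg (∑ e ∈ S, p e)
  refine ⟨F, hF, ?_⟩
  have hlx : l (∑ e ∈ S, p e) = #S * l (p e₀) := by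
    rw [map_sum, sum_congr rfl hSl, sum_const, nsmul_eq_mul]
  have hle : #S * l (p e₀) ≤ a F (∑ e ∈ S, p e) * l (p e₀) := by
    rw [← hlx, h.support_eq_sum hF, sum_mul]
    conv_lhs => rw [← h.sum_coord F hF (∑ e ∈ S, p e), map_sum]
    exact sum_le_sum fun e he => by
      rw [map_smul, smul_eq_mul]
      exact mul_le_mul_of_nonneg_left (hmax e (h.subset F hF he)) (hc e he)
  have hle' := le_of_mul_le_mul_right hle hpos
  intro e he hmaxe
  have heS : e ∈ S := mem_filter.2 ⟨he, hmaxe⟩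
  by_contra heF
  have : a F (∑ e ∈ S, p e) < #S := by
    rw [map_sum, card_eq_sum_ones, Nat.cast_sum]
    refine sum_lt_sum (fun f hf => ?_) ⟨e, heS, ?_⟩
    · simpa using h.support_le hF (mem_filter.1 hf).1
    · simpa using h.support_lt F hF e he heF
  linarith

/-- Sum the supporting functionals of all facets containing `G`. The bound `#S` is attained exactly
at the points lying in all these facets. An index of `F` outside `G` is removed by a flip, which
stays among the facets containing `G`. -/
theorem exists_exposing (h : SupportingFlips p L 𝓕 c a) {G F : Finset ι} (hF : F ∈ 𝓕) (hGF : G ⊆ F)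
    (hG : G.Nonempty) : ∃ l : (Fin D → ℝ) →ₗ[ℝ] ℝ, ∀ e,
      (e ∈ L ∧ ∀ f ∈ L, l (p f) ≤ l (p e)) ↔ e ∈ G := by
  classical
  set S := {H ∈ 𝓕 | G ⊆ H} with hS
  have hle : ∀ f ∈ L, (∑ H ∈ S, a H) (p f) ≤ #S := by
    intro f hf
    rw [LinearMap.sum_apply, card_eq_sum_ones, Nat.cast_sum]
    exact sum_le_sum fun H hH => by simpa using h.support_le (mem_filter.1 hH).1 hf
  have heq : ∀ e ∈ G, (∑ H ∈ S, a H) (p e) = #S := by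
    intro e he
    rw [LinearMap.sum_apply, card_eq_sum_ones, Nat.cast_sum]
    exact sum_congr rfl fun H hH => by
      simpa using h.support_eq H (mem_filter.1 hH).1 e ((mem_filter.1 hH).2 he)
  refine ⟨∑ H ∈ S, a H, fun e => ⟨fun ⟨heL, hmax⟩ => ?_, fun he => ⟨h.subset F hF (hGF he),
    fun f hf => by rw [heq e he]; exact hle f hf⟩⟩⟩
  obtain ⟨g, hg⟩ := hG
  have h1 : (#S : ℝ) ≤ (∑ H ∈ S, a H) (p e) := by
    rw [← heq g hg]
    exact hmax g (h.subset F hF (hGF hg))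
  by_contra heG
  obtain ⟨H, hH, heH⟩ : ∃ H ∈ S, e ∉ H := by
    by_cases heF : e ∈ F
    · obtain ⟨H, hH, hsub, heH⟩ := h.exists_flip' hF heF
      refine ⟨H, mem_filter.2 ⟨hH, fun f hf => hsub (mem_erase.2 ⟨?_, hGF hf⟩)⟩, heH⟩
      rintro rfl
      exact heG hf
    · exact ⟨F, mem_filter.2 ⟨hF, hGF⟩, heF⟩
  have : (∑ H ∈ S, a H) (p e) < #S := by
    rw [LinearMap.sum_apply, card_eq_sum_ones, Nat.cast_sum]
    refine sum_lt_sum (fun H hH => ?_) ⟨H, hH, ?_⟩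
    · simpa using h.support_le (mem_filter.1 hH).1 heL
    · simpa using h.support_lt H (mem_filter.1 hH).1 e heL heH
  linarith

/-- The vector `-p f` is a nonnegative combination of the points of some facet; adding `p f` and
normalizing the weights expresses the origin. -/
theorem zero_mem (h : SupportingFlips p L 𝓕 c a) : 0 ∈ convexHull ℝ (p '' (L : Set ι)) := by
  obtain ⟨F₀, hF₀⟩ := h.nonempty
  obtain ⟨f, hf⟩ := h.facet_nonempty F₀ hF₀
  obtain ⟨F, hF, hc⟩ := h.exists_coord_nonneg (-p f)
  have hs : 0 ≤ ∑ e ∈ F, c F e (-p f) := sum_nonneg hc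
  set w : ι → ℝ := fun e => (if e = f then 1 else 0) + if e ∈ F then c F e (-p f) else 0 with hw
  have hfL := h.subset F₀ hF₀ hf
  have hw0 : ∀ e ∈ L, 0 ≤ w e := by
    intro e he
    rw [hw]
    refine add_nonneg (by split_ifs <;> norm_num) ?_
    split_ifs with heF
    exacts [hc e heF, le_rfl]
  have hFL : L.filter (· ∈ F) = F := by
    rw [filter_mem_eq_inter, inter_eq_right.2 (h.subset F hF)]
  have hw1 : ∑ e ∈ L, w e = 1 + ∑ e ∈ F, c F e (-p f) := by
    rw [hw, sum_add_distrib, sum_ite_eq', if_pos hfL, ← sum_filter, hFL]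
  have hw2 : ∑ e ∈ L, w e • p e = 0 := by
    simp only [hw, add_smul, sum_add_distrib, ite_smul, one_smul, zero_smul]
    rw [sum_ite_eq', if_pos hfL, ← sum_filter, hFL, h.sum_coord F hF]
    simp
  have hpos : 0 < ∑ e ∈ L, w e := by rw [hw1]; linarith
  have := Finset.centerMass_mem_convexHull (s := p '' (L : Set ι)) L hw0 hpos (z := p)
    (fun e he => ⟨e, he, rfl⟩)
  rwa [Finset.centerMass, hw2, smul_zero] at this

theorem affineSpan_eq_top (h : SupportingFlips p L 𝓕 c a) :
    affineSpan ℝ (convexHull ℝ (p '' (L : Set ι))) = ⊤ := by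
  set A := affineSpan ℝ (convexHull ℝ (p '' (L : Set ι)))
  have h0 : (0 : Fin D → ℝ) ∈ A := mem_affineSpan ℝ h.zero_mem
  rw [← AffineSubspace.direction_eq_top_iff_of_nonempty ⟨0, h0⟩]
  obtain ⟨F, hF⟩ := h.nonempty
  rw [eq_top_iff]
  intro x _
  rw [← h.sum_coord F hF x]
  refine Submodule.sum_mem _ fun e he => Submodule.smul_mem _ _ ?_
  have := AffineSubspace.vsub_mem_direction (mem_affineSpan ℝ (subset_convexHull ℝ _
    (Set.mem_image_of_mem p (mem_coe.2 (h.subset F hF he))))) h0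
  rwa [vsub_eq_sub, sub_zero] at this

theorem isProperFace_iff (h : SupportingFlips p L 𝓕 c a) {B : Set (Fin D → ℝ)} :
    Multiassoc.IsProperFace (convexHull ℝ (p '' (L : Set ι))) B ↔
      ∃ l : (Fin D → ℝ) →ₗ[ℝ] ℝ, l ≠ 0 ∧
        B = convexHull ℝ (p '' {e | e ∈ L ∧ ∀ f ∈ L, l (p f) ≤ l (p e)}) := by
  constructor
  · rintro ⟨hexp, hne, hP⟩
    obtain ⟨l, hl⟩ := hexp hne
    refine ⟨(l : (Fin D → ℝ) →ₗ[ℝ] ℝ), ?_, ?_⟩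
    · intro h0
      apply hP
      rw [hl]
      ext x
      have : ∀ y, l y = 0 := fun y => LinearMap.congr_fun h0 y
      simp [this]
    · rw [hl]
      exact setOf_isMax_eq_convexHull p L (l : (Fin D → ℝ) →ₗ[ℝ] ℝ)
  · rintro ⟨l, hl, rfl⟩
    obtain ⟨F₀, hF₀⟩ := h.nonempty
    obtain ⟨f₀, hf₀⟩ := h.facet_nonempty F₀ hF₀
    obtain ⟨e₀, he₀, hmax⟩ := exists_max_image L (fun e => l (p e)) ⟨f₀, h.subset F₀ hF₀ hf₀⟩
    refine ⟨fun _ => ⟨LinearMap.toContinuousLinearMap l, ?_⟩,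
      ⟨p e₀, subset_convexHull ℝ _ ⟨e₀, ⟨he₀, hmax⟩, rfl⟩⟩, ?_⟩
    · rw [← setOf_isMax_eq_convexHull]
      rfl
    -- All maximizers lie on the hyperplane `a F = 1` of one facet, but the new point of any flip of
    -- that facet does not.
    · intro heq
      obtain ⟨F, hF, hsub⟩ := h.vertices_subset hl
      obtain ⟨e, he⟩ := h.facet_nonempty F hF
      obtain ⟨q, hq, hG⟩ := h.exists_flip F hF e he
      have hqL := h.subset _ hG (mem_insert_self q _)
      have hmem : p q ∈ convexHull ℝ (p '' (L : Set ι)) := subset_convexHull ℝ _ ⟨q, hqL, rfl⟩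
      rw [← heq] at hmem
      have : convexHull ℝ (p '' {e | e ∈ L ∧ ∀ f ∈ L, l (p f) ≤ l (p e)}) ⊆ {x | a F x = 1} := by
        refine convexHull_min ?_ ?_
        · rintro _ ⟨f, ⟨hf, hfm⟩, rfl⟩
          exact h.support_eq F hF f (hsub f hf hfm)
        · exact convex_hyperplane (a F).isLinear 1
      have h1 := this hmem
      exact (h.support_lt F hF q hqL hq).ne h1

theorem isPolytopalSphere (h : SupportingFlips p L 𝓕 c a) {K : PreAbstractSimplicialComplex ι}
    (hK : ∀ F, F ∈ K.faces ↔ F.Nonempty ∧ ∃ G ∈ 𝓕, F ⊆ G) : Multiassoc.IsPolytopalSphere K D := by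
  classical
  set P := convexHull ℝ (p '' (L : Set ι)) with hP
  -- the vertices of a proper face form a face of `K`
  have key : ∀ B, Multiassoc.IsProperFace P B → ∃ G ∈ K.faces, B = convexHull ℝ (p '' (G : Set ι)) ∧
      ∀ e ∈ L, p e ∈ B ↔ e ∈ G := by
    intro B hB
    obtain ⟨l, hl, hBl⟩ := h.isProperFace_iff.1 hB
    obtain ⟨F, hF, hsub⟩ := h.vertices_subset hl
    refine ⟨{e ∈ L | ∀ f ∈ L, l (p f) ≤ l (p e)}, (hK _).2 ⟨?_, F, hF, ?_⟩, ?_, ?_⟩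
    · obtain ⟨x, hx⟩ := hB.2.1
      rw [hBl] at hx
      obtain ⟨-, e, he, -⟩ := convexHull_nonempty_iff.1 ⟨x, hx⟩
      exact ⟨e, mem_filter.2 he⟩
    · intro e he
      exact hsub e (mem_filter.1 he).1 (mem_filter.1 he).2
    · rw [hBl]
      congr 2
      ext e
      simp
    · intro e he
      rw [mem_filter]
      rw [hBl, ← setOf_isMax_eq_convexHull]
      constructor
      · rintro ⟨h1, h2⟩
        exact ⟨he, fun f hf => h2 _ (subset_convexHull ℝ _ ⟨f, hf, rfl⟩)⟩
      · rintro h1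
        rw [setOf_isMax_eq_convexHull]
        exact subset_convexHull ℝ _ ⟨e, h1, rfl⟩
  have key' : ∀ G ∈ K.faces, Multiassoc.IsProperFace P (convexHull ℝ (p '' (G : Set ι))) ∧
      ∀ e ∈ L, p e ∈ convexHull ℝ (p '' (G : Set ι)) ↔ e ∈ G := by
    intro G hG
    obtain ⟨hGne, F, hF, hGF⟩ := (hK G).1 hG
    obtain ⟨l, hl⟩ := h.exists_exposing hF hGF hGne
    have hset : {e | e ∈ L ∧ ∀ f ∈ L, l (p f) ≤ l (p e)} = (G : Set ι) := by
      ext e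
      exact hl e
    have hl0 : l ≠ 0 := by
      rintro rfl
      obtain ⟨g, hg⟩ := hGne
      obtain ⟨q, hq, hG'⟩ := h.exists_flip F hF g (hGF hg)
      exact hq (hGF ((hl q).1 ⟨h.subset _ hG' (mem_insert_self q _), fun f _ => le_rfl⟩))
    refine ⟨h.isProperFace_iff.2 ⟨l, hl0, by rw [hset]⟩, fun e he => ?_⟩
    rw [← hset, ← setOf_isMax_eq_convexHull, ← hl e]
    constructor
    · rintro ⟨h1, h2⟩
      exact ⟨he, fun f hf => h2 _ (subset_convexHull ℝ _ ⟨f, hf, rfl⟩)⟩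
    · rintro h1
      rw [setOf_isMax_eq_convexHull]
      exact subset_convexHull ℝ _ ⟨e, h1, rfl⟩
  have hKL : ∀ G ∈ K.faces, G ⊆ L := by
    intro G hG
    obtain ⟨-, F, hF, hGF⟩ := (hK G).1 hG
    exact hGF.trans (h.subset F hF)
  refine ⟨P, ⟨⟨p '' (L : Set ι), (finite_toSet L).image p, rfl⟩, h.affineSpan_eq_top, ?_⟩, ⟨?_⟩⟩
  · intro B hB
    obtain ⟨G, hG, hBG, -⟩ := key B hB
    obtain ⟨-, F, hF, hGF⟩ := (hK G).1 hG
    refine ⟨p '' (G : Set ι), (finite_toSet G).image p, ?_, hBG⟩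
    exact (((h.linearIndepOn F hF).mono
        (by simpa using hGF)).id_image).linearIndependent.affineIndependent
  · refine OrderIso.symm
      { toFun := fun G => ⟨convexHull ℝ (p '' (G.1 : Set ι)), (key' G.1 G.2).1⟩
        invFun := fun B => ⟨(key B.1 B.2).choose, (key B.1 B.2).choose_spec.1⟩
        left_inv := ?_
        right_inv := ?_
        map_rel_iff' := ?_ }
    · rintro ⟨G, hG⟩
      apply Subtype.ext
      obtain ⟨hH, -, hmem⟩ := (key _ (key' G hG).1).choose_spec
      ext e
      constructor
      · intro he
        exact ((key' G hG).2 e (hKL _ hH he)).1 ((hmem e (hKL _ hH he)).2 he)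
      · intro he
        exact (hmem e (hKL _ hG he)).1 (((key' G hG).2 e (hKL _ hG he)).2 he)
    · rintro ⟨B, hB⟩
      exact Subtype.ext (key B hB).choose_spec.2.1.symm
    · rintro ⟨G, hG⟩ ⟨H, hH⟩
      constructor
      · intro hle e he
        have : p e ∈ convexHull ℝ (p '' (H : Set ι)) := hle (subset_convexHull ℝ _ ⟨e, he, rfl⟩)
        exact ((key' H hH).2 e (hKL G hG he)).1 this
      · intro hle
        exact convexHull_mono (Set.image_mono (by simpa using hle))

end SupportingFlips

end Polytope

/-! ### Subword complexes of the symmetric group -/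

namespace Subword

open Equiv

/-- The permutation of `ℕ` reversing `{0, …, m - 1}`. -/
def reversal (m : ℕ) : Perm ℕ :=
  Function.Involutive.toPerm (fun i => if i < m then m - 1 - i else i) fun i => by
    dsimp only
    split_ifs <;> omega

theorem reversal_apply (m i : ℕ) : reversal m i = if i < m then m - 1 - i else i := rfl

theorem reversal_inv (m : ℕ) : (reversal m)⁻¹ = reversal m := rfl

/-- The adjacent transposition of `a` and `a + 1`. -/
def adj (a : ℕ) : Perm ℕ := swap a (a + 1)

theorem adj_apply (a i : ℕ) : adj a i = if i = a then a + 1 else if i = a + 1 then a else i :=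
  swap_apply_def a (a + 1) i

theorem adj_inv (a : ℕ) : (adj a)⁻¹ = adj a := swap_inv a (a + 1)

theorem adj_mul_self (a : ℕ) : adj a * adj a = 1 := swap_mul_self a (a + 1)

theorem conj_adj (w : Perm ℕ) (a : ℕ) : w * adj a * w⁻¹ = swap (w a) (w (a + 1)) :=
  (swap_apply_apply w a (a + 1)).symm

theorem adj_lt_adj {a x y : ℕ} (h : ¬(x = a ∧ y = a + 1)) (h' : ¬(x = a + 1 ∧ y = a)) :
    adj a x < adj a y ↔ x < y := by
  simp only [adj_apply]
  split_ifs <;> omega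

/-- The inversions of a permutation of `{0, …, m - 1}`, as pairs of values. -/
def inversions (m : ℕ) (w : Perm ℕ) : Finset (ℕ × ℕ) :=
  {t ∈ range m ×ˢ range m | t.1 < t.2 ∧ w⁻¹ t.2 < w⁻¹ t.1}

/-- The length of the longest permutation of `{0, …, m - 1}`. -/
def maxLength (m : ℕ) : ℕ := #{t ∈ range m ×ˢ range m | t.1 < t.2}

theorem mem_inversions {m : ℕ} {w : Perm ℕ} {x y : ℕ} :
    (x, y) ∈ inversions m w ↔ (x < m ∧ y < m) ∧ x < y ∧ w⁻¹ y < w⁻¹ x := by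
  simp [inversions]

theorem inversions_one (m : ℕ) : inversions m 1 = ∅ := by
  ext ⟨x, y⟩
  simp only [mem_inversions, notMem_empty, iff_false, inv_one, Perm.one_apply]
  omega

theorem card_inversions_reversal (m : ℕ) : #(inversions m (reversal m)) = maxLength m := by
  refine congrArg card ?_
  ext ⟨x, y⟩
  simp only [mem_inversions, mem_filter, mem_product, mem_range, reversal_inv, reversal_apply]
  refine ⟨fun h => ⟨h.1, h.2.1⟩, fun h => ⟨h.1, h.2, ?_⟩⟩
  rw [if_pos h.1.1, if_pos h.1.2]
  omega

theorem mul_adj_inv_apply (w : Perm ℕ) (a x : ℕ) : (w * adj a)⁻¹ x = adj a (w⁻¹ x) := by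
  rw [mul_inv_rev, adj_inv, Perm.mul_apply]

/-- Right multiplication exchanges two neighbouring positions. With inversions recorded as pairs of
values, it affects only the pair of values found there. -/
theorem inversions_mul_adj_subset (m : ℕ) (w : Perm ℕ) (a : ℕ) :
    inversions m (w * adj a) ⊆ insert (w a, w (a + 1)) (inversions m w) := by
  rintro ⟨x, y⟩ h
  rw [mem_insert, mem_inversions]
  rw [mem_inversions, mul_adj_inv_apply, mul_adj_inv_apply] at h
  obtain ⟨hm, hxy, h⟩ := h
  by_cases h1 : w⁻¹ x = a ∧ w⁻¹ y = a + 1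
  · left
    rw [← h1.2, ← h1.1]
    simp
  · by_cases h2 : w⁻¹ x = a + 1 ∧ w⁻¹ y = a
    · exact Or.inr ⟨hm, hxy, by omega⟩
    · exact Or.inr ⟨hm, hxy, (adj_lt_adj (fun h => h2 ⟨h.2, h.1⟩) fun h => h1 ⟨h.2, h.1⟩).1 h⟩

theorem inversions_mul_adj_subset_of_lt (m : ℕ) (w : Perm ℕ) (a : ℕ) (ha : w (a + 1) < w a) :
    inversions m (w * adj a) ⊆ inversions m w := by
  intro t ht
  rcases mem_insert.1 (inversions_mul_adj_subset m w a ht) with rfl | h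
  · exact absurd (mem_inversions.1 ht).2.1 (by omega)
  · exact h

theorem inversions_mul_adj {m : ℕ} {w : Perm ℕ} {a : ℕ} (ha : w a < w (a + 1))
    (hm : w (a + 1) < m) :
    inversions m (w * adj a) = insert (w a, w (a + 1)) (inversions m w) := by
  refine (inversions_mul_adj_subset m w a).antisymm ?_
  rintro ⟨x, y⟩ h
  rw [mem_inversions, mul_adj_inv_apply, mul_adj_inv_apply]
  rcases mem_insert.1 h with h | h
  · obtain ⟨rfl, rfl⟩ := Prod.mk.inj h
    refine ⟨⟨by omega, hm⟩, ha, ?_⟩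
    simp [adj_apply]
  · obtain ⟨hm, hxy, h⟩ := mem_inversions.1 h
    refine ⟨hm, hxy, (adj_lt_adj ?_ ?_).2 h⟩
    · rintro ⟨h1, h2⟩
      have h3 : y = w a := by rw [← h1]; simp
      have h4 : x = w (a + 1) := by rw [← h2]; simp
      omega
    · omega

theorem card_inversions_mul_adj {m : ℕ} {w : Perm ℕ} {a : ℕ} (ha : w a < w (a + 1))
    (hm : w (a + 1) < m) : #(inversions m (w * adj a)) = #(inversions m w) + 1 := by
  rw [inversions_mul_adj ha hm, card_insert_of_notMem]
  rw [mem_inversions]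
  simp

theorem reversal_of_forall {m : ℕ} {w : Perm ℕ} (h : ∀ i < m, w i = m - 1 - i)
    (h' : ∀ i, m ≤ i → w i = i) : w = reversal m := by
  ext i
  rw [reversal_apply]
  split_ifs with hi
  · exact h i hi
  · exact h' i (not_lt.1 hi)

theorem mul_adj_of_le {m a : ℕ} (ha : a + 1 < m) {w : Perm ℕ} (hw : ∀ i, m ≤ i → w i = i) {i : ℕ}
    (hi : m ≤ i) : (w * adj a) i = i := by
  rw [Perm.mul_apply, adj_apply, if_neg (by omega), if_neg (by omega), hw i hi]

theorem lt_of_fix {m : ℕ} {w : Perm ℕ} (hw : ∀ i, m ≤ i → w i = i) {i : ℕ} (hi : i < m) :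
    w i < m := by
  by_contra h
  have := w.injective (hw (w i) (not_lt.1 h))
  omega

section Words

variable {ι : Type*} [DecidableEq ι] (g : ι → ℕ)

/-- The product of the adjacent transpositions of the letters of `l` that are not in `F`. -/
def wordProd (F : Finset ι) (l : List ι) : Perm ℕ :=
  (l.map fun e => if e ∈ F then 1 else adj (g e)).prod

/-- The letters of `l` not in `F` form a reduced word from `w` to the reversal of `{0, …, m-1}`. -/
def Reduced (m : ℕ) (F : Finset ι) : List ι → Perm ℕ → Prop
  | [], w => w = reversal m
  | e :: l, w => (e ∈ F ∧ Reduced m F l w) ∨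
      (e ∉ F ∧ w (g e) < w (g e + 1) ∧ Reduced m F l (w * adj (g e)))

/-- The facets of the subword complex of the word `l` and the reversal of `{0, …, m - 1}`. -/
structure IsFacet (m : ℕ) (l : List ι) (F : Finset ι) : Prop where
  subset : F ⊆ l.toFinset
  card : #F + maxLength m = l.length
  prod : wordProd g F l = reversal m

variable {g}

theorem wordProd_cons (F : Finset ι) (e : ι) (l : List ι) :
    wordProd g F (e :: l) = (if e ∈ F then 1 else adj (g e)) * wordProd g F l := by
  simp [wordProd]

theorem wordProd_append (F : Finset ι) (l l' : List ι) :
    wordProd g F (l ++ l') = wordProd g F l * wordProd g F l' := by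
  simp [wordProd]

theorem wordProd_congr {F F' : Finset ι} {l : List ι} (h : ∀ e ∈ l, e ∈ F ↔ e ∈ F') :
    wordProd g F l = wordProd g F' l := by
  rw [wordProd, wordProd]
  congr 1
  exact List.map_congr_left fun e he => by simp only [h e he]

theorem wordProd_fix {m : ℕ} {F : Finset ι} {l : List ι} (hg : ∀ e ∈ l, g e + 1 < m) {w : Perm ℕ}
    (hw : ∀ i, m ≤ i → w i = i) : ∀ i, m ≤ i → (w * wordProd g F l) i = i := by
  induction l generalizing w with
  | nil => simpa [wordProd] using hw
  | cons e l ih =>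
    rw [wordProd_cons, ← mul_assoc]
    refine ih (fun e' he' => hg e' (List.mem_cons_of_mem _ he')) fun i hi => ?_
    split_ifs
    · rw [mul_one, hw i hi]
    · exact mul_adj_of_le (hg e List.mem_cons_self) hw hi

theorem Reduced.mul_wordProd {m : ℕ} {F : Finset ι} {l : List ι} {w : Perm ℕ}
    (h : Reduced g m F l w) : w * wordProd g F l = reversal m := by
  induction l generalizing w with
  | nil => simpa [wordProd, Reduced] using h
  | cons e l ih =>
    rw [wordProd_cons, ← mul_assoc]
    rcases h with ⟨he, h⟩ | ⟨he, -, h⟩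
    · rw [if_pos he, mul_one, ih h]
    · rw [if_neg he, ih h]

theorem Reduced.length {m : ℕ} {F : Finset ι} {l : List ι} (hg : ∀ e ∈ l, g e + 1 < m)
    {w : Perm ℕ} (hw : ∀ i, m ≤ i → w i = i) (h : Reduced g m F l w) :
    (l.filter (· ∉ F)).length + #(inversions m w) = maxLength m := by
  induction l generalizing w with
  | nil =>
    obtain rfl : w = reversal m := h
    simpa using card_inversions_reversal m
  | cons e l ih =>
    have hg' : ∀ e ∈ l, g e + 1 < m := fun e' he' => hg e' (List.mem_cons_of_mem _ he')
    have hge := hg e List.mem_cons_self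
    rcases h with ⟨he, h⟩ | ⟨he, hlt, h⟩
    · rw [List.filter_cons_of_neg (by simpa using he)]
      exact ih hg' hw h
    · rw [List.filter_cons_of_pos (by simpa using he), List.length_cons,
        ← ih hg' (fun i hi => mul_adj_of_le hge hw hi) h,
        card_inversions_mul_adj hlt (lt_of_fix hw hge)]
      ring

/-- Each letter adds at most one inversion. If the number of letters does not exceed the number of
missing inversions, every letter must add one. -/
theorem Reduced.of_le {m : ℕ} {F : Finset ι} {l : List ι} {w : Perm ℕ}
    (hp : w * wordProd g F l = reversal m)
    (hl : (l.filter (· ∉ F)).length + #(inversions m w) ≤ maxLength m) : Reduced g m F l w := by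
  have key : ∀ (l : List ι) (w : Perm ℕ), w * wordProd g F l = reversal m →
      maxLength m ≤ (l.filter (· ∉ F)).length + #(inversions m w) := by
    intro l
    induction l with
    | nil =>
      intro w hw
      obtain rfl : w = reversal m := by simpa [wordProd] using hw
      simpa using (card_inversions_reversal m).ge
    | cons e l ih =>
      intro w hw
      rw [wordProd_cons, ← mul_assoc] at hw
      by_cases he : e ∈ F
      · rw [List.filter_cons_of_neg (by simpa using he)]
        rw [if_pos he, mul_one] at hw
        exact ih w hw
      · rw [List.filter_cons_of_pos (by simpa using he), List.length_cons]
        rw [if_neg he] at hw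
        have h1 := ih _ hw
        have h2 := (card_le_card (inversions_mul_adj_subset m w (g e))).trans (card_insert_le _ _)
        omega
  induction l generalizing w with
  | nil => simpa [wordProd, Reduced] using hp
  | cons e l ih =>
    rw [wordProd_cons, ← mul_assoc] at hp
    by_cases he : e ∈ F
    · rw [List.filter_cons_of_neg (by simpa using he)] at hl
      rw [if_pos he, mul_one] at hp
      exact Or.inl ⟨he, ih hp hl⟩
    · rw [List.filter_cons_of_pos (by simpa using he), List.length_cons] at hl
      rw [if_neg he] at hp
      have h1 := key l _ hp
      have h2 := (card_le_card (inversions_mul_adj_subset m w (g e))).trans (card_insert_le _ _)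
      refine Or.inr ⟨he, ?_, ih hp (by omega)⟩
      by_contra hlt
      have hlt' : w (g e + 1) < w (g e) := lt_of_le_of_ne (not_lt.1 hlt) fun h => by
        have := w.injective h
        omega
      have h3 := card_le_card (inversions_mul_adj_subset_of_lt m w (g e) hlt')
      omega

theorem length_filter_notMem {l : List ι} (hl : l.Nodup) {F : Finset ι} (hF : F ⊆ l.toFinset) :
    (l.filter (· ∉ F)).length + #F = l.length := by
  have h1 : #F = (l.filter (· ∈ F)).length := by
    rw [← List.toFinset_card_of_nodup (hl.filter _)]
    congr 1
    ext e
    simp only [List.mem_toFinset, List.mem_filter, decide_eq_true_eq]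
    exact ⟨fun h => ⟨List.mem_toFinset.1 (hF h), h⟩, fun h => h.2⟩
  rw [h1, add_comm]
  simpa using (List.length_eq_length_filter_add (l := l) fun e => decide (e ∈ F)).symm

theorem isFacet_iff {m : ℕ} {l : List ι} (hg : ∀ e ∈ l, g e + 1 < m) (hl : l.Nodup)
    {F : Finset ι} : IsFacet g m l F ↔ F ⊆ l.toFinset ∧ Reduced g m F l 1 := by
  constructor
  · rintro ⟨h1, h2, h3⟩
    refine ⟨h1, Reduced.of_le (by rw [one_mul, h3]) ?_⟩
    have := length_filter_notMem hl h1
    rw [inversions_one, card_empty]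
    omega
  · rintro ⟨h1, h2⟩
    refine ⟨h1, ?_, by simpa using h2.mul_wordProd⟩
    have := length_filter_notMem hl h1
    have h3 := h2.length hg (fun i _ => rfl)
    rw [inversions_one, card_empty] at h3
    omega

/-! #### Flips -/

/-- An adjacent transposition changes the relative order of the positions of only one pair of
values. If the order of `x` and `y` changes along the word, it does so at some letter, whose root is
then the transposition of `x` and `y`. -/
theorem exists_root {F : Finset ι} {l : List ι} {w : Perm ℕ} {x y : ℕ}
    (h : ¬(w⁻¹ x < w⁻¹ y ↔ (w * wordProd g F l)⁻¹ x < (w * wordProd g F l)⁻¹ y)) :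
    ∃ l₁ p l₂, l = l₁ ++ p :: l₂ ∧ p ∉ F ∧
      swap ((w * wordProd g F l₁) (g p)) ((w * wordProd g F l₁) (g p + 1)) = swap x y := by
  induction l generalizing w with
  | nil => simp [wordProd] at h
  | cons e l ih =>
    rw [wordProd_cons, ← mul_assoc] at h
    by_cases h1 : w⁻¹ x < w⁻¹ y ↔
        (w * if e ∈ F then 1 else adj (g e))⁻¹ x < (w * if e ∈ F then 1 else adj (g e))⁻¹ y
    · rw [h1] at h
      obtain ⟨l₁, p, l₂, rfl, hp, h⟩ := ih h
      exact ⟨e :: l₁, p, l₂, rfl, hp, by rw [wordProd_cons, ← mul_assoc, h]⟩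
    · by_cases he : e ∈ F
      · simp [if_pos he] at h1
      · refine ⟨[], e, l, rfl, he, ?_⟩
        rw [if_neg he, mul_adj_inv_apply, mul_adj_inv_apply] at h1
        have h2 : w * wordProd g F [] = w := by simp [wordProd]
        rw [h2]
        by_contra h3
        refine h1 (adj_lt_adj ?_ ?_).symm
        · rintro ⟨h4, h5⟩
          refine h3 ?_
          rw [← h5, ← h4]
          simp
        · rintro ⟨h4, h5⟩
          refine h3 ?_
          rw [swap_comm, ← h4, ← h5]
          simp

/-- Hypothesis `ht` says that `e` and `p` have the same root, so that applying the one letter or the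
other gives the same product. -/
theorem wordProd_flip {F : Finset ι} {l a b c : List ι} {e p : ι} (hl : l.Nodup)
    (h : l = a ++ e :: (b ++ p :: c)) (hep : e ∈ F ∧ p ∉ F ∨ e ∉ F ∧ p ∈ F)
    (ht : wordProd g F a * adj (g e) * wordProd g F b = wordProd g F a * wordProd g F b * adj (g p))
    {F' : Finset ι} (hF' : ∀ q, q ≠ e → q ≠ p → (q ∈ F' ↔ q ∈ F)) (he : e ∈ F' ↔ e ∉ F)
    (hp : p ∈ F' ↔ p ∉ F) : wordProd g F' l = wordProd g F l := by
  subst h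
  simp only [List.nodup_append, List.nodup_cons, List.mem_append, List.mem_cons, not_or] at hl
  have ha : wordProd g F' a = wordProd g F a := wordProd_congr fun q hq => hF' q
    (fun h => hl.2.2 q hq e (by simp) h) fun h => hl.2.2 q hq p (by simp) h
  have hb : wordProd g F' b = wordProd g F b := wordProd_congr fun q hq => hF' q
    (fun h => hl.2.1.1.1 (h ▸ hq)) fun h => hl.2.1.2.2.2 q hq p (by simp) h
  have hc : wordProd g F' c = wordProd g F c := wordProd_congr fun q hq => hF' q
    (fun h => hl.2.1.1.2.2 (h ▸ hq)) fun h => hl.2.1.2.2.1.1 (h ▸ hq)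
  simp only [wordProd_append, wordProd_cons, ha, hb, hc, he, hp]
  rcases hep with ⟨h1, h2⟩ | ⟨h1, h2⟩
  · simp only [h1, h2, not_true, not_false_iff, if_true, if_false, one_mul]
    rw [← mul_assoc, ← mul_assoc, ht]
    group
  · simp only [h1, h2, not_true, not_false_iff, if_true, if_false, one_mul]
    rw [← mul_assoc, ← mul_assoc, ← mul_assoc, ← mul_assoc, ht]

/-- The root of `e` exchanges two values below `m`. The reversal inverts this pair, so by
`exists_root` some letter outside `F` has the same root, and it can take the place of `e`. The two
cases are the possible orders of the letters in the word. -/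
theorem IsFacet.exists_flip {m : ℕ} {l : List ι} (hg : ∀ e ∈ l, g e + 1 < m) (hl : l.Nodup)
    {F : Finset ι} (hF : IsFacet g m l F) {e : ι} (he : e ∈ F) :
    ∃ p, p ∉ F ∧ IsFacet g m l (insert p (F.erase e)) := by
  obtain ⟨a, b, hab⟩ := List.append_of_mem (List.mem_toFinset.1 (hF.subset he))
  have hga : ∀ e ∈ a, g e + 1 < m := fun q hq => hg q (by simp [hab, hq])
  have hge := hg e (by simp [hab])
  set w := wordProd g F a with hw
  have hfix : ∀ i, m ≤ i → w i = i := by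
    simpa using wordProd_fix (F := F) hga (w := 1) (fun i _ => rfl)
  have hx := lt_of_fix hfix (i := g e) (by omega)
  have hy := lt_of_fix hfix hge
  have hne : w (g e) ≠ w (g e + 1) := fun h => by
    have := w.injective h
    omega
  obtain ⟨l₁, p, l₂, hp, hpF, hr⟩ := exists_root (g := g) (F := F) (l := l) (w := 1)
    (x := w (g e)) (y := w (g e + 1)) (by
      rw [one_mul, hF.prod, reversal_inv, reversal_apply, reversal_apply, if_pos hx, if_pos hy,
        inv_one, Perm.one_apply, Perm.one_apply]
      omega)
  rw [one_mul, ← conj_adj, ← conj_adj] at hr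
  have hpe : p ≠ e := fun h => hpF (h ▸ he)
  have hpl : p ∈ l := by simp [hp]
  refine ⟨p, hpF, ⟨?_, ?_, ?_⟩⟩
  · intro q hq
    rcases mem_insert.1 hq with rfl | hq
    · exact List.mem_toFinset.2 hpl
    · exact hF.subset (mem_of_mem_erase hq)
  · rw [card_insert_of_notMem (fun h => hpF (mem_of_mem_erase h)), card_erase_add_one he, hF.card]
  · have h1 : ∀ q, q ≠ e → q ≠ p → (q ∈ insert p (F.erase e) ↔ q ∈ F) := fun q h1 h2 => by
      simp [h1, h2]
    have h2 : e ∈ insert p (F.erase e) ↔ e ∉ F := by simp [he, hpe.symm]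
    have h3 : p ∈ insert p (F.erase e) ↔ p ∉ F := by simp [hpF]
    rw [← hF.prod]
    rcases List.append_eq_append_iff.1 (hab.symm.trans hp) with ⟨c, h4, h5⟩ | ⟨c, h4, h5⟩
    · rcases List.cons_eq_append_iff.1 h5 with ⟨rfl, h6⟩ | ⟨c', rfl, h6⟩
      · exact absurd (List.cons.inj h6).1 hpe
      · refine wordProd_flip hl (hab.trans (by rw [h6])) (Or.inl ⟨he, hpF⟩) ?_ h1 h2 h3
        rw [h4, wordProd_append, wordProd_cons, if_pos he, one_mul, ← hw] at hr
        rw [← hw]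
        calc w * adj (g e) * wordProd g F c' = w * adj (g e) * w⁻¹ * (w * wordProd g F c') :=
            by group
          _ = _ := by rw [← hr]; group
    · rcases List.cons_eq_append_iff.1 h5 with ⟨rfl, h6⟩ | ⟨c', rfl, h6⟩
      · exact absurd (List.cons.inj h6).1 hpe.symm
      · refine wordProd_flip hl (hp.trans (by rw [h6])) (Or.inr ⟨hpF, he⟩) ?_
          (fun q h4 h5 => h1 q h5 h4) h3 h2
        rw [hw, h4, wordProd_append, wordProd_cons, if_neg hpF] at hr
        set u := wordProd g F l₁
        set v := wordProd g F c'
        -- When `p` precedes `e`, the prefix before `e` already applies `p`. By the equality of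
        -- roots, applying `e` as well cancels it.
        have h7 : u * (adj (g p) * v) * adj (g e) = u * v := by
          calc u * (adj (g p) * v) * adj (g e) =
              u * (adj (g p) * v) * adj (g e) * (u * (adj (g p) * v))⁻¹ * (u * (adj (g p) * v)) :=
                  by
                group
            _ = u * (adj (g p) * adj (g p)) * v := by rw [← hr]; group
            _ = u * v := by rw [adj_mul_self, mul_one]
        rw [← h7, mul_assoc _ (adj (g e)), adj_mul_self, mul_one, mul_assoc]

end Words

end Subword

namespace Subword

open Equiv

/-! ### Cliques of crossing edges, and permutations seen through their level sets. -/

section Cliques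

variable {α : Type*} (r : α → α → Bool)

/-- Whether the list contains `n` elements that are pairwise related by `r`. -/
def hasClique : ℕ → List α → Bool
  | 0 => fun _ => true
  | n + 1 => fun l => List.rec false (fun a t b => hasClique n (t.filter (r a)) || b) l

variable {r}

theorem exists_of_hasClique [DecidableEq α] (hr : ∀ a b, r a b = r b a) {n : ℕ} {l : List α}
    (hl : l.Nodup) (h : hasClique r n l = true) :
    ∃ C ⊆ l.toFinset, #C = n ∧ ∀ a ∈ C, ∀ b ∈ C, a ≠ b → r a b = true := by
  induction n generalizing l with
  | zero => exact ⟨∅, by simp⟩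
  | succ n ih =>
    induction l with
    | nil => simp [hasClique] at h
    | cons a t iht =>
      obtain ⟨hat, ht⟩ := List.nodup_cons.1 hl
      have h' : hasClique r n (t.filter (r a)) = true ∨ hasClique r (n + 1) t = true := by
        simpa [hasClique] using h
      rcases h' with h' | h'
      · obtain ⟨C, hC, hn, hCr⟩ := ih (ht.filter _) h'
        have hCt : ∀ b ∈ C, b ∈ t ∧ r a b = true := fun b hb => by simpa using hC hb
        refine ⟨insert a C, ?_, ?_, ?_⟩
        · intro b hb
          rcases mem_insert.1 hb with rfl | hb
          · simp
          · simpa using Or.inr (hCt b hb).1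
        · rw [card_insert_of_notMem (fun h => hat (hCt a h).1), hn]
        · intro b hb c hc hbc
          rcases mem_insert.1 hb with hb' | hb' <;> rcases mem_insert.1 hc with hc' | hc'
          · exact absurd (hb'.trans hc'.symm) hbc
          · exact hb' ▸ (hCt c hc').2
          · rw [hr]
            exact hc' ▸ (hCt b hb').2
          · exact hCr b hb' c hc' hbc
      · obtain ⟨C, hC, h⟩ := iht ht h'
        exact ⟨C, fun b hb => by simpa using Or.inr (List.mem_toFinset.1 (hC hb)), h⟩

end Cliques

/-- The generator labelling the relevant edge `{i, j}` of a polygon. -/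
def edgeGen (k : ℕ) (e : ℕ × ℕ) : ℕ := e.2 - e.1 - (k + 1)

/-- Whether the edges `{i, j}` and `{i', j'}` cross. -/
def edgeCross (e f : ℕ × ℕ) : Bool :=
  (Nat.blt e.1 f.1 && Nat.blt f.1 e.2 && Nat.blt e.2 f.2) ||
    (Nat.blt f.1 e.1 && Nat.blt e.1 f.2 && Nat.blt f.2 e.2)

theorem edgeCross_comm (e f : ℕ × ℕ) : edgeCross e f = edgeCross f e := by
  rw [edgeCross, edgeCross, Bool.or_comm]

/-- The indicator of the positions, among the first `m`, of the values `≥ t` of a permutation. -/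
def levelSet (m t : ℕ) (w : ℕ → ℕ) : List Bool := (List.range m).map fun j => Nat.ble t (w j)

/-- Exchange the entries of a list at the positions `a` and `a + 1`. -/
def swapAt {α : Type*} (d : α) (a : ℕ) (S : List α) : List α :=
  (List.range S.length).map fun j => S.getD (if j = a then a + 1 else if j = a + 1 then a else j) d

theorem getD_map_range {α : Type*} {m j : ℕ} (hj : j < m) (f : ℕ → α) (d : α) :
    ((List.range m).map f).getD j d = f j := by
  simp [List.getD_eq_getElem?_getD, hj]

theorem swapAt_map_range {α : Type*} {m a : ℕ} (ha : a + 1 < m) (f : ℕ → α) (d : α) :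
    swapAt d a ((List.range m).map f) = (List.range m).map (f ∘ adj a) := by
  rw [swapAt, List.length_map, List.length_range]
  refine List.map_congr_left fun j hj => ?_
  rw [List.mem_range] at hj
  rw [← adj_apply, Function.comp_apply, getD_map_range]
  rw [adj_apply]
  split_ifs <;> omega

/-- Whether the entries at the positions `a` and `a + 1` are `false` and `true`. -/
def canSwap (a : ℕ) (S : List Bool) : Bool := !(S.getD a false) && S.getD (a + 1) false

theorem canSwap_levelSet {m t a : ℕ} (ha : a + 1 < m) (w : ℕ → ℕ) :
    canSwap a (levelSet m t w) = true ↔ w a < t ∧ t ≤ w (a + 1) := by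
  rw [canSwap, levelSet, getD_map_range (by omega), getD_map_range ha]
  simp only [Bool.and_eq_true, Bool.not_eq_true', Nat.ble_eq, ← Bool.not_eq_true, not_le]

/-- A length-increasing transposition changes the level set only when its two values lie on
different sides of the threshold. Conversely a movable level set forces the length to increase. Each
level set therefore evolves under the greedy product independently of the others, with at most `2 ^
m` states. -/
theorem levelSet_mul_adj {m t a : ℕ} (ha : a + 1 < m) {w : Perm ℕ} (h : w a < w (a + 1)) :
    levelSet m t (w * adj a : Perm ℕ) =
      if canSwap a (levelSet m t w) then swapAt false a (levelSet m t w) else levelSet m t w := by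
  split_ifs with hc
  · rw [levelSet, levelSet, swapAt_map_range ha]
    rfl
  · rw [canSwap_levelSet ha] at hc
    refine List.map_congr_left fun j _ => ?_
    rw [Perm.mul_apply, adj_apply]
    rw [Bool.eq_iff_iff, Nat.ble_eq, Nat.ble_eq]
    split_ifs with h1 h2
    · subst h1; omega
    · subst h2; omega
    · rfl

theorem reversal_of_levelSet {m : ℕ} {w : Perm ℕ} (hw : ∀ i, m ≤ i → w i = i)
    (h : ∀ t < m, levelSet m t w = levelSet m t (reversal m)) : w = reversal m := by
  have h' : ∀ t < m, ∀ j < m, (t ≤ w j ↔ t ≤ m - 1 - j) := fun t ht j hj => by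
    have := congrArg (fun S => S.getD j false) (h t ht)
    simp only [levelSet, getD_map_range hj, reversal_apply, if_pos hj] at this
    rw [← Nat.ble_eq, this, Nat.ble_eq]
  refine reversal_of_forall (fun j hj => ?_) hw
  have h1 := lt_of_fix hw hj
  have h2 := (h' (w j) h1 j hj).1 le_rfl
  have h3 := (h' (m - 1 - j) (by omega) j hj).2 le_rfl
  omega

/-- The binary code of a list of Booleans. -/
def maskCode : List Bool → ℕ
  | [] => 0
  | b :: S => (bif b then 1 else 0) + 2 * maskCode S

theorem maskCode_inj {S T : List Bool} (hl : S.length = T.length) (h : maskCode S = maskCode T) :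
    S = T := by
  induction S generalizing T with
  | nil => exact (List.length_eq_zero_iff.1 hl.symm).symm
  | cons b S ih =>
    cases T with
    | nil => simp at hl
    | cons c T =>
      rw [maskCode, maskCode] at h
      have h1 : b = c ∧ maskCode S = maskCode T := by
        cases b <;> cases c <;> simp only [cond_true, cond_false] at h <;>
          refine ⟨by first | rfl | omega, by omega⟩
      rw [h1.1, ih (by simpa using hl) h1.2]

/-- The lists of Booleans of a given length. -/
def boolLists : ℕ → List (List Bool)
  | 0 => [[]]
  | m + 1 => (boolLists m).flatMap fun S => [false :: S, true :: S]

theorem mem_boolLists {m : ℕ} {S : List Bool} : S ∈ boolLists m ↔ S.length = m := by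
  induction m generalizing S with
  | zero => simp [boolLists]
  | succ m ih =>
    cases S with
    | nil => simp [boolLists]
    | cons b S => cases b <;> simp [boolLists, ih]

/-- Test whether the bits `a` and `a + 1` of a code are `0` and `1`. -/
def codeCanSwap (a S : ℕ) : Bool := Nat.beq (Nat.land (Nat.shiftRight S a) 3) 2

/-- The check that codes behave like lists of Booleans of length `m`, and that the codes that can be
swapped at `a` are among the bits of `masks a`. -/
def codeCheck (m : ℕ) (masks : List ℕ) : Bool :=
  (boolLists m).all fun S => (List.range (m - 1)).all fun a =>
    codeCanSwap a (maskCode S) == canSwap a S && (!canSwap a S ||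
      ((masks.getD a 0).testBit (maskCode S) && maskCode (swapAt false a S) + 2 ^ a == maskCode S))

theorem codeCheck_spec {m : ℕ} {masks : List ℕ} (h : codeCheck m masks = true) {a : ℕ}
    (ha : a + 1 < m) (t : ℕ) (w : ℕ → ℕ) :
    codeCanSwap a (maskCode (levelSet m t w)) = canSwap a (levelSet m t w) ∧
      (canSwap a (levelSet m t w) = true →
        (masks.getD a 0).testBit (maskCode (levelSet m t w)) = true ∧
        maskCode (swapAt false a (levelSet m t w)) + 2 ^ a = maskCode (levelSet m t w)) := by
  have h1 := List.all_eq_true.1 h (levelSet m t w) (mem_boolLists.2 (by simp [levelSet]))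
  have h2 := List.all_eq_true.1 h1 a (List.mem_range.2 (by omega))
  rw [Bool.and_eq_true, beq_iff_eq, Bool.or_eq_true, Bool.and_eq_true, beq_iff_eq] at h2
  refine ⟨h2.1, fun h3 => ?_⟩
  rcases h2.2 with h4 | h4
  · simp [h3] at h4
  · exact h4

/-- Evaluate `x` before passing it on. -/
@[reducible] def force {α : Type} (d : α) (x : ℕ) (k : ℕ → α) : α :=
  Nat.rec d (fun y _ => k y) (Nat.succ x)

/-! #### Crossing-free sets lie in facets -/

/-- Follow the code `S` of the positions of the largest values along the greedy word: each letter
that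
can move `S` does so, unless it belongs to a crossing-free set, the letters `f` being already known
to. The result is `true` if `S` always ends at `T`. -/
def greedyCheck (k T : ℕ) : List (ℕ × ℕ) → ℕ → List (ℕ × ℕ) → Bool
  | [], S, _ => Nat.beq S T
  | e :: l, S, f => force false (edgeGen k e) fun a =>
      bif codeCanSwap a S then
        force false (S - 2 ^ a) (fun S' => greedyCheck k T l S' f) &&
          (hasClique edgeCross k (f.filter (edgeCross e)) || greedyCheck k T l S (e :: f))
      else greedyCheck k T l S f

section Edges

variable {ι : Type*} [DecidableEq ι] {k m : ℕ} {E : ι → ℕ × ℕ}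

/-- The set `G` has no `k + 1` pairwise crossing elements. -/
def CrossFree (k : ℕ) (E : ι → ℕ × ℕ) (G : Finset ι) : Prop :=
  ∀ C ⊆ G, #C = k + 1 → ∃ a ∈ C, ∃ b ∈ C, a ≠ b ∧ edgeCross (E a) (E b) = false

/-- The letters not in `G` that increase the length are applied one after the other. -/
def greedy (g : ι → ℕ) (G : Finset ι) : List ι → Perm ℕ → Perm ℕ
  | [], w => w
  | e :: l, w => if e ∉ G ∧ w (g e) < w (g e + 1) then greedy g G l (w * adj (g e))
      else greedy g G l w

theorem greedy_fix {g : ι → ℕ} {G : Finset ι} {l : List ι} (hg : ∀ e ∈ l, g e + 1 < m)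
    {w : Perm ℕ} (hw : ∀ i, m ≤ i → w i = i) : ∀ i, m ≤ i → greedy g G l w i = i := by
  induction l generalizing w with
  | nil => exact hw
  | cons e l ih =>
    have hg' := fun e' he' => hg e' (List.mem_cons_of_mem e he')
    rw [greedy]
    split_ifs
    · exact ih hg' fun i hi => mul_adj_of_le (hg e List.mem_cons_self) hw hi
    · exact ih hg' hw

/-- Letters passed over because they do not increase the length are added to `G`; the remaining
letters form a reduced word. -/
theorem exists_reduced_of_greedy {g : ι → ℕ} {G : Finset ι} {l : List ι} (hl : l.Nodup)
    {w : Perm ℕ} (h : greedy g G l w = reversal m) :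
    ∃ F ⊆ l.toFinset, G ∩ l.toFinset ⊆ F ∧ Reduced g m F l w := by
  induction l generalizing w with
  | nil => exact ⟨∅, by simp, by simp, h⟩
  | cons e l ih =>
    obtain ⟨hel, hl⟩ := List.nodup_cons.1 hl
    rw [greedy] at h
    have hcongr : ∀ {F F' : Finset ι} {l : List ι} {w : Perm ℕ}, (∀ e ∈ l, e ∈ F ↔ e ∈ F') →
        Reduced g m F l w → Reduced g m F' l w := by
      intro F F' l
      induction l with
      | nil => exact fun _ h => h
      | cons e l ih =>
        intro w h1 h2
        have h1' := h1 e List.mem_cons_self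
        have ih' := fun {w} => ih (w := w) fun e' he' => h1 e' (List.mem_cons_of_mem e he')
        rcases h2 with ⟨h2, h3⟩ | ⟨h2, h3, h4⟩
        · exact Or.inl ⟨h1'.1 h2, ih' h3⟩
        · exact Or.inr ⟨fun h => h2 (h1'.2 h), h3, ih' h4⟩
    split_ifs at h with hc
    · obtain ⟨F, hF, hGF, hr⟩ := ih hl h
      refine ⟨F, fun q hq => ?_, fun q hq => ?_, Or.inr ⟨?_, hc.2, hr⟩⟩
      · simpa using Or.inr (List.mem_toFinset.1 (hF hq))
      · rw [List.toFinset_cons, mem_inter, mem_insert] at hq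
        rcases hq with ⟨hqG, rfl | hq⟩
        · exact absurd hqG hc.1
        · exact hGF (mem_inter.2 ⟨hqG, hq⟩)
      · exact fun h => hel (List.mem_toFinset.1 (hF h))
    · obtain ⟨F, hF, hGF, hr⟩ := ih hl h
      refine ⟨insert e F, fun q hq => ?_, fun q hq => ?_, Or.inl ⟨mem_insert_self _ _, ?_⟩⟩
      · rcases mem_insert.1 hq with rfl | hq
        · simp
        · simpa using Or.inr (List.mem_toFinset.1 (hF hq))
      · rw [List.toFinset_cons, mem_inter, mem_insert] at hq
        rcases hq with ⟨hqG, rfl | hq⟩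
        · exact mem_insert_self _ _
        · exact mem_insert_of_mem (hGF (mem_inter.2 ⟨hqG, hq⟩))
      · refine hcongr (fun q hq => ?_) hr
        rw [mem_insert, or_iff_right]
        exact fun h => hel (h ▸ hq)

/-- The set `G` is not enumerated. Membership of a letter matters only when that letter would move
the level set, so the search branches only there, and `f` records the letters assumed to be in `G`.
The branch with `e ∈ G` is void if `e` crosses `k` pairwise crossing letters of `f`. -/
theorem levelSet_greedy {t T : ℕ} {masks : List ℕ} (hc : codeCheck m masks = true)
    {G : Finset ι} (hG : CrossFree k E G) {l : List ι} (hl : l.Nodup)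
    (hg : ∀ e ∈ l, edgeGen k (E e) + 1 < m) {w : Perm ℕ} {f : List ι} (hf : f.Nodup)
    (hfl : ∀ e ∈ f, e ∈ G ∧ e ∉ l)
    (h : greedyCheck k T (l.map E) (maskCode (levelSet m t w)) (f.map E) = true) :
    maskCode (levelSet m t (greedy (fun e => edgeGen k (E e)) G l w)) = T := by
  induction l generalizing w f with
  | nil => exact Nat.eq_of_beq_eq_true h
  | cons e l ih =>
    obtain ⟨hel, hl⟩ := List.nodup_cons.1 hl
    have hg' : ∀ e ∈ l, edgeGen k (E e) + 1 < m := fun e' he' => hg e' (List.mem_cons_of_mem e he')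
    have hge := hg e List.mem_cons_self
    have hfl' : ∀ e ∈ f, e ∈ G ∧ e ∉ l := fun q hq =>
      ⟨(hfl q hq).1, fun h => (hfl q hq).2 (List.mem_cons_of_mem _ h)⟩
    rw [List.map_cons, greedyCheck] at h
    dsimp only [force] at h
    obtain ⟨hc1, hc2⟩ := codeCheck_spec hc hge t w
    rw [hc1] at h
    rw [greedy]
    cases hcs : canSwap (edgeGen k (E e)) (levelSet m t w) with
    | true =>
      rw [hcs, cond_true, Bool.and_eq_true, Bool.or_eq_true] at h
      have hlt := (canSwap_levelSet hge _).1 hcs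
      have hlt' : w (edgeGen k (E e)) < w (edgeGen k (E e) + 1) := by omega
      by_cases heG : e ∈ G
      · rw [if_neg (by simp [heG])]
        have hef : e ∉ f := fun h => (hfl e h).2 List.mem_cons_self
        rcases h.2 with h | h
        · exfalso
          have hmap : (f.map E).filter (edgeCross (E e)) =
              (f.filter fun q => edgeCross (E e) (E q)).map E := by
            rw [List.filter_map]
            rfl
          have hcl : ∀ (n : ℕ) (l : List ι), hasClique edgeCross n (l.map E) =
              hasClique (fun a b => edgeCross (E a) (E b)) n l := by
            intro n
            induction n with
            | zero => exact fun _ => rfl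
            | succ n ihn =>
              intro l
              induction l with
              | nil => rfl
              | cons a l ihl =>
                have h1 : ∀ (r : ι → ι → Bool) (a : ι) (l : List ι), hasClique r (n + 1) (a :: l) =
                  (hasClique r n (l.filter (r a)) || hasClique r (n + 1) l) := fun _ _ _ => rfl
                have h2 : ∀ (r : ℕ × ℕ → ℕ × ℕ → Bool) (a : ℕ × ℕ) (l : List (ℕ × ℕ)),
                  hasClique r (n + 1) (a :: l) =
                  (hasClique r n (l.filter (r a)) || hasClique r (n + 1) l) := fun _ _ _ => rfl
                rw [List.map_cons, h2, ihl, h1, ← ihn, List.filter_map]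
                rfl
          rw [hmap, hcl] at h
          obtain ⟨C, hC, hn, hCr⟩ := exists_of_hasClique
            (r := fun a b => edgeCross (E a) (E b)) (fun a b => edgeCross_comm _ _) (hf.filter _) h
          have hCf : ∀ b ∈ C, b ∈ f ∧ edgeCross (E e) (E b) = true := fun b hb => by
            simpa using hC hb
          obtain ⟨a, ha, b, hb, hab, hcr⟩ := hG (insert e C)
            (insert_subset heG fun b hb => (hfl b (hCf b hb).1).1)
            (by rw [card_insert_of_notMem (fun h => hef (hCf e h).1), hn])
          rw [← Bool.not_eq_true] at hcr
          refine hcr ?_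
          rcases mem_insert.1 ha with ha' | ha' <;> rcases mem_insert.1 hb with hb' | hb'
          · exact absurd (ha'.trans hb'.symm) hab
          · exact ha' ▸ (hCf b hb').2
          · rw [edgeCross_comm]
            exact hb' ▸ (hCf a ha').2
          · exact hCr a ha' b hb' hab
        · refine ih hl hg' (f := e :: f) (List.nodup_cons.2 ⟨hef, hf⟩) ?_ h
          intro q hq
          rcases List.mem_cons.1 hq with rfl | hq
          · exact ⟨heG, hel⟩
          · exact hfl' q hq
      · rw [if_pos ⟨heG, hlt'⟩]
        refine ih hl hg' hf hfl' ?_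
        rw [levelSet_mul_adj hge hlt', if_pos hcs, Nat.eq_sub_of_add_eq (hc2 hcs).2]
        exact h.1
    | false =>
      rw [hcs, cond_false] at h
      split_ifs with hlt
      · refine ih hl hg' hf hfl' ?_
        rw [levelSet_mul_adj hge hlt.2, if_neg (by simp [hcs])]
        exact h
      · exact ih hl hg' hf hfl' h

/-- The check that every set of letters without `k + 1` pairwise crossing ones lies in a facet. -/
def fillCheck (k m : ℕ) (P : List (ℕ × ℕ)) : Bool :=
  (List.range m).all fun t =>
    force false (maskCode (levelSet m t fun j => m - 1 - j)) fun T =>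
      force false (maskCode (levelSet m t id)) fun S => greedyCheck k T P S []

theorem exists_facet_of_fillCheck {masks : List ℕ} (hc : codeCheck m masks = true)
    {l : List ι} (hl : l.Nodup)
    (hg : ∀ e ∈ l, edgeGen k (E e) + 1 < m) (h : fillCheck k m (l.map E) = true) {G : Finset ι}
    (hGl : G ⊆ l.toFinset) (hG : CrossFree k E G) :
    ∃ F, IsFacet (fun e => edgeGen k (E e)) m l F ∧ G ⊆ F := by
  have h1 : greedy (fun e => edgeGen k (E e)) G l 1 = reversal m := by
    refine reversal_of_levelSet (greedy_fix hg fun _ _ => rfl) fun t ht => ?_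
    have h2 : levelSet m t (reversal m) = levelSet m t fun j => m - 1 - j :=
      List.map_congr_left fun j hj => by
        rw [reversal_apply, if_pos (List.mem_range.1 hj)]
    rw [h2]
    refine maskCode_inj (by simp [levelSet]) ?_
    refine levelSet_greedy hc hG hl hg (f := []) List.nodup_nil (by simp) ?_
    exact List.all_eq_true.1 h t (List.mem_range.2 ht)
  obtain ⟨F, hF, hGF, hr⟩ := exists_reduced_of_greedy hl h1
  exact ⟨F, (isFacet_iff hg hl).2 ⟨hF, hr⟩, fun e he => hGF (mem_inter.2 ⟨he, hGl he⟩)⟩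

/-! #### Facets are crossing-free -/

/-- Run through the sets `C` of pairwise crossing letters, keeping track of the set of bits `X` of
the
codes of the positions of the largest values that can be attained without the letters in `C`. The
result is `true` if one of the codes in `T` cannot be attained without `k + 1` such letters. -/
def crossCheck (k : ℕ) (masks T : List ℕ) : List (ℕ × ℕ) → List (ℕ × ℕ) → ℕ → Bool
  | [], C, X => Nat.ble C.length k || T.any fun t => !X.testBit t
  | e :: l, C, X =>
    force false (edgeGen k e) (fun a =>
      force false (Nat.lor X (Nat.shiftRight (Nat.land X (masks.getD a 0)) (2 ^ a)))
        fun X' => crossCheck k masks T l C X') &&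
    (Nat.ble (k + 1) C.length || !C.all (edgeCross e) || crossCheck k masks T l (e :: C) X)

/-- For a crossing set `C`, each letter outside `C` may or may not be applied, so the attainable
codes are over-approximated by a set that only grows. A facet containing `C` makes the codes of all
level sets of the reversal attainable, hence the check returns `false`. -/
theorem not_crossCheck {masks : List ℕ} (hc : codeCheck m masks = true) {F C : Finset ι}
    (hCF : C ⊆ F) (hC : #C = k + 1)
    (hCr : ∀ a ∈ C, ∀ b ∈ C, a ≠ b → edgeCross (E a) (E b) = true)
    {l : List ι} (hl : l.Nodup) (hg : ∀ e ∈ l, edgeGen k (E e) + 1 < m) {w : Perm ℕ}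
    (hF : Reduced (fun e => edgeGen k (E e)) m F l w) {f : List ι} (hf : f.Nodup)
    (hfl : ∀ e ∈ f, e ∈ C ∧ e ∉ l) (hCl : ∀ e ∈ C, e ∈ f ∨ e ∈ l) {X : ℕ}
    (hX : ∀ t < m, X.testBit (maskCode (levelSet m t w)) = true) :
    crossCheck k masks ((List.range m).map fun t => maskCode (levelSet m t fun j => m - 1 - j))
      (l.map E) (f.map E) X = false := by
  induction l generalizing w f X with
  | nil =>
    obtain rfl : w = reversal m := hF
    have h1 : f.length = k + 1 := by
      rw [← hC, ← List.toFinset_card_of_nodup hf]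
      congr 1
      ext e
      rw [List.mem_toFinset]
      exact ⟨fun h => (hfl e h).1, fun h => (hCl e h).resolve_right List.not_mem_nil⟩
    rw [← Bool.not_eq_true, List.map_nil, crossCheck, Bool.or_eq_true, Nat.ble_eq,
      List.length_map, h1, List.any_eq_true]
    rintro (h | ⟨T, hT, h⟩)
    · omega
    · obtain ⟨t, ht, rfl⟩ := List.mem_map.1 hT
      have h2 : levelSet m t (reversal m) = levelSet m t fun j => m - 1 - j :=
        List.map_congr_left fun j hj => by
          rw [reversal_apply, if_pos (List.mem_range.1 hj)]
      have h3 := hX t (List.mem_range.1 ht)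
      rw [h2] at h3
      simp [h3] at h
  | cons e l ih =>
    obtain ⟨hel, hl⟩ := List.nodup_cons.1 hl
    have hg' : ∀ e ∈ l, edgeGen k (E e) + 1 < m := fun e' he' => hg e' (List.mem_cons_of_mem e he')
    have hge := hg e List.mem_cons_self
    have hfl' : ∀ e ∈ f, e ∈ C ∧ e ∉ l := fun q hq =>
      ⟨(hfl q hq).1, fun h => (hfl q hq).2 (List.mem_cons_of_mem _ h)⟩
    have hef : e ∉ f := fun h => (hfl e h).2 List.mem_cons_self
    rw [← Bool.not_eq_true, List.map_cons, crossCheck]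
    dsimp only [force]
    rw [Bool.and_eq_true]
    rintro ⟨h1, h2⟩
    by_cases heC : e ∈ C
    · rw [Bool.or_eq_true, Bool.or_eq_true, Nat.ble_eq, List.length_map] at h2
      rcases hF with ⟨heF, hF⟩ | ⟨heF, -⟩
      · rcases h2 with (h2 | h2) | h2
        · have h3 : f.toFinset ⊆ C.erase e := fun q hq => by
            rw [List.mem_toFinset] at hq
            exact mem_erase.2 ⟨fun h => hef (h ▸ hq), (hfl q hq).1⟩
          have h4 := card_le_card h3
          rw [List.toFinset_card_of_nodup hf, card_erase_of_mem heC] at h4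
          omega
        · rw [Bool.not_eq_true', ← Bool.not_eq_true, List.all_eq_true] at h2
          refine h2 fun q hq => ?_
          obtain ⟨q, hq', rfl⟩ := List.mem_map.1 hq
          exact hCr e heC q (hfl q hq').1 fun h => hef (h ▸ hq')
        · have := ih hl hg' hF (f := e :: f) (List.nodup_cons.2 ⟨hef, hf⟩)
            (fun q hq => by
              rcases List.mem_cons.1 hq with rfl | hq
              · exact ⟨heC, hel⟩
              · exact hfl' q hq)
            (fun q hq => by
              rcases hCl q hq with h | h
              · exact Or.inl (List.mem_cons_of_mem _ h)
              · rcases List.mem_cons.1 h with rfl | h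
                · exact Or.inl List.mem_cons_self
                · exact Or.inr h) hX
          rw [List.map_cons, h2] at this
          exact Bool.noConfusion this
      · exact heF (hCF heC)
    · have hCl' : ∀ e ∈ C, e ∈ f ∨ e ∈ l := fun q hq => by
        rcases hCl q hq with h | h
        · exact Or.inl h
        · rcases List.mem_cons.1 h with rfl | h
          · exact absurd hq heC
          · exact Or.inr h
      rw [← Bool.not_eq_false] at h1
      rcases hF with ⟨heF, hF⟩ | ⟨heF, hlt, hF⟩
      · refine h1 (ih hl hg' hF hf hfl' hCl' fun t ht => ?_)
        have := hX t ht
        exact (Nat.testBit_or _ _ _).trans (by rw [this, Bool.true_or])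
      · refine h1 (ih hl hg' hF hf hfl' hCl' fun t ht => ?_)
        have h3 := hX t ht
        rw [levelSet_mul_adj hge hlt]
        refine (Nat.testBit_or _ _ _).trans ?_
        obtain ⟨-, hc2⟩ := codeCheck_spec hc hge t w
        split_ifs with hcs
        · have h4 : (Nat.shiftRight (Nat.land X (masks.getD (edgeGen k (E e)) 0))
              (2 ^ edgeGen k (E e))).testBit (maskCode (swapAt false (edgeGen k (E e))
                (levelSet m t w))) = true := by
            refine (Nat.testBit_shiftRight _).trans ?_
            rw [add_comm, (hc2 hcs).2]
            exact (Nat.testBit_and _ _ _).trans (by rw [h3, (hc2 hcs).1]; rfl)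
          rw [h4, Bool.or_true]
        · rw [h3, Bool.true_or]

/-- The check that no facet contains `k + 1` pairwise crossing letters. -/
def crossFreeCheck (k m : ℕ) (masks : List ℕ) (P : List (ℕ × ℕ)) : Bool :=
  force false (((List.range m).map fun t => 2 ^ maskCode (levelSet m t id)).foldr Nat.lor 0)
      fun X =>
    crossCheck k masks ((List.range m).map fun t => maskCode (levelSet m t fun j => m - 1 - j))
        P [] X

theorem crossFree_of_isFacet {masks : List ℕ} (hc : codeCheck m masks = true) {l : List ι}
    (hl : l.Nodup) (hg : ∀ e ∈ l, edgeGen k (E e) + 1 < m)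
    (h : crossFreeCheck k m masks (l.map E) = true) {F : Finset ι}
    (hF : IsFacet (fun e => edgeGen k (E e)) m l F) : CrossFree k E F := by
  intro C hCF hC
  by_contra! hcon
  have hr := ((isFacet_iff hg hl).1 hF)
  have := not_crossCheck hc hCF hC (fun a ha b hb hab => by simpa using hcon a ha b hb hab) hl hg
    hr.2 (f := []) List.nodup_nil (by simp)
    (fun e he => Or.inr (List.mem_toFinset.1 (hr.1 (hCF he))))
    (X := ((List.range m).map fun t => 2 ^ maskCode (levelSet m t id)).foldr Nat.lor 0) ?_
  · rw [crossFreeCheck] at h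
    exact Bool.noConfusion (h.symm.trans this)
  · have key : ∀ (L : List ℕ), ∀ x ∈ L, ((L.map (2 ^ ·)).foldr Nat.lor 0).testBit x = true := by
      intro L
      induction L with
      | nil => simp
      | cons a L ihL =>
        intro x hx
        rw [List.map_cons, List.foldr_cons]
        refine (Nat.testBit_or _ _ _).trans ?_
        rcases List.mem_cons.1 hx with rfl | hx
        · rw [Nat.testBit_two_pow_self, Bool.true_or]
        · rw [ihL x hx, Bool.or_true]
    intro t ht
    have := key ((List.range m).map fun t => maskCode (levelSet m t id))
        (maskCode (levelSet m t id))
      (List.mem_map.2 ⟨t, List.mem_range.2 ht, rfl⟩)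
    rwa [List.map_map] at this

end Edges

end Subword

/-! ### A table-driven search through all facets. -/

namespace Subword

open Equiv

/-- The rank of a list in the lexicographic order of its rearrangements. -/
def rank : List ℕ → ℕ
  | [] => 0
  | a :: x => (x.filter fun b => Nat.blt b a).length * x.length.factorial + rank x

/-- The index of a permutation of `{0, …, m - 1}`. -/
def stateIdx (m : ℕ) (w : ℕ → ℕ) : ℕ := rank ((List.range m).map w)

/-- The `i`-th bit of `A`. -/
def bitAt (A i : ℕ) : ℕ := Nat.land (Nat.shiftRight A i) (nat_lit 1)

/-- The `i`-th entry of the table `T`, whose entries take ten bits each. -/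
def entryAt (T i : ℕ) : ℕ := Nat.land (Nat.shiftRight T (Nat.mul (nat_lit 10) i)) (nat_lit 1023)

/-- The check that `tabs` are the tables of right multiplications by adjacent transpositions,
wherever
these increase the length, and that all indices are less than `n`. -/
def tableCheck (m n : ℕ) (tabs : List ℕ) : Bool :=
  (List.range m).permutations'.all fun x =>
    force false (rank x) fun i => Nat.blt i n && (List.range (m - 1)).all fun a =>
      Nat.ble (x.getD (a + 1) 0) (x.getD a 0) || force false (rank (swapAt 0 a x)) fun j =>
        Nat.beq (entryAt (tabs.getD a 0) i) j && !Nat.beq j i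

theorem map_range_mem_permutations' {m : ℕ} {w : Perm ℕ} (hw : ∀ i, m ≤ i → w i = i) :
    (List.range m).map w ∈ (List.range m).permutations' := by
  rw [List.mem_permutations']
  refine List.Subperm.perm_of_length_le (List.subperm_of_subset ?_ ?_) (by simp)
  · exact List.nodup_range.map w.injective
  · intro i hi
    obtain ⟨j, hj, rfl⟩ := List.mem_map.1 hi
    exact List.mem_range.2 (lt_of_fix hw (List.mem_range.1 hj))

theorem tableCheck_spec {m n : ℕ} {tabs : List ℕ} (h : tableCheck m n tabs = true) {w : Perm ℕ}
    (hw : ∀ i, m ≤ i → w i = i) : stateIdx m w < n ∧ ∀ a, a + 1 < m → w a < w (a + 1) →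
      entryAt (tabs.getD a 0) (stateIdx m w) = stateIdx m (w * adj a : Perm ℕ) ∧
      stateIdx m (w * adj a : Perm ℕ) ≠ stateIdx m w := by
  have h1 := List.all_eq_true.1 h _ (map_range_mem_permutations' hw)
  dsimp only [force] at h1
  rw [Bool.and_eq_true, Nat.blt_eq] at h1
  refine ⟨h1.1, fun a ha hlt => ?_⟩
  have h2 := List.all_eq_true.1 h1.2 a (List.mem_range.2 (by omega))
  rw [getD_map_range ha, getD_map_range (by omega : a < m), swapAt_map_range ha, Bool.or_eq_true,
    Nat.ble_eq, Bool.and_eq_true, Bool.not_eq_true'] at h2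
  rcases h2 with h2 | h2
  · omega
  · exact ⟨Nat.eq_of_beq_eq_true h2.1, Nat.ne_of_beq_eq_false h2.2⟩

/-- The check that a state, all of whose successors are dead for the next mask, is dead unless
allowed
by the mask; a state is dead for a mask if its bit is `0`. -/
def maskCheck (k n fin : ℕ) (tabs : List ℕ) : List (ℕ × ℕ) → List ℕ → Bool
  | [], M => !Nat.beq (bitAt (M.headD 0) fin) 0
  | e :: l, M =>
    force false (M.headD 0) (fun A => force false (M.tail.headD 0) fun B =>
      force false (tabs.getD (edgeGen k e) 0) fun T => (List.range n).all fun i =>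
        !Nat.beq (bitAt A i) 0 || (Nat.beq (bitAt B i) 0 && Nat.beq (bitAt B (entryAt T i)) 0)) &&
    maskCheck k n fin tabs l M.tail

/-- The data attached to a letter: its table of states, a sign table, a mask of states, and the
position of the letter in packed vectors, which have one more entry at the end. -/
structure Step where
  tab : ℕ
  nu : ℕ
  mask : ℕ
  sh : ℕ

/-- The step of the letter `e`, followed by the letters `l`. -/
def stepOf (k W : ℕ) (tabs nus : List ℕ) (e : ℕ × ℕ) (l : List (ℕ × ℕ)) (A : ℕ) : Step :=
  ⟨tabs.getD (edgeGen k e) 0, nus.getD (edgeGen k e) 0, A, W * (l.length + 1)⟩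

/-- The steps of a word. -/
def stepsOf (k W : ℕ) (tabs nus : List ℕ) : List (ℕ × ℕ) → List ℕ → List Step
  | [], _ => []
  | e :: l, M => stepOf k W tabs nus e l (M.headD 0) :: stepsOf k W tabs nus l M.tail

/-- Evaluate the steps of a word before passing them on. -/
def forceSteps (k W : ℕ) (tabs nus : List ℕ) :
    List (ℕ × ℕ) → List ℕ → (List Step → Bool) → Bool
  | [], _, c => c []
  | e :: l, M, c =>
    force false (edgeGen k e) fun a => force false (tabs.getD a 0) fun t =>
      force false (nus.getD a 0) fun v => force false (M.headD 0) fun A =>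
        force false (W * (l.length + 1)) fun s =>
          forceSteps k W tabs nus l M.tail fun st => c (⟨t, v, A, s⟩ :: st)

theorem forceSteps_eq (k W : ℕ) (tabs nus : List ℕ) (l : List (ℕ × ℕ)) (M : List ℕ)
    (c : List Step → Bool) : forceSteps k W tabs nus l M c = c (stepsOf k W tabs nus l M) := by
  induction l generalizing M c with
  | nil => rfl
  | cons e l ih => exact ih M.tail _

/-- Run through all facets of a subword complex, keeping track of the state `i` of the word of
letters not in the facet and of further data, updated by `skip` for the letters of the facet and by
`apply` for the other ones, and check the condition `leaf` for the resulting data, if the final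
state
is `fin`. -/
def traverse {σ : Type} (skip apply : Step → ℕ → σ → (σ → Bool) → Bool) (leaf : σ → Bool) (fin : ℕ)
    :
    List Step → ℕ → σ → Bool :=
  -- `Bool.rec` takes the value at `false` first. Dead states, and final states other than `fin`,
  -- count as success; on a live state the two branches are joined by a lazy conjunction.
  List.rec (fun i s => Bool.rec true (leaf s) (Nat.beq i fin)) fun st _ ih i s =>
    Nat.rec true (fun _ _ =>
      Bool.rec false
        (force false (entryAt (Step.tab st) i) fun j =>
          Bool.rec (apply st i s (ih j)) true (Nat.beq j i))
        (skip st i s (ih i))) (bitAt (Step.mask st) i)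

section

variable {ι : Type*} [DecidableEq ι] {k m n W : ℕ} {tabs nus : List ℕ} {E : ι → ℕ × ℕ}

-- Every successor of a dead state is dead, and the reversal is alive at the end of the word. A
-- state from which the reversal is reached by a reduced word is therefore alive, and pruning loses
-- no facet.
omit [DecidableEq ι] in
theorem bitAt_ne_zero (htab : tableCheck m n tabs = true) {F : Finset ι} {l : List ι} {w : Perm ℕ}
    {M : List ℕ} (hmask : maskCheck k n (stateIdx m (reversal m)) tabs (l.map E) M = true)
    (hg : ∀ e ∈ l, edgeGen k (E e) + 1 < m) (hw : ∀ i, m ≤ i → w i = i)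
    (hF : Reduced (fun e => edgeGen k (E e)) m F l w) : bitAt (M.headD 0) (stateIdx m w) ≠ 0 := by
  induction l generalizing w M with
  | nil =>
    obtain rfl : w = reversal m := hF
    rw [List.map_nil, maskCheck, Bool.not_eq_true'] at hmask
    exact Nat.ne_of_beq_eq_false hmask
  | cons e l ih =>
    have hge := hg e List.mem_cons_self
    rw [List.map_cons, maskCheck, Bool.and_eq_true] at hmask
    dsimp only [force] at hmask
    obtain ⟨h1, h2⟩ := tableCheck_spec htab hw
    have h3 := List.all_eq_true.1 hmask.1 _ (List.mem_range.2 h1)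
    rw [Bool.or_eq_true, Bool.not_eq_true', Bool.and_eq_true] at h3
    have ih' := fun {w} => ih (w := w) hmask.2 fun e' he' => hg e' (List.mem_cons_of_mem _ he')
    rcases h3 with h3 | h3
    · exact Nat.ne_of_beq_eq_false h3
    · rcases hF with ⟨-, hF⟩ | ⟨-, hlt, hF⟩
      · exact absurd (Nat.eq_of_beq_eq_true h3.1) (ih' hw hF)
      · rw [(h2 _ hge hlt).1] at h3
        exact absurd (Nat.eq_of_beq_eq_true h3.2) (ih' (fun i hi => mul_adj_of_le hge hw hi) hF)

-- The facet `F` selects one branch of the search. The updates are in continuation-passing form, so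
-- success of the whole search yields at each letter a new state satisfying the invariant `I` on
-- which the continuation succeeds.
omit [DecidableEq ι] in
theorem exists_leaf_of_traverse {σ : Type} {skip apply : Step → ℕ → σ → (σ → Bool) → Bool}
    {leaf : σ → Bool} (htab : tableCheck m n tabs = true) {F : Finset ι}
    {I : List ι → Perm ℕ → σ → Prop}
    (hskip : ∀ e l w s A c, e ∈ F → I (e :: l) w s →
      skip (stepOf k W tabs nus (E e) (l.map E) A) (stateIdx m w) s c = true →
      ∃ s', I l w s' ∧ c s' = true)
    (happly : ∀ e l w s A c, e ∉ F → I (e :: l) w s →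
      apply (stepOf k W tabs nus (E e) (l.map E) A) (stateIdx m w) s c = true →
      ∃ s', I l (w * adj (edgeGen k (E e))) s' ∧ c s' = true)
    {l : List ι} {w : Perm ℕ} {M : List ℕ} {s : σ}
    (hmask : maskCheck k n (stateIdx m (reversal m)) tabs (l.map E) M = true)
    (hg : ∀ e ∈ l, edgeGen k (E e) + 1 < m) (hw : ∀ i, m ≤ i → w i = i)
    (hF : Reduced (fun e => edgeGen k (E e)) m F l w) (hI : I l w s)
    (h : traverse skip apply leaf (stateIdx m (reversal m)) (stepsOf k W tabs nus (l.map E) M)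
        (stateIdx m w) s = true) :
    ∃ w' s', I [] w' s' ∧ leaf s' = true := by
  induction l generalizing w M s with
  | nil =>
    obtain rfl : w = reversal m := hF
    refine ⟨_, s, hI, ?_⟩
    have h1 : (Bool.rec true (leaf s)
      (Nat.beq (stateIdx m (reversal m)) (stateIdx m (reversal m))) : Bool) = true := h
    rwa [Nat.beq_refl] at h1
  | cons e l ih =>
    have hge := hg e List.mem_cons_self
    have hbit := bitAt_ne_zero htab hmask hg hw hF
    have hmask' := hmask
    rw [List.map_cons, maskCheck, Bool.and_eq_true] at hmask'
    have ih' := fun {w s} => ih (w := w) (s := s) hmask'.2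
      fun e' he' => hg e' (List.mem_cons_of_mem _ he')
    obtain ⟨y, hy⟩ := Nat.exists_eq_succ_of_ne_zero hbit
    have h1 : (skip (stepOf k W tabs nus (E e) (l.map E) (M.headD 0)) (stateIdx m w) s
          (traverse skip apply leaf (stateIdx m (reversal m))
              (stepsOf k W tabs nus (l.map E) M.tail) (stateIdx m w)) = true) ∧
        (force false (entryAt (tabs.getD (edgeGen k (E e)) 0) (stateIdx m w)) fun j =>
          Bool.rec (apply (stepOf k W tabs nus (E e) (l.map E) (M.headD 0)) (stateIdx m w) s
            (traverse skip apply leaf (stateIdx m (reversal m))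
                (stepsOf k W tabs nus (l.map E) M.tail) j)) true
            (Nat.beq j (stateIdx m w))) = true := by
      have h2 : (Nat.rec true (fun _ _ => Bool.rec false
          (force false (entryAt (tabs.getD (edgeGen k (E e)) 0) (stateIdx m w)) fun j =>
          Bool.rec (apply (stepOf k W tabs nus (E e) (l.map E) (M.headD 0)) (stateIdx m w) s
            (traverse skip apply leaf (stateIdx m (reversal m))
                (stepsOf k W tabs nus (l.map E) M.tail) j)) true
            (Nat.beq j (stateIdx m w)))
          (skip (stepOf k W tabs nus (E e) (l.map E) (M.headD 0)) (stateIdx m w) s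
          (traverse skip apply leaf (stateIdx m (reversal m))
              (stepsOf k W tabs nus (l.map E) M.tail) (stateIdx m w))))
          (bitAt (M.headD 0) (stateIdx m w)) : Bool) = true := h
      rw [hy] at h2
      dsimp only at h2
      generalize skip _ _ _ _ = x at h2 ⊢
      cases x
      · exact Bool.noConfusion h2
      · exact ⟨rfl, h2⟩
    rcases hF with ⟨heF, hF⟩ | ⟨heF, hlt, hF⟩
    · obtain ⟨s', hs', hc⟩ := hskip e l w s _ _ heF hI h1.1
      exact ih' hw hF hs' hc
    · obtain ⟨h2, h3⟩ := (tableCheck_spec htab hw).2 _ hge hlt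
      have h4 := h1.2
      dsimp only [force] at h4
      rw [h2] at h4
      have h5 : Nat.beq (stateIdx m (w * adj (edgeGen k (E e)) : Perm ℕ)) (stateIdx m w) = false :=
          by
        rw [← Bool.not_eq_true]
        exact fun h => h3 (Nat.eq_of_beq_eq_true h)
      rw [h5] at h4
      obtain ⟨s', hs', hc⟩ := happly e l w s _ _ heF hI h4
      exact ih' (fun i hi => mul_adj_of_le hge hw hi) hF hs' hc

/-! #### Signs of flips -/

/-- The sum of the signs of the letters not in `F`. -/
def signSum (m k : ℕ) (E : ι → ℕ × ℕ) (nus : List ℕ) (F : Finset ι) : List ι → Perm ℕ → ℕ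
  | [], _ => 0
  | e :: l, w => if e ∈ F then signSum m k E nus F l w else
      bitAt (nus.getD (edgeGen k (E e)) 0) (stateIdx m w) +
        signSum m k E nus F l (w * adj (edgeGen k (E e)))

/-- The check of the coherence of the signs `nus` under flips, with respect to a table `H` of pairs
of
states, of the form `2 + h` if the pair is admissible. -/
def flipCheck (m n : ℕ) (tabs nus : List ℕ) (H : List ℕ) : Bool :=
  (List.range n).all fun i => force false (H.getD i 0) fun Hi =>
    (List.range (m - 1)).all fun a => force false (tabs.getD a 0) fun T =>
      force false (nus.getD a 0) fun V => force false (entryAt T i) fun j =>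
        Nat.beq j i || (Nat.beq (Nat.land (Nat.shiftRight Hi (2 * j)) 3) (2 + bitAt V i) &&
          force false (H.getD j 0) fun Hj => (List.range n).all fun i' =>
            force false (entryAt T i') fun j' => Nat.beq j' i' ||
              force false (Nat.land (Nat.shiftRight Hi (2 * i')) 3) fun x => Nat.blt x 2 ||
                Nat.beq (Nat.land (Nat.shiftRight Hj (2 * j')) 3)
                  (2 + (x + bitAt V i + bitAt V i' + 1) % 2))

/-- The entry of the table `H` for a pair of states. -/
def pairAt (H : List ℕ) (i j : ℕ) : ℕ := Nat.land (Nat.shiftRight (H.getD i 0) (2 * j)) 3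

theorem flipCheck_spec {H : List ℕ} (htab : tableCheck m n tabs = true)
    (h : flipCheck m n tabs nus H = true) {w : Perm ℕ} (hw : ∀ i, m ≤ i → w i = i) {a : ℕ}
    (ha : a + 1 < m) (hlt : w a < w (a + 1)) :
    pairAt H (stateIdx m w) (stateIdx m (w * adj a : Perm ℕ)) =
        2 + bitAt (nus.getD a 0) (stateIdx m w) ∧
      ∀ w' : Perm ℕ, (∀ i, m ≤ i → w' i = i) → w' a < w' (a + 1) →
        2 ≤ pairAt H (stateIdx m w) (stateIdx m w') →
        pairAt H (stateIdx m (w * adj a : Perm ℕ)) (stateIdx m (w' * adj a : Perm ℕ)) =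
          2 + (pairAt H (stateIdx m w) (stateIdx m w') + bitAt (nus.getD a 0) (stateIdx m w) +
            bitAt (nus.getD a 0) (stateIdx m w') + 1) % 2 := by
  obtain ⟨h1, h2⟩ := tableCheck_spec htab hw
  have h3 := List.all_eq_true.1 h _ (List.mem_range.2 h1)
  have h4 := List.all_eq_true.1 h3 a (List.mem_range.2 (by omega))
  dsimp only [force] at h4
  rw [(h2 a ha hlt).1, Bool.or_eq_true, Bool.and_eq_true] at h4
  have h5 := h4.resolve_left fun h => (h2 a ha hlt).2 (Nat.eq_of_beq_eq_true h)
  refine ⟨Nat.eq_of_beq_eq_true h5.1, fun w' hw' hlt' hle => ?_⟩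
  obtain ⟨h1', h2'⟩ := tableCheck_spec htab hw'
  have h6 := List.all_eq_true.1 h5.2 _ (List.mem_range.2 h1')
  rw [(h2' a ha hlt').1, Bool.or_eq_true, Bool.or_eq_true] at h6
  rcases h6 with h6 | h6 | h6
  · exact absurd (Nat.eq_of_beq_eq_true h6) (h2' a ha hlt').2
  · rw [Nat.blt_eq] at h6
    exact absurd h6 (not_lt.2 hle)
  · exact Nat.eq_of_beq_eq_true h6

theorem signSum_congr {F F' : Finset ι} {l : List ι} (h : ∀ e ∈ l, e ∈ F ↔ e ∈ F') (w : Perm ℕ) :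
    signSum m k E nus F l w = signSum m k E nus F' l w := by
  induction l generalizing w with
  | nil => rfl
  | cons e l ih =>
    have ih' := ih fun e' he' => h e' (List.mem_cons_of_mem _ he')
    simp only [signSum, h e List.mem_cons_self, ih']

/-- Between the two letters of a flip, the words of the two facets read the same letters from states
`w` and `w'`. The table entry of the pair is `2 + h`, where `h` starts as the sign of `e` and
changes by the two local signs plus one at each common letter. At `p` it must equal the sign of `p`,
so the local signs add up to the number of common letters modulo two. -/
theorem signSum_pair {H : List ℕ} (htab : tableCheck m n tabs = true)
    (h : flipCheck m n tabs nus H = true) {F F' : Finset ι} {b c : List ι} {p : ι}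
    (hb : ∀ e ∈ b, e ∈ F ↔ e ∈ F') (hc : ∀ e ∈ c, e ∈ F ↔ e ∈ F') (hp : p ∉ F) (hp' : p ∈ F')
    (hg : ∀ e ∈ b ++ p :: c, edgeGen k (E e) + 1 < m) {w w' : Perm ℕ} (hw : ∀ i, m ≤ i → w i = i)
    (hw' : ∀ i, m ≤ i → w' i = i)
    (hF : Reduced (fun e => edgeGen k (E e)) m F (b ++ p :: c) w)
    (hF' : Reduced (fun e => edgeGen k (E e)) m F' (b ++ p :: c) w')
    (hle : 2 ≤ pairAt H (stateIdx m w) (stateIdx m w')) :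
    (signSum m k E nus F (b ++ p :: c) w + signSum m k E nus F' (b ++ p :: c) w' +
      pairAt H (stateIdx m w) (stateIdx m w')) % 2 = (b.filter (· ∉ F)).length % 2 := by
  induction b generalizing w w' with
  | nil =>
    rcases hF with ⟨h1, -⟩ | ⟨-, hlt, hF⟩
    · exact absurd h1 hp
    rcases hF' with ⟨-, hF'⟩ | ⟨h1, -⟩
    swap
    · exact absurd hp' h1
    have h1 : w' = w * adj (edgeGen k (E p)) := by
      have h2 := hF.mul_wordProd
      have h3 := hF'.mul_wordProd
      rw [wordProd_congr hc, ← h3] at h2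
      exact (mul_right_cancel h2).symm
    rw [List.nil_append, signSum, signSum, if_neg hp, if_pos hp', signSum_congr hc, ← h1,
        List.filter_nil,
      List.length_nil]
    have h2 := (flipCheck_spec htab h hw (hg p (by simp)) hlt).1
    rw [← h1] at h2
    omega
  | cons e b ih =>
    have hge := hg e (by simp)
    have ih' := fun {w w'} => ih (w := w) (w' := w')
        (fun e' he' => hb e' (List.mem_cons_of_mem _ he'))
      fun e' he' => hg e' (by simpa using Or.inr (by simpa using he'))
    have heF := hb e List.mem_cons_self
    rw [List.cons_append, signSum, signSum]
    rcases hF with ⟨h1, hF⟩ | ⟨h1, hlt, hF⟩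
    · rcases hF' with ⟨h1', hF'⟩ | ⟨h1', -⟩
      · rw [if_pos h1, if_pos h1', List.filter_cons_of_neg (by simpa using h1)]
        exact ih' hw hw' hF hF' hle
      · exact absurd (heF.1 h1) h1'
    · rcases hF' with ⟨h1', -⟩ | ⟨h1', hlt', hF'⟩
      · exact absurd (heF.2 h1') h1
      · have h2 := (flipCheck_spec htab h hw hge hlt).2 w' hw' hlt' hle
        have h3 := ih' (fun i hi => mul_adj_of_le hge hw hi)
          (fun i hi => mul_adj_of_le hge hw' hi) hF hF' (by rw [h2]; omega)
        rw [h2] at h3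
        rw [if_neg h1, if_neg h1', List.filter_cons_of_pos (by simpa using h1), List.length_cons]
        omega

/-- The change of the sum of signs in a flip. -/
theorem signSum_flip {H : List ℕ} (htab : tableCheck m n tabs = true)
    (h : flipCheck m n tabs nus H = true) {F F' : Finset ι} {a b c : List ι} {e p : ι}
    (ha : ∀ q ∈ a, q ∈ F ↔ q ∈ F') (hb : ∀ q ∈ b, q ∈ F ↔ q ∈ F') (hc : ∀ q ∈ c, q ∈ F ↔ q ∈ F')
    (he : e ∈ F) (he' : e ∉ F') (hp : p ∉ F) (hp' : p ∈ F')
    (hg : ∀ q ∈ a ++ e :: (b ++ p :: c), edgeGen k (E q) + 1 < m) {w : Perm ℕ}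
    (hw : ∀ i, m ≤ i → w i = i)
    (hF : Reduced (fun e => edgeGen k (E e)) m F (a ++ e :: (b ++ p :: c)) w)
    (hF' : Reduced (fun e => edgeGen k (E e)) m F' (a ++ e :: (b ++ p :: c)) w) :
    (signSum m k E nus F (a ++ e :: (b ++ p :: c)) w +
      signSum m k E nus F' (a ++ e :: (b ++ p :: c)) w) % 2 = (b.filter (· ∉ F)).length % 2 := by
  induction a generalizing w with
  | nil =>
    have hge := hg e (by simp)
    rw [List.nil_append, signSum, signSum, if_pos he, if_neg he']
    rcases hF with ⟨-, hF⟩ | ⟨h1, -⟩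
    swap
    · exact absurd he h1
    rcases hF' with ⟨h1, -⟩ | ⟨-, hlt, hF'⟩
    · exact absurd h1 he'
    have h1 := (flipCheck_spec htab h hw hge hlt).1
    have h2 := signSum_pair htab h hb hc hp hp' (fun q hq =>
        hg q (by simpa using Or.inr (by simpa using hq)))
      hw (fun i hi => mul_adj_of_le hge hw hi) hF hF' (by rw [h1]; omega)
    rw [h1] at h2
    omega
  | cons q a ih =>
    have hgq := hg q (by simp)
    have ih' := fun {w} => ih (w := w) (fun e' he' => ha e' (List.mem_cons_of_mem _ he'))
      fun e' he' => hg e' (List.mem_cons_of_mem _ he')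
    have hq := ha q List.mem_cons_self
    rw [List.cons_append, signSum, signSum]
    rcases hF with ⟨h1, hF⟩ | ⟨h1, hlt, hF⟩
    · rcases hF' with ⟨h1', hF'⟩ | ⟨h1', -⟩
      · rw [if_pos h1, if_pos h1']
        exact ih' hw hF hF'
      · exact absurd (hq.1 h1) h1'
    · rcases hF' with ⟨h1', -⟩ | ⟨h1', -, hF'⟩
      · exact absurd (hq.2 h1') h1
      · rw [if_neg h1, if_neg h1']
        have := ih' (fun i hi => mul_adj_of_le hgq hw hi) hF hF'
        omega

end

end Subword

/-! ### Fraction-free elimination -/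

namespace Bareiss

open Matrix

variable {ι : Type*} (M : ℕ → ι → ℤ) (c : ℕ → ι)

/-- The square matrix of the first `j` rows of `M` and the columns `c 0, …, c (j - 1)`. -/
def block (j : ℕ) : Matrix (Fin j) (Fin j) ℤ := Matrix.of fun a b => M a (c b)

/-- The minor of the first `j` rows of `M` and the columns `c 0, …, c (j - 1)`. -/
def lead (j : ℕ) : ℤ := (block M c j).det

/-- The row `i` of `M`, reduced by the first `j` rows and multiplied by the minor `lead M c j`. -/
def red (j i : ℕ) (e : ι) : ℤ :=
  lead M c j * M i e - ∑ b : Fin j, ((fun a : Fin j => M i (c a)) ᵥ* (block M c j).adjugate) b *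
      M b e

/-- `f` is `s` times the row `i` of `M`, up to a combination of the first `j` rows. -/
def IsReduction (j i : ℕ) (s : ℤ) (f : ι → ℤ) : Prop :=
  ∃ y : ℕ → ℤ, ∀ e, f e = s * M i e - ∑ b ∈ range j, y b * M b e

variable {M c}

theorem isReduction_red (j i : ℕ) : IsReduction M j i (lead M c j) (red M c j i) := by
  refine ⟨fun b => if h : b < j then
    ((fun a : Fin j => M i (c a)) ᵥ* (block M c j).adjugate) ⟨b, h⟩ else 0, fun e => ?_⟩
  rw [red, sum_range]
  simp

theorem red_apply_of_lt {j a : ℕ} (ha : a < j) (i : ℕ) : red M c j i (c a) = 0 := by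
  have h1 : ((fun a : Fin j => M i (c a)) ᵥ* (block M c j).adjugate) ᵥ* block M c j =
      lead M c j • fun a : Fin j => M i (c a) := by
    rw [vecMul_vecMul, adjugate_mul, vecMul_smul, vecMul_one]
    rfl
  have h2 := congrFun h1 ⟨a, ha⟩
  rw [red, sub_eq_zero]
  exact h2.symm

/-- The pivot block is nonsingular, so the combination subtracted is determined by the entries in
the pivot columns. This identifies rows without division. -/
theorem IsReduction.ext {j i : ℕ} {s : ℤ} {f f' : ι → ℤ} (hj : lead M c j ≠ 0)
    (hf : IsReduction M j i s f) (hf' : IsReduction M j i s f')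
    (h : ∀ a < j, f (c a) = f' (c a)) : f = f' := by
  obtain ⟨y, hy⟩ := hf
  obtain ⟨y', hy'⟩ := hf'
  have h1 : (fun b : Fin j => y b - y' b) ᵥ* block M c j = 0 := by
    ext a
    have := h a a.2
    rw [hy, hy', sum_range, sum_range] at this
    simp only [vecMul, dotProduct, block, of_apply, sub_mul, sum_sub_distrib, Pi.zero_apply]
    linarith
  have h2 := eq_zero_of_vecMul_eq_zero hj h1
  ext e
  rw [hy, hy']
  congr 1
  refine sum_congr rfl fun b hb => ?_
  have := congrFun h2 ⟨b, mem_range.1 hb⟩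
  rw [Pi.zero_apply, sub_eq_zero] at this
  rw [this]

theorem lead_zero : lead M c 0 = 1 := det_isEmpty

theorem red_zero (i : ℕ) : red M c 0 i = M i := by
  ext e
  simp [red, lead_zero]

/-- Replace the last row of the larger block by its reduction. The determinant is multiplied by
`lead M c j`; on the other hand the new row vanishes except in the corner. -/
theorem lead_succ {j : ℕ} (hj : lead M c j ≠ 0) : lead M c (j + 1) = red M c j j (c j) := by
  obtain ⟨y, hy⟩ := isReduction_red (M := M) (c := c) j j
  set B := (block M c (j + 1)).updateRow (Fin.last j) fun a => red M c j j (c a) with hB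
  have h1 : B.det = lead M c j * lead M c (j + 1) := by
    have h : (fun a : Fin (j + 1) => red M c j j (c a)) =
        ∑ b : Fin (j + 1), (if (b : ℕ) < j then -y b else lead M c j) • block M c (j + 1) b := by
      ext a
      rw [hy, Fin.sum_univ_castSucc, sum_range]
      simp [block, sub_eq_add_neg, add_comm]
    rw [hB, h, det_updateRow_sum]
    simp [lead]
  have h2 : B.det = lead M c j * red M c j j (c j) := by
    rw [det_succ_row _ (Fin.last j), sum_eq_single (Fin.last j)]
    · have h : B.submatrix (Fin.last j).succAbove (Fin.last j).succAbove = block M c j := by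
        ext a b
        rw [hB, submatrix_apply, updateRow_ne (Fin.succAbove_ne _ _)]
        simp [block]
      rw [h, hB, updateRow_self]
      simp [← two_mul, lead, mul_comm]
    · intro b _ hb
      have h : B (Fin.last j) b = 0 := by
        rw [hB, updateRow_self]
        exact red_apply_of_lt (Fin.val_lt_last hb) j
      rw [h, mul_zero, zero_mul]
    · simp
  exact mul_left_cancel₀ hj (h1.symm.trans h2)

/-- The identity that makes the division by the previous pivot exact. Both sides are reductions of
row `i` by the first `j + 1` rows with the same multiplier, and both vanish in the pivot columns. -/
theorem lead_mul_red_succ {j : ℕ} (hj : lead M c j ≠ 0) (hj' : lead M c (j + 1) ≠ 0) (i : ℕ)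
    (e : ι) :
    lead M c j * red M c (j + 1) i e =
      lead M c (j + 1) * red M c j i e - red M c j i (c j) * red M c j j e := by
  obtain ⟨y, hy⟩ := isReduction_red (M := M) (c := c) (j + 1) i
  obtain ⟨z, hz⟩ := isReduction_red (M := M) (c := c) j i
  obtain ⟨z', hz'⟩ := isReduction_red (M := M) (c := c) j j
  refine congrFun (IsReduction.ext (M := M) (c := c) (j := j + 1) (i := i)
    (s := lead M c j * lead M c (j + 1)) (f := fun e => lead M c j * red M c (j + 1) i e)
    (f' := fun e => lead M c (j + 1) * red M c j i e - red M c j i (c j) * red M c j j e)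
    hj' ?_ ?_ ?_) e
  · refine ⟨fun b => lead M c j * y b, fun e => ?_⟩
    simp only [hy e, mul_sub, mul_sum, mul_assoc]
  · refine ⟨fun b => if b < j then lead M c (j + 1) * z b - red M c j i (c j) * z' b else
      red M c j i (c j) * lead M c j, fun e => ?_⟩
    dsimp only
    have h1 : ∑ b ∈ range j, (if b < j then lead M c (j + 1) * z b - red M c j i (c j) * z' b else
        red M c j i (c j) * lead M c j) * M b e =
        lead M c (j + 1) * (∑ b ∈ range j, z b * M b e) -
          red M c j i (c j) * ∑ b ∈ range j, z' b * M b e := by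
      rw [mul_sum, mul_sum, ← sum_sub_distrib]
      refine sum_congr rfl fun b hb => ?_
      rw [if_pos (mem_range.1 hb)]
      ring
    rw [sum_range_succ, h1, if_neg (lt_irrefl j), hz e, hz' e]
    ring
  · intro a ha
    rw [red_apply_of_lt ha, mul_zero]
    rcases Nat.lt_succ_iff_lt_or_eq.1 ha with h | rfl
    · rw [red_apply_of_lt h, red_apply_of_lt h]
      ring
    · rw [lead_succ hj]
      ring

theorem abs_adjugate_le {n : ℕ} {A : Matrix (Fin n) (Fin n) ℤ} {K : ℤ} (hK : 1 ≤ K)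
    (hA : ∀ a b, |A a b| ≤ K) (a b : Fin n) : |A.adjugate a b| ≤ n.factorial * K ^ n := by
  rw [adjugate_apply]
  have := det_le (A := A.updateRow b (Pi.single a 1)) (abv := AbsoluteValue.abs) (x := K) ?_
  · simpa using this
  · intro i j
    by_cases hi : i = b
    · subst hi
      rw [updateRow_self, Pi.single_apply]
      split_ifs <;> simp <;> omega
    · rw [updateRow_ne hi]
      exact hA i j

theorem abs_lead_le {j : ℕ} {K : ℤ} (hM : ∀ b < j, ∀ e, |M b e| ≤ K) :
    |lead M c j| ≤ j.factorial * K ^ j := by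
  have := det_le (A := block M c j) (abv := AbsoluteValue.abs) (x := K) fun a b => hM a a.2 (c b)
  simpa [lead] using this

/-- A crude estimate from the Leibniz formula for the minor and for the adjugate, enough to
guarantee that the digits of packed rows never overflow. -/
theorem abs_red_le {j i : ℕ} {K : ℤ} (hK : 1 ≤ K) (hM : ∀ b < j, ∀ e, |M b e| ≤ K)
    (hi : ∀ e, |M i e| ≤ K) (e : ι) :
    |red M c j i e| ≤ j.factorial * K ^ (j + 1) * (1 + j ^ 2 * K) := by
  have hK0 : 0 ≤ K := by omega
  have h0 : (0 : ℤ) ≤ j.factorial * K ^ j := by positivity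
  have h1 : |lead M c j * M i e| ≤ j.factorial * K ^ j * K := by
    rw [abs_mul]
    exact mul_le_mul (abs_lead_le hM) (hi e) (abs_nonneg _) h0
  have h2 : ∀ b, |((fun a : Fin j => M i (c a)) ᵥ* (block M c j).adjugate) b| ≤
      j * (K * (j.factorial * K ^ j)) := by
    intro b
    rw [vecMul, dotProduct]
    refine (abs_sum_le_sum_abs _ _).trans ((sum_le_card_nsmul _ _ (K * (j.factorial * K ^ j))
      fun a _ => ?_).trans ?_)
    · rw [abs_mul]
      exact mul_le_mul (hi _) (abs_adjugate_le hK (fun a b => hM a a.2 (c b)) a b) (abs_nonneg _)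
          hK0
    · simp
  have h3 : |∑ b : Fin j, ((fun a : Fin j => M i (c a)) ᵥ* (block M c j).adjugate) b * M b e| ≤
      j * (j * (K * (j.factorial * K ^ j)) * K) := by
    refine (abs_sum_le_sum_abs _ _).trans ((sum_le_card_nsmul _ _
      (j * (K * (j.factorial * K ^ j)) * K) fun a _ => ?_).trans ?_)
    · rw [abs_mul]
      exact mul_le_mul (h2 a) (hM a a.2 e) (abs_nonneg _) (by positivity)
    · simp
  calc |red M c j i e| ≤ _ := abs_sub _ _
    _ ≤ _ := add_le_add h1 h3
    _ = _ := by ring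

end Bareiss

namespace Bareiss

open Subword

/-! #### Packed rows -/

section Pack

variable {ι : Type*} {W h : ℕ}

/-- The number with the digits `f e`, `e ∈ l`, in base `2 ^ W`. -/
def pack (W : ℕ) (f : ι → ℕ) : List ι → ℕ
  | [] => 0
  | e :: l => f e * 2 ^ (W * l.length) + pack W f l

/-- The packed form of a vector `v` of integers, to which `h` is added to make them nonnegative. -/
def packInt (W h : ℕ) (v : ι → ℤ) (l : List ι) : ℕ := pack W (fun e => (v e + h).toNat) l

/-- The `i`-th digit of `X`, where `i` is given by a shift, and `mask` is the maximal digit. -/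
def digit (mask X sh : ℕ) : ℕ := Nat.land (Nat.shiftRight X sh) mask

theorem pack_lt {f : ι → ℕ} {l : List ι} (hf : ∀ e ∈ l, f e < 2 ^ W) :
    pack W f l < 2 ^ (W * l.length) := by
  induction l with
  | nil => simp [pack]
  | cons e l ih =>
    have h1 := ih fun e' he' => hf e' (List.mem_cons_of_mem _ he')
    have h2 := hf e List.mem_cons_self
    rw [pack, List.length_cons, mul_add, mul_one, pow_add]
    calc f e * 2 ^ (W * l.length) + pack W f l < f e * 2 ^ (W * l.length) + 2 ^ (W * l.length) := by
          omega
      _ = (f e + 1) * 2 ^ (W * l.length) := by ring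
      _ ≤ 2 ^ W * 2 ^ (W * l.length) := Nat.mul_le_mul_right _ h2
      _ = _ := mul_comm _ _

theorem digit_pack {f : ι → ℕ} {l₁ l₂ : List ι} {e : ι} (hf : ∀ q ∈ l₁ ++ e :: l₂, f q < 2 ^ W) :
    digit (2 ^ W - 1) (pack W f (l₁ ++ e :: l₂)) (W * l₂.length) = f e := by
  have h1 : digit (2 ^ W - 1) (pack W f (l₁ ++ e :: l₂)) (W * l₂.length) =
      pack W f (l₁ ++ e :: l₂) / 2 ^ (W * l₂.length) % 2 ^ W := by
    rw [← Nat.shiftRight_eq_div_pow, ← Nat.and_two_pow_sub_one_eq_mod]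
    rfl
  have h2 : ∃ A, pack W f (l₁ ++ e :: l₂) =
      (A * 2 ^ W + f e) * 2 ^ (W * l₂.length) + pack W f l₂ := by
    clear h1 hf
    induction l₁ with
    | nil => exact ⟨0, by simp [pack]⟩
    | cons q l₁ ih =>
      obtain ⟨A, hA⟩ := ih
      refine ⟨f q * 2 ^ (W * l₁.length) + A, ?_⟩
      rw [List.cons_append, pack, hA, List.length_append, List.length_cons, mul_add, mul_add,
          mul_one,
        pow_add, pow_add]
      ring
  obtain ⟨A, hA⟩ := h2
  have h3 : pack W f l₂ < 2 ^ (W * l₂.length) := pack_lt fun q hq => hf q (by simp [hq])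
  rw [h1, hA, mul_comm, Nat.mul_add_div (by positivity), Nat.div_eq_of_lt h3, add_zero, mul_comm A,
    Nat.mul_add_mod, Nat.mod_eq_of_lt (hf e (by simp))]

theorem digit_packInt {v : ι → ℤ} {l₁ l₂ : List ι} {e : ι} (hW : 2 * h = 2 ^ W)
    (hv : ∀ q ∈ l₁ ++ e :: l₂, |v q| < h) :
    (digit (2 ^ W - 1) (packInt W h v (l₁ ++ e :: l₂)) (W * l₂.length) : ℤ) = v e + h := by
  rw [packInt, digit_pack]
  · have := abs_lt.1 (hv e (by simp))
    omega
  · intro q hq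
    have := abs_lt.1 (hv q hq)
    omega

/-- The linear form underlying `pack`. -/
def packLinear (W : ℕ) (v : ι → ℤ) : List ι → ℤ
  | [] => 0
  | e :: l => v e * 2 ^ (W * l.length) + packLinear W v l

theorem packLinear_congr {v v' : ι → ℤ} {l : List ι} (hv : ∀ q ∈ l, v q = v' q) :
    packLinear W v l = packLinear W v' l := by
  induction l with
  | nil => rfl
  | cons e l ih =>
    rw [packLinear, packLinear, hv e List.mem_cons_self,
      ih fun e' he' => hv e' (List.mem_cons_of_mem _ he')]

theorem packLinear_add (v v' : ι → ℤ) (l : List ι) :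
    packLinear W (fun e => v e + v' e) l = packLinear W v l + packLinear W v' l := by
  induction l with
  | nil => rfl
  | cons e l ih => rw [packLinear, packLinear, packLinear, ih]; ring

theorem packLinear_mul (a : ℤ) (v : ι → ℤ) (l : List ι) :
    packLinear W (fun e => a * v e) l = a * packLinear W v l := by
  induction l with
  | nil => simp [packLinear]
  | cons e l ih => rw [packLinear, packLinear, ih]; ring

theorem packInt_eq {v : ι → ℤ} {l : List ι} (hv : ∀ q ∈ l, |v q| < h) :
    (packInt W h v l : ℤ) = packLinear W v l + packInt W h (0 : ι → ℤ) l := by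
  have key : ∀ {v : ι → ℤ} {l : List ι}, (∀ q ∈ l, 0 ≤ v q + h) →
      (packInt W h v l : ℤ) = packLinear W (fun e => v e + h) l := by
    intro v l
    induction l with
    | nil => exact fun _ => rfl
    | cons e l ih =>
      intro hv
      rw [packLinear, ← ih fun e' he' => hv e' (List.mem_cons_of_mem _ he')]
      simp only [packInt, pack]
      push_cast [Int.toNat_of_nonneg (hv e List.mem_cons_self)]
      rfl
  rw [key fun q hq => by have := abs_lt.1 (hv q hq); omega, key fun q hq => by simp,
    packLinear_add]
  simp

theorem packInt_neg {v : ι → ℤ} {l : List ι} (hv : ∀ q ∈ l, |v q| < h) :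
    2 * packInt W h (0 : ι → ℤ) l - packInt W h v l = packInt W h (fun e => -v e) l := by
  have h1 := packInt_eq (W := W) hv
  have h2 := packInt_eq (W := W) (v := fun e => -v e) (l := l) (h := h)
    fun q hq => by rw [abs_neg]; exact hv q hq
  have h3 : packLinear W (fun e => -v e) l = -packLinear W v l := by
    simpa using packLinear_mul (W := W) (-1) v l
  omega

/-- Let `β` be the packed zero vector, so that packing is a linear form plus `β`. The digit read off
is `a = t + h`, and the terms with `h` and `β` cancel to leave `g` times the packed form of `y`. The
positive terms are collected before subtracting, so the natural subtraction is not truncated. -/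
theorem packInt_update {x y F : ι → ℤ} {l : List ι} {p g a : ℕ} {t : ℤ} (hg : 0 < g)
    (hx : ∀ q ∈ l, |x q| < h) (hy : ∀ q ∈ l, |y q| < h) (hF : ∀ q ∈ l, |F q| < h)
    (ha : (a : ℤ) = t + h) (hxy : ∀ q ∈ l, g * y q = p * x q - t * F q) :
    (p * packInt W h x l + a * packInt W h (0 : ι → ℤ) l +
      (h * packInt W h F l + g * packInt W h (0 : ι → ℤ) l) -
      (a * packInt W h F l + (p + h) * packInt W h (0 : ι → ℤ) l)) / g = packInt W h y l := by
  refine Nat.div_eq_of_eq_mul_right hg ?_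
  rw [Nat.sub_eq_iff_eq_add']
  · zify
    have h1 : (g : ℤ) * packLinear W y l = p * packLinear W x l - t * packLinear W F l := by
      rw [← packLinear_mul, packLinear_congr hxy]
      simp only [sub_eq_add_neg, ← neg_mul]
      rw [packLinear_add, packLinear_mul, packLinear_mul]
    rw [packInt_eq hx, packInt_eq hy, packInt_eq hF, ha]
    linear_combination -h1
  · zify
    have h1 : (g : ℤ) * packLinear W y l = p * packLinear W x l - t * packLinear W F l := by
      rw [← packLinear_mul, packLinear_congr hxy]
      simp only [sub_eq_add_neg, ← neg_mul]
      rw [packLinear_add, packLinear_mul, packLinear_mul]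
    have h2 : (0 : ℤ) ≤ g * packInt W h y l := by positivity
    rw [packInt_eq hy] at h2
    rw [packInt_eq hx, packInt_eq hF, ha]
    linear_combination h2 + h1

end Pack

/-! #### Elimination of packed rows -/

/-- Update the rows `X` in an elimination step with pivot row `F` and pivot `p`. -/
def updateRows (mask β sh p J K F g : ℕ) : List ℕ → (List ℕ → Bool) → Bool :=
  List.rec (fun c => c []) fun X _ ih c =>
    force false (digit mask X sh) fun a =>
      force false (Nat.div (Nat.sub (Nat.add (Nat.add (Nat.mul p X) (Nat.mul a β)) K)
        (Nat.add (Nat.mul a F) J)) g) fun Y => ih fun Ys => c (Y :: Ys)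

/-- An elimination step with the first row as pivot row. The previous pivot is `g`, and the parity
of
`b` records the changes of sign. -/
def eliminate (mask h β sh : ℕ) (rows : List ℕ) (g b : ℕ) (c : List ℕ → ℕ → ℕ → Bool) : Bool :=
  List.rec false (fun F Fs _ =>
    force false (digit mask F sh) fun a =>
      -- The first branch is the case of a digit below `h`, a negative pivot: the row is negated as
      -- `2β - F` and the parity increased. A zero pivot makes the check fail.
      Bool.rec
        (force false (Nat.sub h a) fun p => force false (Nat.sub (Nat.mul 2 β) F) fun F' =>
          force false (Nat.succ b) fun b' =>
            force false (Nat.mul (Nat.add p h) β) fun J =>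
              force false (Nat.add (Nat.mul h F') (Nat.mul g β)) fun K =>
                updateRows mask β sh p J K F' g Fs fun Ys => c Ys p b')
        (force false (Nat.sub a h) fun p =>
          Bool.rec
            (force false (Nat.mul (Nat.add p h) β) fun J =>
              force false (Nat.add (Nat.mul h F) (Nat.mul g β)) fun K =>
                updateRows mask β sh p J K F g Fs fun Ys => c Ys p b) false (Nat.beq p 0))
        (Nat.ble h a)) rows

section Eliminate

variable {ι : Type*} {W h r : ℕ} {M : ℕ → ι → ℤ} {c : ℕ → ι}

theorem updateRows_eq {mask β sh p J K F g : ℕ} {rows : List ℕ} {k : List ℕ → Bool} :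
    updateRows mask β sh p J K F g rows k = k (rows.map fun X =>
      (p * X + digit mask X sh * β + K - (digit mask X sh * F + J)) / g) := by
  induction rows generalizing k with
  | nil => rfl
  | cons X rows ih => exact ih

/-- The packed form of the rows `j, …, r` after `j` elimination steps. -/
def packRows (W h r : ℕ) (M : ℕ → ι → ℤ) (c : ℕ → ι) (L : List ι) (s : ℤ) (j : ℕ) : List ℕ :=
  (List.range (r + 1 - j)).map fun t => packInt W h (fun e => s * red M c j (j + t) e) L

theorem updateRows_packRows {l₁ l₂ : List ι} {j : ℕ} {s : ℤ} (hW : 2 * h = 2 ^ W)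
    (hred : ∀ t ≤ r, ∀ i ≤ r, ∀ q ∈ l₁ ++ c j :: l₂, |red M c t i q| < h) (hj : j < r)
    (hs : s = 1 ∨ s = -1) {g : ℕ} (hg : 0 < g) (hsg : s * lead M c j = g) {s' : ℤ}
    (hs' : s' = 1 ∨ s' = -1) {p : ℕ} (hp : 0 < p) (hsp : s' * lead M c (j + 1) = p)
    {k : List ℕ → Bool}
    (hk : updateRows (2 ^ W - 1) (packInt W h (0 : ι → ℤ) (l₁ ++ c j :: l₂)) (W * l₂.length) p
      ((p + h) * packInt W h (0 : ι → ℤ) (l₁ ++ c j :: l₂))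
      (h * packInt W h (fun e => s' * red M c j j e) (l₁ ++ c j :: l₂) +
        g * packInt W h (0 : ι → ℤ) (l₁ ++ c j :: l₂))
      (packInt W h (fun e => s' * red M c j j e) (l₁ ++ c j :: l₂)) g
      ((List.range (r + 1 - (j + 1))).map fun t =>
        packInt W h (fun e => s * red M c j (j + 1 + t) e) (l₁ ++ c j :: l₂)) k = true) :
    k (packRows W h r M c (l₁ ++ c j :: l₂) s' (j + 1)) = true := by
  rw [updateRows_eq, List.map_map] at hk
  rw [← hk, packRows]
  congr 1
  refine List.map_congr_left fun t ht => ?_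
  rw [List.mem_range] at ht
  have habs : ∀ {s : ℤ}, s = 1 ∨ s = -1 → ∀ x : ℤ, |s * x| = |x| := by
    rintro s (rfl | rfl) x <;> simp
  have hx : ∀ q ∈ l₁ ++ c j :: l₂, |s * red M c j (j + 1 + t) q| < h := fun q hq => by
    rw [habs hs]
    exact hred j (by omega) _ (by omega) q hq
  have hj0 : lead M c j ≠ 0 := fun h0 => by
    rw [h0, mul_zero] at hsg
    omega
  have hj1 : lead M c (j + 1) ≠ 0 := fun h0 => by
    rw [h0, mul_zero] at hsp
    omega
  have hss : s * s = 1 := by rcases hs with rfl | rfl <;> rfl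
  have hss' : s' * s' = 1 := by rcases hs' with rfl | rfl <;> rfl
  refine (packInt_update (t := s * red M c j (j + 1 + t) (c j)) hg hx (fun q hq => ?_)
    (fun q hq => ?_) (digit_packInt (v := fun e => s * red M c j (j + 1 + t) e) (e := c j) hW hx)
        fun q hq => ?_).symm
  · rw [habs hs']
    exact hred (j + 1) hj _ (by omega) q hq
  · rw [habs hs']
    exact hred j hj.le _ hj.le q hq
  · have h1 := lead_mul_red_succ hj0 hj1 (j + 1 + t) q
    rw [← hsg, ← hsp]
    linear_combination (s * s') * h1

theorem exists_of_eliminate {l₁ l₂ : List ι} {j n b : ℕ} (hW : 2 * h = 2 ^ W)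
    (hred : ∀ t ≤ r, ∀ i ≤ r, ∀ q ∈ l₁ ++ c j :: l₂, |red M c t i q| < h) (hj : j < r) {g : ℕ}
    (hg : 0 < g) (hsg : (-1) ^ (b + n) * lead M c j = g) {k : List ℕ → ℕ → ℕ → Bool}
    (hk : eliminate (2 ^ W - 1) h (packInt W h (0 : ι → ℤ) (l₁ ++ c j :: l₂)) (W * l₂.length)
      (packRows W h r M c (l₁ ++ c j :: l₂) ((-1) ^ (b + n)) j) g b k = true) :
    ∃ p b' : ℕ, 0 < p ∧ (-1) ^ (b' + n) * lead M c (j + 1) = p ∧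
      k (packRows W h r M c (l₁ ++ c j :: l₂) ((-1) ^ (b' + n)) (j + 1)) p b' = true := by
  have hs : ∀ m : ℕ, (-1 : ℤ) ^ m = 1 ∨ (-1 : ℤ) ^ m = -1 := neg_one_pow_eq_or ℤ
  have habs : ∀ {s : ℤ}, s = 1 ∨ s = -1 → ∀ x : ℤ, |s * x| = |x| := by
    rintro s (rfl | rfl) x <;> simp
  have hj0 : lead M c j ≠ 0 := fun h0 => by
    rw [h0, mul_zero] at hsg
    omega
  obtain ⟨s, hs0⟩ : ∃ s : ℤ, s = (-1) ^ (b + n) := ⟨_, rfl⟩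
  have hsucc : (-1 : ℤ) ^ (b + 1 + n) = -s := by rw [hs0]; ring
  have hsb := hs (b + n)
  rw [← hs0] at hsg hk hsb
  have h1 : packRows W h r M c (l₁ ++ c j :: l₂) s j =
      packInt W h (fun e => s * red M c j j e) (l₁ ++ c j :: l₂) ::
        (List.range (r + 1 - (j + 1))).map fun t =>
          packInt W h (fun e => s * red M c j (j + 1 + t) e) (l₁ ++ c j :: l₂) := by
    rw [packRows, show r + 1 - j = r + 1 - (j + 1) + 1 by omega, List.range_succ_eq_map,
        List.map_cons,
      List.map_map]
    refine congrArg₂ _ rfl (List.map_congr_left fun t _ => ?_)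
    simp only [Function.comp_apply, Nat.succ_eq_add_one, add_assoc, add_comm 1]
  have hF : ∀ q ∈ l₁ ++ c j :: l₂, |s * red M c j j q| < h := fun q hq => by
    rw [habs hsb]
    exact hred j hj.le j hj.le q hq
  have hdig := digit_packInt (v := fun e => s * red M c j j e) (e := c j) hW hF
  rw [← lead_succ hj0] at hdig
  have hneg := packInt_neg (W := W) hF
  simp only [← neg_mul] at hneg
  rw [h1, eliminate] at hk
  dsimp only [force] at hk
  set a := digit (2 ^ W - 1) (packInt W h (fun e => s * red M c j j e) (l₁ ++ c j :: l₂))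
    (W * l₂.length)
  cases hle : Nat.ble h a with
  | true =>
    rw [hle] at hk
    have hle' : h ≤ a := Nat.le_of_ble_eq_true hle
    cases hp : Nat.beq (Nat.sub a h) 0 with
    | true =>
      dsimp only at hk
      rw [hp] at hk
      exact Bool.noConfusion hk
    | false =>
      dsimp only at hk
      rw [hp] at hk
      have hp' : a - h ≠ 0 := Nat.ne_of_beq_eq_false hp
      have hsp : s * lead M c (j + 1) = (a - h : ℕ) := by omega
      refine ⟨a - h, b, by omega, by rw [← hs0, hsp], ?_⟩
      rw [← hs0]
      exact updateRows_packRows (k := fun Ys => k Ys (a - h) b) hW hred hj hsb hg hsg hsb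
        (by omega) hsp hk
  | false =>
    rw [hle] at hk
    have hle' : ¬h ≤ a := fun h' => by
      rw [Nat.ble_eq_true_of_le h'] at hle
      exact Bool.noConfusion hle
    have hsp : -s * lead M c (j + 1) = (h - a : ℕ) := by
      rw [neg_mul]
      omega
    refine ⟨h - a, b + 1, by omega, by rw [hsucc, hsp], ?_⟩
    rw [hsucc]
    refine updateRows_packRows (k := fun Ys => k Ys (h - a) (b + 1)) hW hred hj hsb hg hsg
      (by rcases hsb with h | h <;> simp [h]) (by omega) hsp ?_
    rw [← hneg]
    exact hk

end Eliminate

end Bareiss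

namespace Bareiss

open Subword

/-! #### Elimination along the facets of a subword complex -/

/-- The state of an elimination: the remaining rows, the last pivot, the parity of the changes of
sign,
and the shifts of the columns that have been left aside. -/
structure Elim where
  rows : List ℕ
  g : ℕ
  b : ℕ
  acc : List ℕ

/-- Eliminate a column. -/
def elimStep (mask h β : ℕ) (st : Step) (i : ℕ) (s : Elim) (c : Elim → Bool) : Bool :=
  match s with
  | ⟨rows, g, b, acc⟩ =>
    force false (Nat.land (Nat.add b (bitAt (Step.nu st) i)) (nat_lit 1)) fun b =>
      eliminate mask h β (Step.sh st) rows g b fun Ys p b' => c ⟨Ys, p, b', acc⟩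

/-- Leave a column aside. -/
def pushStep (st : Step) (_ : ℕ) (s : Elim) (c : Elim → Bool) : Bool :=
  match s with
  | ⟨rows, g, b, acc⟩ => force false (Step.sh st) fun sh => c ⟨rows, g, b, sh :: acc⟩

/-- Whether some entry left aside is negative. -/
def existsNegative (mask h X : ℕ) : List ℕ → Bool :=
  List.rec false fun t _ ih => Bool.rec ih true (Nat.ble (Nat.succ (digit mask X t)) h)

/-- Whether all entries left aside are positive. -/
def forallPositive (mask h X : ℕ) : List ℕ → Bool :=
  List.rec true fun t _ ih => Bool.rec false ih (Nat.ble (Nat.succ h) (digit mask X t))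

theorem existsNegative_eq_true {mask h X : ℕ} {acc : List ℕ} :
    existsNegative mask h X acc = true ↔ ∃ t ∈ acc, digit mask X t < h := by
  induction acc with
  | nil => simp [existsNegative]
  | cons t acc ih =>
    have h1 : existsNegative mask h X (t :: acc) =
        Bool.rec (existsNegative mask h X acc) true (Nat.ble (Nat.succ (digit mask X t)) h) := rfl
    rw [h1, List.exists_mem_cons_iff, ← ih, ← Nat.succ_le_iff, ← Nat.ble_eq]
    cases Nat.ble (Nat.succ (digit mask X t)) h <;> simp

theorem forallPositive_eq_true {mask h X : ℕ} {acc : List ℕ} :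
    forallPositive mask h X acc = true ↔ ∀ t ∈ acc, h < digit mask X t := by
  induction acc with
  | nil => simp [forallPositive]
  | cons t acc ih =>
    have h1 : forallPositive mask h X (t :: acc) =
        Bool.rec false (forallPositive mask h X acc) (Nat.ble (Nat.succ h) (digit mask X t)) := rfl
    rw [h1, List.forall_mem_cons, ← ih, ← Nat.succ_le_iff, ← Nat.ble_eq]
    cases Nat.ble (Nat.succ h) (digit mask X t) <;> simp

/-- All entries left aside are positive. -/
def positiveLeaf (mask h : ℕ) (s : Elim) : Bool :=
  match s with
  | ⟨rows, _, _, acc⟩ => force false (rows.headD 0) fun X => forallPositive mask h X acc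

/-- The parity is `b₀`, and some entry left aside is negative, unless these entries are those of the
positions `acc₀`. -/
def negativeLeaf (mask h b₀ : ℕ) (acc₀ : List ℕ) (s : Elim) : Bool :=
  match s with
  | ⟨rows, _, b, acc⟩ =>
    Nat.beq (Nat.land b (nat_lit 1)) b₀ && force false (rows.headD 0) fun X =>
      existsNegative mask h X acc || acc == acc₀

section

variable {ι : Type*} [DecidableEq ι] {W h r : ℕ} {M : ℕ → ι → ℤ} {L : List ι} {C : Finset ι} {d : ι}

/-- The letters of `L` in `C`, in order. -/
def colSeq (L : List ι) (C : Finset ι) (d : ι) (i : ℕ) : ι := (L.filter (· ∈ C)).getD i d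

/-- The shift of the column `e` in the packed rows. -/
def shift (W : ℕ) (L : List ι) (e : ι) : ℕ := W * (L.length - 1 - L.idxOf e)

theorem shift_eq {pre l : List ι} {e : ι} (hL : (pre ++ e :: l).Nodup) :
    shift W (pre ++ e :: l) e = W * l.length := by
  have he : e ∉ pre := fun h => (List.nodup_append.1 hL).2.2 e h e List.mem_cons_self rfl
  rw [shift, List.idxOf_append_of_notMem he, List.idxOf_cons_self, List.length_append,
    List.length_cons]
  congr 1
  omega

theorem shift_injOn (hW : W ≠ 0) {e f : ι} (he : e ∈ L) (hf : f ∈ L)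
    (h : shift W L e = shift W L f) : e = f := by
  have h1 := List.idxOf_lt_length_of_mem he
  have h2 := List.idxOf_lt_length_of_mem hf
  have h3 : L.length - 1 - L.idxOf e = L.length - 1 - L.idxOf f :=
    Nat.eq_of_mul_eq_mul_left (Nat.pos_of_ne_zero hW) h
  exact (List.idxOf_inj he).1 (by omega)

/-- The state `s` is obtained from `M` by eliminating the columns in `C` that belong to the initial
segment `pre` of `L`; the parity of the changes of sign is that of `s.b + n`. -/
structure ElimInv (W h r : ℕ) (M : ℕ → ι → ℤ) (L : List ι) (C : Finset ι) (d : ι) (pre : List ι)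
    (n : ℕ) (s : Elim) : Prop where
  rows : s.rows = packRows W h r M (colSeq L C d) L ((-1) ^ (s.b + n)) (pre.filter (· ∈ C)).length
  pos : 0 < s.g
  sign : (-1) ^ (s.b + n) * lead M (colSeq L C d) (pre.filter (· ∈ C)).length = s.g
  acc : s.acc = ((pre.filter (· ∉ C)).map (shift W L)).reverse

theorem ElimInv.push {pre l : List ι} {n : ℕ} {s : Elim} {e : ι} (hL : L.Nodup)
    (hs : ElimInv W h r M L C d pre n s) (hpre : L = pre ++ e :: l) (he : e ∉ C) {st : Step}
    (hst : st.sh = W * l.length) {i : ℕ} {c : Elim → Bool} (hc : pushStep st i s c = true) :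
    ∃ s', ElimInv W h r M L C d (pre ++ [e]) n s' ∧ c s' = true := by
  have h1 : (pre ++ [e]).filter (· ∈ C) = pre.filter (· ∈ C) := by simp [he]
  refine ⟨_, ⟨?_, ?_, ?_, ?_⟩, hc⟩
  · rw [h1]
    exact hs.rows
  · exact hs.pos
  · rw [h1]
    exact hs.sign
  · have h2 : shift W L e = st.sh := by
      rw [hst]
      subst hpre
      exact shift_eq hL
    have h3 := hs.acc
    simpa [List.filter_append, he, h2] using h3

theorem colSeq_eq {pre l : List ι} {e : ι} (hpre : L = pre ++ e :: l) (he : e ∈ C) :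
    colSeq L C d (pre.filter (· ∈ C)).length = e := by
  rw [colSeq, hpre, List.filter_append, List.filter_cons_of_pos (by simpa using he)]
  simp [List.getD_eq_getElem?_getD]

theorem ElimInv.elim {pre l : List ι} {n : ℕ} {s : Elim} {e : ι} (hW : 2 * h = 2 ^ W)
    (hr : (L.filter (· ∈ C)).length = r)
    (hred : ∀ t ≤ r, ∀ i ≤ r, ∀ q ∈ L, |red M (colSeq L C d) t i q| < h)
    (hs : ElimInv W h r M L C d pre n s) (hpre : L = pre ++ e :: l) (he : e ∈ C) {st : Step}
    (hst : st.sh = W * l.length) {i : ℕ} {c : Elim → Bool}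
    (hc : elimStep (2 ^ W - 1) h (packInt W h (0 : ι → ℤ) L) st i s c = true) :
    ∃ s', ElimInv W h r M L C d (pre ++ [e]) (n + bitAt st.nu i) s' ∧ c s' = true := by
  have h1 : ((pre ++ [e]).filter (· ∈ C)).length = (pre.filter (· ∈ C)).length + 1 := by simp [he]
  have h2 : (pre ++ [e]).filter (· ∉ C) = pre.filter (· ∉ C) := by simp [he]
  have hj : (pre.filter (· ∈ C)).length < r := by
    rw [← hr, hpre, List.filter_append, List.filter_cons_of_pos (by simpa using he),
      List.length_append, List.length_cons]
    omega
  obtain ⟨rows, g, b, acc⟩ := s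
  have hce := colSeq_eq (d := d) hpre he
  set j := (pre.filter (· ∈ C)).length with hjdef
  set b₁ := Nat.land (b + bitAt st.nu i) 1 with hb₁
  have hb₁' : b₁ = (b + bitAt st.nu i) % 2 := Nat.and_one_is_mod _
  -- The local sign is added both to the stored parity and to `n`, so the sign carried by the rows
  -- is unchanged.
  have hpow : (-1 : ℤ) ^ (b₁ + (n + bitAt st.nu i)) = (-1) ^ (b + n) := by
    rw [neg_one_pow_eq_pow_mod_two, neg_one_pow_eq_pow_mod_two (b + n)]
    congr 1
    omega
  have hrows := hs.rows
  have hsign := hs.sign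
  dsimp only at hrows hsign
  have hpre' : L = pre ++ colSeq L C d j :: l := by rw [hce]; exact hpre
  have hc' : eliminate (2 ^ W - 1) h (packInt W h (0 : ι → ℤ) L) (W * l.length) rows g b₁
      (fun Ys p b' => c ⟨Ys, p, b', acc⟩) = true := by
    rw [← hst]
    exact hc
  rw [hrows, ← hpow] at hc'
  rw [← hpow] at hsign
  obtain ⟨p, b', hp, hsp, hk⟩ := exists_of_eliminate (l₁ := pre) (l₂ := l) hW
    (by rw [← hpre']; exact hred) hj hs.pos hsign (k := fun Ys p b' => c ⟨Ys, p, b', acc⟩)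
    (by rw [← hpre']; exact hc')
  rw [← hpre'] at hk
  refine ⟨_, ⟨?_, ?_, ?_, ?_⟩, hk⟩
  · rw [h1]
  · exact hp
  · rw [h1]
    exact hsp
  · rw [h2]
    exact hs.acc

/-- The entries of the last row at the end of an elimination. -/
theorem ElimInv.digit_eq {pre : List ι} {n : ℕ} {s : Elim} (hL : L.Nodup) (hW : 2 * h = 2 ^ W)
    (hr : (pre.filter (· ∈ C)).length = r)
    (hred : ∀ t ≤ r, ∀ i ≤ r, ∀ q ∈ L, |red M (colSeq L C d) t i q| < h)
    (hs : ElimInv W h r M L C d pre n s) {e : ι} (he : e ∈ L) :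
    (digit (2 ^ W - 1) (s.rows.headD 0) (shift W L e) : ℤ) =
      (-1) ^ (s.b + n) * red M (colSeq L C d) r r e + h := by
  have h1 : s.rows.headD 0 =
      packInt W h (fun e => (-1) ^ (s.b + n) * red M (colSeq L C d) r r e) L := by
    rw [hs.rows, packRows, hr, Nat.add_sub_cancel_left]
    rfl
  rw [h1]
  obtain ⟨l₁, l₂, hl⟩ := List.append_of_mem he
  have h2 : shift W L e = W * l₂.length := by
    subst hl
    exact shift_eq hL
  rw [h2]
  have h3 := digit_packInt (v := fun e => (-1) ^ (s.b + n) * red M (colSeq L C d) r r e) (l₁ := l₁)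
    (l₂ := l₂) (e := e) hW ?_
  · rw [← h3, ← hl]
  · intro q hq
    rw [abs_mul, abs_neg_one_pow, one_mul]
    exact hred r le_rfl r le_rfl q (hl ▸ hq)

/-- Because `s.g` is positive, the sign of the minor times an entry can be read off from a digit
compared with `h`. -/
theorem ElimInv.mul_red {pre : List ι} {n : ℕ} {s : Elim} (hr : (pre.filter (· ∈ C)).length = r)
    (hs : ElimInv W h r M L C d pre n s) (x : ℤ) :
    lead M (colSeq L C d) r * x = s.g * ((-1) ^ (s.b + n) * x) := by
  rw [← hs.sign, hr]
  have h1 : ((-1 : ℤ) ^ (s.b + n)) * (-1) ^ (s.b + n) = 1 := by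
    rw [← mul_pow]
    simp
  linear_combination (-lead M (colSeq L C d) r * x) * h1

/-! #### The matrix of a list of rows -/

/-- The matrix whose rows are given by lists, with columns indexed by the elements of `L`. -/
def matrixOf (R : List (List ℤ)) (L : List ι) (i : ℕ) (e : ι) : ℤ := (R.getD i []).getD (L.idxOf e)
    0

/-- The packed form of a list of integers. -/
def packList (W h : ℕ) : List ℤ → ℕ
  | [] => 0
  | x :: xs => (x + h).toNat * 2 ^ (W * xs.length) + packList W h xs

omit [DecidableEq ι] in
theorem pack_congr {f f' : ι → ℕ} {l : List ι} (hf : ∀ e ∈ l, f e = f' e) :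
    pack W f l = pack W f' l := by
  induction l with
  | nil => rfl
  | cons e l ih =>
    rw [pack, pack, hf e List.mem_cons_self, ih fun e' he' => hf e' (List.mem_cons_of_mem _ he')]

theorem packInt_getD (hL : L.Nodup) {xs : List ℤ} (hxs : xs.length = L.length) :
    packInt W h (fun e => xs.getD (L.idxOf e) 0) L = packList W h xs := by
  induction L generalizing xs with
  | nil =>
    rw [List.length_eq_zero_iff.1 hxs]
    rfl
  | cons a L ih =>
    obtain ⟨haL, hL⟩ := List.nodup_cons.1 hL
    cases xs with
    | nil => simp at hxs
    | cons x xs =>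
      have hxs' : xs.length = L.length := by simpa using hxs
      rw [packList, ← ih hL hxs', hxs', packInt, pack]
      congr 1
      · simp
      · refine pack_congr fun e he => ?_
        have : a ≠ e := fun h => haL (h ▸ he)
        rw [List.idxOf_cons_ne _ this, List.getD_cons_succ]

/-- The size check of a list of rows. -/
def sizeCheck (N r K h : ℕ) (R : List (List ℤ)) : Bool :=
  Nat.beq R.length (r + 1) && (R.all fun xs => Nat.beq xs.length N && xs.all fun x =>
    Nat.ble x.natAbs K) && Nat.blt (r.factorial * K ^ (r + 1) * (1 + r ^ 2 * K)) h && Nat.ble 1 K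

/-- Evaluate packed rows before passing them on. -/
def forceRows (W h : ℕ) : List (List ℤ) → (List ℕ → Bool) → Bool
  | [], c => c []
  | xs :: R, c => force false (packList W h xs) fun X => forceRows W h R fun Xs => c (X :: Xs)

theorem forceRows_eq (W h : ℕ) (R : List (List ℤ)) (c : List ℕ → Bool) :
    forceRows W h R c = c (R.map (packList W h)) := by
  induction R generalizing c with
  | nil => rfl
  | cons xs R ih => exact ih _

variable {N K : ℕ} {R : List (List ℤ)}

theorem abs_red_lt_of_sizeCheck (hR : sizeCheck L.length r K h R = true) {c : ℕ → ι} :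
    ∀ t ≤ r, ∀ i ≤ r, ∀ q ∈ L, |red (matrixOf R L) c t i q| < h := by
  intro t ht i _ q _
  simp only [sizeCheck, Bool.and_eq_true, Nat.beq_eq, Nat.ble_eq, Nat.blt_eq,
    List.all_eq_true] at hR
  obtain ⟨⟨⟨-, h1⟩, h2⟩, hK⟩ := hR
  have hM : ∀ i e, |matrixOf R L i e| ≤ (K : ℤ) := by
    intro i e
    have h3 : ∀ x ∈ R.getD i [], |x| ≤ (K : ℤ) := by
      intro x hx
      rw [List.getD_eq_getElem?_getD] at hx
      cases hRi : R[i]? with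
      | none => simp [hRi] at hx
      | some xs =>
        rw [hRi, Option.getD_some] at hx
        have := (h1 xs (List.mem_of_getElem? hRi)).2 x hx
        rw [Int.abs_eq_natAbs]
        exact_mod_cast this
    rw [matrixOf, List.getD_eq_getElem?_getD]
    cases hx : (R.getD i [])[L.idxOf e]? with
    | none => simp
    | some x => exact h3 x (List.mem_of_getElem? hx)
  refine (abs_red_le (by exact_mod_cast hK) (fun b _ => hM b) (hM i) q).trans_lt ?_
  refine lt_of_le_of_lt ?_ (by exact_mod_cast h2 :
    ((r.factorial * K ^ (r + 1) * (1 + r ^ 2 * K) : ℕ) : ℤ) < h)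
  have hnat : t.factorial * K ^ (t + 1) * (1 + t ^ 2 * K) ≤
      r.factorial * K ^ (r + 1) * (1 + r ^ 2 * K) := by
    gcongr
  exact_mod_cast hnat

theorem packRows_matrixOf (hL : L.Nodup) (hR : sizeCheck L.length r K h R = true) {c : ℕ → ι} :
    packRows W h r (matrixOf R L) c L 1 0 = R.map (packList W h) := by
  simp only [sizeCheck, Bool.and_eq_true, Nat.beq_eq, Nat.ble_eq, Nat.blt_eq,
    List.all_eq_true] at hR
  obtain ⟨⟨⟨h0, h1⟩, -⟩, -⟩ := hR
  refine List.ext_getElem (by simp [packRows, h0]) fun i hi hi' => ?_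
  rw [List.length_map] at hi'
  have h2 : (fun e => 1 * red (matrixOf R L) c 0 (0 + i) e) =
      fun e => (R[i]).getD (L.idxOf e) 0 := by
    ext e
    rw [one_mul, red_zero, zero_add, matrixOf, List.getD_eq_getElem?_getD (l := R),
      List.getElem?_eq_getElem hi', Option.getD_some]
  simp only [packRows, List.getElem_map, List.getElem_range]
  rw [h2, packInt_getD hL (h1 _ (List.getElem_mem hi')).1]

theorem elimInv_nil (hL : L.Nodup) (hR : sizeCheck L.length r K h R = true) :
    ElimInv W h r (matrixOf R L) L C d [] 0 ⟨R.map (packList W h), 1, 0, []⟩ := by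
  refine ⟨?_, Nat.one_pos, ?_, rfl⟩
  · simpa using (packRows_matrixOf hL hR).symm
  · simp [lead_zero]

/-! #### The checks -/

/-- The check that the last row is positive outside of each facet, once reduced by the columns of
the
facet. -/
def positiveCheck (k W : ℕ) (tabs masks : List ℕ) (i₀ fin : ℕ) (P : List (ℕ × ℕ))
    (R : List (List ℤ)) : Bool :=
  force false (2 ^ W - 1) fun mask => force false (2 ^ (W - 1)) fun h =>
    force false (packInt W h (0 : ℕ × ℕ → ℤ) ((0, 0) :: P)) fun β =>
      force false i₀ fun i₀ => force false fin fun fin =>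
      forceRows W h R fun rows => forceSteps k W tabs [] P masks fun st =>
        traverse (elimStep mask h β) pushStep (positiveLeaf mask h) fin st i₀ ⟨rows, 1, 0, []⟩

/-- The check that the last row is negative somewhere on each facet but one, once reduced by the
columns of the complement of the facet, and that the sign of the minors of the columns of this
complement is given by `nus`. -/
def negativeCheck (k W : ℕ) (tabs nus masks : List ℕ) (i₀ fin : ℕ) (P : List (ℕ × ℕ))
    (R : List (List ℤ)) (b₀ : ℕ) (acc₀ : List ℕ) : Bool :=
  force false (2 ^ W - 1) fun mask => force false (2 ^ (W - 1)) fun h =>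
    force false (packInt W h (0 : ℕ × ℕ → ℤ) ((0, 0) :: P)) fun β =>
      force false i₀ fun i₀ => force false fin fun fin =>
      forceRows W h R fun rows => forceSteps k W tabs nus P masks fun st =>
        traverse pushStep (elimStep mask h β) (negativeLeaf mask h b₀ acc₀)
            fin st i₀ ⟨rows, 1, 0, []⟩

omit [DecidableEq ι] in
theorem packInt_zero_congr {α : Type*} {l : List α} (hl : l.length = L.length) :
    packInt W h (0 : α → ℤ) l = packInt W h (0 : ι → ℤ) L := by
  induction L generalizing l with
  | nil => rw [List.length_eq_zero_iff.1 hl]; rfl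
  | cons e L ih =>
    cases l with
    | nil => simp at hl
    | cons a l =>
      have hl' : l.length = L.length := by simpa using hl
      have := ih hl'
      simp only [packInt, pack, Pi.zero_apply] at this ⊢
      rw [this, hl']

theorem colSeq_concat (hd : d ∉ C) : colSeq (L ++ [d]) C d = colSeq L C d := by
  funext i
  simp [colSeq, hd]

variable {k m n : ℕ} {tabs nus masks : List ℕ} {E : ι → ℕ × ℕ}

/-- Along the branch of `F` the columns of `F` are the pivots and the other columns are left aside.
With the empty list of signs every local sign is zero, so the stored parity is that of the sign
changes alone. The column `d` is never a pivot and never tested. -/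
theorem lead_mul_red_pos (hL : (L ++ [d]).Nodup) (hW : W ≠ 0)
    (hg : ∀ e ∈ L, edgeGen k (E e) + 1 < m) (htab : tableCheck m n tabs = true)
    (hmask : maskCheck k n (stateIdx m (reversal m)) tabs (L.map E) masks = true)
    (hR : sizeCheck (L ++ [d]).length r K (2 ^ (W - 1)) R = true)
    (h : positiveCheck k W tabs masks (stateIdx m id) (stateIdx m (reversal m)) (L.map E) R = true)
        {F : Finset ι}
    (hF : IsFacet (fun e => edgeGen k (E e)) m L F) (hr : #F = r) :
    lead (matrixOf R (L ++ [d])) (colSeq L F d) r ≠ 0 ∧ ∀ q ∈ L, q ∉ F →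
      0 < lead (matrixOf R (L ++ [d])) (colSeq L F d) r * red (matrixOf R (L ++ [d]))
          (colSeq L F d) r r q := by
  have hW' : 2 * 2 ^ (W - 1) = 2 ^ W := by
    rw [← pow_succ', Nat.sub_add_cancel (Nat.one_le_iff_ne_zero.2 hW)]
  obtain ⟨hL', -, hdL⟩ := List.nodup_append.1 hL
  replace hdL : d ∉ L := fun h => hdL d h d (by simp) rfl
  have hlen : (L.filter (· ∈ F)).length = r := by
    rw [← hr, ← List.toFinset_card_of_nodup (hL'.filter _)]
    congr 1
    ext e
    simp only [List.mem_toFinset, List.mem_filter, decide_eq_true_eq]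
    exact ⟨fun h => h.2, fun h => ⟨List.mem_toFinset.1 (hF.subset h), h⟩⟩
  have hd : d ∉ F := fun h => hdL (List.mem_toFinset.1 (hF.subset h))
  rw [← colSeq_concat hd]
  have hlen' := hlen
  rw [show L.filter (· ∈ F) = (L ++ [d]).filter (· ∈ F) by simp [hd]] at hlen'
  have hred := abs_red_lt_of_sizeCheck hR (c := colSeq (L ++ [d]) F d)
  rw [positiveCheck] at h
  dsimp only [force] at h
  rw [forceRows_eq, forceSteps_eq, packInt_zero_congr (L := L ++ [d]) (by simp)] at h
  obtain ⟨w, s, ⟨pre, hpre, hs⟩, hleaf⟩ := exists_leaf_of_traverse (σ := Elim) htab (F := F)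
    (I := fun l _ s => ∃ pre, L = pre ++ l ∧
      ElimInv W (2 ^ (W - 1)) r (matrixOf R (L ++ [d])) (L ++ [d]) F d pre 0 s)
    (fun e l w s A c he ⟨pre, hpre, hs⟩ hc => by
      obtain ⟨s', hs', hc'⟩ := hs.elim hW' hlen' hred (e := e) (l := l ++ [d]) (by simp [hpre])
          he (by simp [stepOf]) hc
      refine ⟨s', ⟨pre ++ [e], by simp [hpre], ?_⟩, hc'⟩
      have h0 : bitAt 0 (stateIdx m w) = 0 := by simp [bitAt]
      simpa [stepOf, h0] using hs')
    (fun e l w s A c he ⟨pre, hpre, hs⟩ hc => by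
      obtain ⟨s', hs', hc'⟩ := hs.push hL (e := e) (l := l ++ [d]) (by simp [hpre])
          he (by simp [stepOf]) hc
      exact ⟨s', ⟨pre ++ [e], by simp [hpre], hs'⟩, hc'⟩)
    (w := 1) hmask hg (fun _ _ => rfl) ((isFacet_iff hg hL').1 hF).2 ⟨[], rfl, elimInv_nil hL hR⟩ h
  rw [List.append_nil] at hpre
  subst hpre
  refine ⟨fun h0 => ?_, fun q hq hqF => ?_⟩
  · have h1 := hs.sign
    have h2 := hs.pos
    rw [hlen, h0, mul_zero] at h1
    omega
  · rw [hs.mul_red hlen]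
    refine mul_pos (by exact_mod_cast hs.pos) ?_
    have h1 := hs.digit_eq hL hW' hlen hred (List.mem_append_left _ hq)
    have h2 := forallPositive_eq_true.1 hleaf (shift W (L ++ [d]) q) (by
      show _ ∈ s.acc
      rw [hs.acc, List.mem_reverse]
      exact List.mem_map_of_mem (by simp [hq, hqF]))
    replace h2 : _ < digit (2 ^ W - 1) (s.rows.headD 0) (shift W (L ++ [d]) q) := h2
    omega

/-- Now the letters outside `F` are the pivots. The stored parity is that of the sign changes plus
the local signs, so a common final value `b₀` says that the sign of every complementary minor is
predicted by `signSum`. The columns left aside form `F` itself, and their shifts identify the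
exceptional facet. -/
theorem lead_sign (hL : (L ++ [d]).Nodup) (hW : W ≠ 0)
    (hg : ∀ e ∈ L, edgeGen k (E e) + 1 < m) (htab : tableCheck m n tabs = true)
    (hmask : maskCheck k n (stateIdx m (reversal m)) tabs (L.map E) masks = true)
    (hR : sizeCheck (L ++ [d]).length r K (2 ^ (W - 1)) R = true) {b₀ : ℕ} {acc₀ : List ℕ}
    (h : negativeCheck k W tabs nus masks (stateIdx m id) (stateIdx m (reversal m)) (L.map E)
        R b₀ acc₀ = true)
    (hrm : maxLength m = r) {F : Finset ι} (hF : IsFacet (fun e => edgeGen k (E e)) m L F) :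
    0 < (-1) ^ (b₀ + signSum m k E nus F L 1) *
      lead (matrixOf R (L ++ [d])) (colSeq L (L.toFinset \ F) d) r ∧
    ((∃ q ∈ F, lead (matrixOf R (L ++ [d])) (colSeq L (L.toFinset \ F) d) r *
      red (matrixOf R (L ++ [d])) (colSeq L (L.toFinset \ F) d) r r q < 0) ∨
      F = {q ∈ L.toFinset | shift W (L ++ [d]) q ∈ acc₀}) := by
  have hW' : 2 * 2 ^ (W - 1) = 2 ^ W := by
    rw [← pow_succ', Nat.sub_add_cancel (Nat.one_le_iff_ne_zero.2 hW)]
  have hmemC : ∀ {e}, e ∈ L → (e ∈ L.toFinset \ F ↔ e ∉ F) := fun {e} he => by simp [he]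
  obtain ⟨hL', -, hdL⟩ := List.nodup_append.1 hL
  replace hdL : d ∉ L := fun h => hdL d h d (by simp) rfl
  have hlen : (L.filter (· ∈ L.toFinset \ F)).length = r := by
    have h1 := length_filter_notMem hL' hF.subset
    have h2 := hF.card
    have h3 : L.filter (· ∈ L.toFinset \ F) = L.filter (· ∉ F) :=
      List.filter_congr fun e he => by simp [he]
    rw [h3]
    omega
  have hd : d ∉ L.toFinset \ F := fun h => hdL (by simpa using (mem_sdiff.1 h).1)
  rw [← colSeq_concat hd]
  have hlen' := hlen
  rw [show L.filter (· ∈ L.toFinset \ F) = (L ++ [d]).filter (· ∈ L.toFinset \ F) by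
    simp [hdL]] at hlen'
  have hred := abs_red_lt_of_sizeCheck hR (c := colSeq (L ++ [d]) (L.toFinset \ F) d)
  rw [negativeCheck] at h
  dsimp only [force] at h
  rw [forceRows_eq, forceSteps_eq, packInt_zero_congr (L := L ++ [d]) (by simp)] at h
  obtain ⟨w, s, ⟨pre, n, hpre, hn, hs⟩, hleaf⟩ := exists_leaf_of_traverse (σ := Elim) htab (F := F)
    (I := fun l w s => ∃ pre n, L = pre ++ l ∧ n + signSum m k E nus F l w =
        signSum m k E nus F L 1 ∧
      ElimInv W (2 ^ (W - 1)) r (matrixOf R (L ++ [d])) (L ++ [d]) (L.toFinset \ F) d pre n s)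
    (fun e l w s A c he ⟨pre, n, hpre, hn, hs⟩ hc => by
      obtain ⟨s', hs', hc'⟩ := hs.push hL (e := e) (l := l ++ [d]) (by simp [hpre])
        (by rw [hmemC (by simp [hpre]), not_not]; exact he) (by simp [stepOf]) hc
      rw [signSum, if_pos he] at hn
      exact ⟨s', ⟨pre ++ [e], n, by simp [hpre], hn, hs'⟩, hc'⟩)
    (fun e l w s A c he ⟨pre, n, hpre, hn, hs⟩ hc => by
      obtain ⟨s', hs', hc'⟩ := hs.elim hW' hlen' hred (e := e) (l := l ++ [d]) (by simp [hpre])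
        ((hmemC (by simp [hpre])).2 he) (by simp [stepOf]) hc
      rw [signSum, if_neg he, ← add_assoc] at hn
      exact ⟨s', ⟨pre ++ [e], _, by simp [hpre], hn, hs'⟩, hc'⟩)
    (w := 1) hmask hg (fun _ _ => rfl) ((isFacet_iff hg hL').1 hF).2
    ⟨[], 0, rfl, zero_add _, elimInv_nil hL hR⟩ h
  rw [List.append_nil] at hpre
  subst hpre
  rw [signSum, add_zero] at hn
  obtain ⟨rows, g, b, acc⟩ := s
  rw [negativeLeaf, Bool.and_eq_true] at hleaf
  dsimp only [force] at hleaf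
  rw [Bool.or_eq_true, existsNegative_eq_true, beq_iff_eq] at hleaf
  obtain ⟨hb, hacc⟩ := hleaf
  set s : Elim := ⟨rows, g, b, acc⟩ with hsdef
  have hb' : s.b % 2 = b₀ := by
    rw [← Nat.eq_of_beq_eq_true hb]
    exact (Nat.and_one_is_mod _).symm
  constructor
  · have h1 : (-1 : ℤ) ^ (b₀ + signSum m k E nus F L 1) = (-1) ^ (s.b + n) := by
      rw [neg_one_pow_eq_pow_mod_two, neg_one_pow_eq_pow_mod_two (s.b + n), ← hn]
      congr 1
      omega
    have h2 := hs.sign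
    rw [hlen] at h2
    rw [h1, h2]
    exact_mod_cast hs.pos
  · have hmem : ∀ t, t ∈ s.acc ↔ ∃ q ∈ F, shift W (L ++ [d]) q = t := by
      intro t
      rw [hs.acc, List.mem_reverse, List.mem_map]
      refine exists_congr fun q => and_congr_left fun _ => ?_
      rw [List.mem_filter, decide_eq_true_eq]
      refine ⟨fun h => not_not.1 fun h' => h.2 ((hmemC h.1).2 h'), fun h => ?_⟩
      have hq := List.mem_toFinset.1 (hF.subset h)
      exact ⟨hq, fun h' => (hmemC hq).1 h' h⟩
    rcases hacc with ⟨t, ht, hlt⟩ | hacc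
    · left
      obtain ⟨q, hq, hqt⟩ := (hmem t).1 ht
      rw [← hqt] at hlt
      refine ⟨q, hq, ?_⟩
      rw [hs.mul_red hlen]
      refine mul_neg_of_pos_of_neg (by exact_mod_cast hs.pos) ?_
      have h1 := hs.digit_eq hL hW' hlen hred
        (List.mem_append_left _ (List.mem_toFinset.1 (hF.subset hq)))
      replace hlt : digit (2 ^ W - 1) (s.rows.headD 0) (shift W (L ++ [d]) q) < 2 ^ (W - 1) := hlt
      omega
    · right
      ext q
      rw [mem_filter, List.mem_toFinset, ← hacc, show acc = s.acc from rfl, hmem]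
      constructor
      · exact fun h => ⟨List.mem_toFinset.1 (hF.subset h), q, h, rfl⟩
      · rintro ⟨hq, q', hq', h⟩
        rwa [shift_injOn hW (List.mem_append_left _ hq)
          (List.mem_append_left _ (List.mem_toFinset.1 (hF.subset hq'))) h.symm]

end

end Bareiss

namespace Multiassoc

open Subword Bareiss

/-! ### The multiassociahedron as a subword complex -/

/-- The pair of endpoints of an edge. -/
def Edge.ends {n : ℕ} (e : Edge n) : ℕ × ℕ := (e.1.1, e.1.2)

theorem Edge.ends_injective {n : ℕ} : Function.Injective (Edge.ends (n := n)) := by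
  rintro ⟨⟨a, b⟩, h⟩ ⟨⟨a', b'⟩, h'⟩ he
  simpa [Edge.ends, Fin.ext_iff] using he

theorem Edge.cross_iff {n : ℕ} (e f : Edge n) : e.Cross f ↔ edgeCross e.ends f.ends = true := by
  simp only [Edge.Cross, edgeCross, Edge.ends, Bool.or_eq_true, Bool.and_eq_true, Nat.blt_eq,
    Fin.lt_def, and_assoc]

theorem crossingFree_iff {n k : ℕ} {F : Finset (Edge n)} :
    CrossingFree (k + 1) F ↔ CrossFree k Edge.ends F := by
  refine forall₂_congr fun C hC => ?_
  rw [IsCrossing, not_and]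
  refine imp_congr_right fun _ => ?_
  simp only [Edge.cross_iff, not_forall, exists_prop, Bool.not_eq_true]

/-- The edges of the `n`-gon in a list of pairs. -/
def edgesOf (n : ℕ) (P : List (ℕ × ℕ)) : List (Edge n) :=
  P.filterMap fun p => if h : p.1 < p.2 ∧ p.2 < n then
    some ⟨(⟨p.1, h.1.trans h.2⟩, ⟨p.2, h.2⟩), h.1⟩ else none

theorem map_ends_edgesOf {n : ℕ} {P : List (ℕ × ℕ)} (hP : ∀ p ∈ P, p.1 < p.2 ∧ p.2 < n) :
    (edgesOf n P).map Edge.ends = P := by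
  induction P with
  | nil => rfl
  | cons p P ih =>
    have ih' := ih fun q hq => hP q (List.mem_cons_of_mem _ hq)
    rw [edgesOf, List.filterMap_cons]
    simp only [dif_pos (hP p List.mem_cons_self), List.map_cons]
    rw [edgesOf] at ih'
    rw [ih']
    rfl

/-- The pairs in `P` are the relevant edges of the `n`-gon, and the corresponding subword complex
has
the crossing-free sets as faces. -/
structure IsRelevantWord (k n m : ℕ) (P : List (ℕ × ℕ)) (masks : List ℕ) : Prop where
  lt : ∀ p ∈ P, p.1 < p.2 ∧ p.2 < n
  relevant : ∀ j < n, ∀ i < j, (i, j) ∈ P ↔ k + 1 ≤ min (j - i) (n - (j - i))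
  nodup : P.Nodup
  gen_lt : ∀ p ∈ P, edgeGen k p + 1 < m
  code : codeCheck m masks = true
  fill : fillCheck k m P = true
  cross : crossFreeCheck k m masks P = true

open Classical in
/-- The facets of the multiassociahedron. -/
noncomputable def facets (k n m : ℕ) (P : List (ℕ × ℕ)) : Finset (Finset (Edge n)) :=
  {F ∈ (edgesOf n P).toFinset.powerset | IsFacet (fun e => edgeGen k e.ends) m (edgesOf n P) F}

theorem mem_facets {k n m : ℕ} {P : List (ℕ × ℕ)} {F : Finset (Edge n)} :
    F ∈ facets k n m P ↔ IsFacet (fun e => edgeGen k e.ends) m (edgesOf n P) F := by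
  classical
  rw [facets, mem_filter, mem_powerset]
  exact and_iff_right_of_imp fun h => h.subset

namespace IsRelevantWord

variable {k n m : ℕ} {P : List (ℕ × ℕ)} {masks : List ℕ}

theorem mem_edgesOf (h : IsRelevantWord k n m P masks) (e : Edge n) :
    e ∈ edgesOf n P ↔ k + 1 ≤ e.length := by
  rw [← List.mem_map_of_injective Edge.ends_injective, map_ends_edgesOf h.lt]
  exact h.relevant e.1.2 e.1.2.2 e.1.1 e.2

theorem nodup_edgesOf (h : IsRelevantWord k n m P masks) : (edgesOf n P).Nodup := by
  refine List.Nodup.of_map Edge.ends ?_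
  rw [map_ends_edgesOf h.lt]
  exact h.nodup

theorem length_edgesOf (h : IsRelevantWord k n m P masks) : (edgesOf n P).length = P.length := by
  rw [← List.length_map Edge.ends, map_ends_edgesOf h.lt]

theorem gen_lt' (h : IsRelevantWord k n m P masks) :
    ∀ e ∈ edgesOf n P, edgeGen k (Edge.ends e) + 1 < m := fun e he =>
  h.gen_lt _ (by rw [← map_ends_edgesOf h.lt]; exact List.mem_map_of_mem he)

/-- The two searches give the two inclusions between the crossing-free sets and the subword complex.
-/
theorem mem_faces_iff (h : IsRelevantWord k n m P masks) (F : Finset (Edge n)) :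
    F ∈ (multiassociahedron k n).faces ↔ F.Nonempty ∧ ∃ G ∈ facets k n m P, F ⊆ G := by
  have hmap := map_ends_edgesOf h.lt
  constructor
  · rintro ⟨hne, hrel, hcr⟩
    obtain ⟨G, hG, hFG⟩ := exists_facet_of_fillCheck (E := Edge.ends) (m := m)
        h.code h.nodup_edgesOf
      h.gen_lt' (by rw [hmap]; exact h.fill)
      (fun e he => List.mem_toFinset.2 ((h.mem_edgesOf e).2 (hrel e he))) (crossingFree_iff.1 hcr)
    exact ⟨hne, G, mem_facets.2 hG, hFG⟩
  · rintro ⟨hne, G, hG, hFG⟩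
    rw [mem_facets] at hG
    refine ⟨hne, fun e he => (h.mem_edgesOf e).1 (List.mem_toFinset.1 (hG.subset (hFG he))), ?_⟩
    have h1 := crossingFree_iff.2 (crossFree_of_isFacet (E := Edge.ends) h.code h.nodup_edgesOf
      h.gen_lt' (by rw [hmap]; exact h.cross) hG)
    exact fun C hC => h1 C (hC.trans hFG)

theorem facets_nonempty (h : IsRelevantWord k n m P masks) : (facets k n m P).Nonempty := by
  obtain ⟨G, hG, -⟩ := exists_facet_of_fillCheck (E := Edge.ends) (m := m) (G := ∅) h.code
    h.nodup_edgesOf h.gen_lt' (by rw [map_ends_edgesOf h.lt]; exact h.fill) (by simp)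
    fun C hC hCk => by
      rw [subset_empty.1 hC] at hCk
      simp at hCk
  exact ⟨G, mem_facets.2 hG⟩

theorem exists_flip (h : IsRelevantWord k n m P masks) {F : Finset (Edge n)}
    (hF : F ∈ facets k n m P) {e : Edge n} (he : e ∈ F) :
    ∃ p, p ∉ F ∧ insert p (F.erase e) ∈ facets k n m P := by
  simp only [mem_facets] at hF ⊢
  exact hF.exists_flip h.gen_lt' h.nodup_edgesOf he

end IsRelevantWord

/-! ### Bases from minors -/

section Coordinates

theorem exists_coordinates {ι V : Type*} [DecidableEq ι] [AddCommGroup V] [Module ℝ V]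
    [FiniteDimensional ℝ V] {v : ι → V} {F : Finset ι} (hv : LinearIndepOn ℝ v (F : Set ι))
    (hF : #F = Module.finrank ℝ V) : ∃ c : ι → V →ₗ[ℝ] ℝ, (∀ x, ∑ e ∈ F, c e x • v e = x) := by
  have hv' : LinearIndependent ℝ fun x : F => v x := hv
  rcases isEmpty_or_nonempty F with hE | hE
  · have h0 : Module.finrank ℝ V = 0 := by
      rw [← hF, card_eq_zero]
      exact isEmpty_coe_sort.1 hE
    have := Module.finrank_zero_iff.1 h0
    exact ⟨fun _ => 0, fun x => Subsingleton.elim _ _⟩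
  · let B := basisOfLinearIndependentOfCardEqFinrank hv' (by rw [Fintype.card_coe, hF])
    refine ⟨fun e => if h : e ∈ F then B.coord ⟨e, h⟩ else 0, fun x => ?_⟩
    rw [← sum_coe_sort]
    conv_rhs => rw [← B.sum_repr x]
    refine sum_congr rfl fun e _ => ?_
    simp [B]

theorem matrixOf_pos {ι : Type*} [DecidableEq ι] {L : List ι} {R : List (List ℤ)} {i : ℕ}
    (hi : (R.getD i []).length = L.length) (h : (R.getD i []).all (fun x => decide (0 < x)) = true)
    {e : ι} (he : e ∈ L) : 0 < matrixOf R L i e := by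
  have h2 : L.idxOf e < (R.getD i []).length := hi ▸ List.idxOf_lt_length_of_mem he
  rw [matrixOf, List.getD_eq_getElem _ _ h2]
  simpa using List.all_eq_true.1 h _ (List.getElem_mem h2)

theorem colSeq_bijOn {ι : Type*} [DecidableEq ι] {L : List ι} (hL : L.Nodup) {F : Finset ι} (d : ι)
    (hF : F ⊆ L.toFinset) {r : ℕ} (hr : #F = r) :
    (∀ i < r, colSeq L F d i ∈ F) ∧ (∀ i < r, ∀ j < r, colSeq L F d i = colSeq L F d j → i = j) ∧
      ∀ e ∈ F, ∃ i < r, colSeq L F d i = e := by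
  have hn : (L.filter (· ∈ F)).Nodup := hL.filter _
  have hT : (L.filter (· ∈ F)).toFinset = F := by
    ext e
    simp only [List.mem_toFinset, List.mem_filter, decide_eq_true_eq]
    exact ⟨fun h => h.2, fun h => ⟨List.mem_toFinset.1 (hF h), h⟩⟩
  have hlen : (L.filter (· ∈ F)).length = r := by
    rw [← hr, ← List.toFinset_card_of_nodup hn, hT]
  have hget : ∀ i (hi : i < r), colSeq L F d i = (L.filter (· ∈ F))[i]'(hlen ▸ hi) := by
    intro i hi
    rw [colSeq, List.getD_eq_getElem]
  refine ⟨fun i hi => ?_, fun i hi j hj hij => ?_, fun e he => ?_⟩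
  · rw [hget i hi]
    have := (List.mem_filter.1 (List.getElem_mem (l := L.filter (· ∈ F)) (hlen.symm ▸ hi))).2
    simpa using this
  · rw [hget i hi, hget j hj] at hij
    exact (List.Nodup.getElem_inj_iff hn).1 hij
  · rw [← hT, List.mem_toFinset] at he
    obtain ⟨i, hi, rfl⟩ := List.mem_iff_getElem.1 he
    exact ⟨i, hlen ▸ hi, hget i (hlen ▸ hi)⟩

theorem linearIndepOn_of_lead_ne_zero {ι : Type*} [DecidableEq ι] {M : ℕ → ι → ℤ} {L : List ι}
    (hL : L.Nodup) {F : Finset ι} {d : ι} (hF : F ⊆ L.toFinset) {r : ℕ} (hr : #F = r)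
    (h : lead M (colSeq L F d) r ≠ 0) :
    LinearIndepOn ℝ (fun e => fun b : Fin r => (M b e : ℝ)) (F : Set ι) := by
  obtain ⟨h1, h2, h3⟩ := colSeq_bijOn hL d hF hr
  have hdet : ((block M (colSeq L F d) r).map (Int.cast : ℤ → ℝ)).det ≠ 0 := by
    have := Int.cast_det (R := ℝ) (block M (colSeq L F d) r)
    rw [← this]
    exact_mod_cast h
  have h4 := Matrix.linearIndependent_cols_of_det_ne_zero hdet
  let f : Fin r ≃ F := Equiv.ofBijective (fun i => ⟨colSeq L F d i, h1 i i.2⟩)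
    ⟨fun i j hij => Fin.ext (h2 i i.2 j j.2 (congrArg Subtype.val hij)), fun ⟨e, he⟩ => by
      obtain ⟨i, hi, hie⟩ := h3 e he
      exact ⟨⟨i, hi⟩, Subtype.ext hie⟩⟩
  exact (linearIndependent_equiv f).1 h4

end Coordinates

/-! ### Polytopality -/

/-- The first `D` rows are vectors and row `D` their heights; the points are the vectors divided by
the heights. For each facet, the linear functional that equals the height on its vectors is strictly
smaller than the height elsewhere, and after division it is the supporting functional of the facet.
-/
theorem isPolytopalSphere_of_positiveCheck {k n m D K W s : ℕ} {P : List (ℕ × ℕ)}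
    {cmasks tabs masks : List ℕ} {R : List (List ℤ)} (h : IsRelevantWord k n m P cmasks)
    (hW : W ≠ 0) (htab : tableCheck m s tabs = true)
    (hmask : maskCheck k s (stateIdx m (reversal m)) tabs P masks = true)
    (hR : sizeCheck (P.length + 1) D K (2 ^ (W - 1)) R = true)
    (hpos : positiveCheck k W tabs masks (stateIdx m id) (stateIdx m (reversal m)) P R = true)
    (hheight : (R.getD D []).all (fun x => decide (0 < x)) = true) (hD : 0 < D)
    (hlen : P.length = D + maxLength m) (d : Edge n) (hd : ¬k + 1 ≤ d.length) :
    IsPolytopalSphere (multiassociahedron k n) D := by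
  set L := edgesOf n P with hLdef
  have hLn : L.Nodup := h.nodup_edgesOf
  have hdL : d ∉ L := fun h' => hd ((h.mem_edgesOf d).1 h')
  have hLd : (L ++ [d]).Nodup := List.nodup_append.2 ⟨hLn, List.nodup_singleton d,
    fun a ha b hb hab => hdL (by rw [List.mem_singleton] at hb; rwa [← hb, ← hab])⟩
  have hmap : L.map Edge.ends = P := map_ends_edgesOf h.lt
  have hLl : L.length = P.length := h.length_edgesOf
  set M := matrixOf R (L ++ [d]) with hM
  have hheight' : ∀ e ∈ L, (0 : ℝ) < M D e := by
    intro e he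
    have h1 : (R.getD D []).length = (L ++ [d]).length := by
      simp only [sizeCheck, Bool.and_eq_true, Nat.beq_eq, List.all_eq_true] at hR
      have hDl : D < R.length := by omega
      rw [List.getD_eq_getElem _ _ hDl, (hR.1.1.2 _ (List.getElem_mem hDl)).1]
      simp [hLl]
    exact_mod_cast matrixOf_pos h1 hheight (List.mem_append_left [d] he)
  set v : Edge n → Fin D → ℝ := fun e b => (M b e : ℝ) with hv
  set p : Edge n → Fin D → ℝ := fun e => (M D e : ℝ)⁻¹ • v e with hp
  have hfacet : ∀ F ∈ facets k n m P, F ⊆ L.toFinset ∧ #F = D ∧ lead M (colSeq L F d) D ≠ 0 ∧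
      ∀ q ∈ L, q ∉ F → 0 < lead M (colSeq L F d) D * red M (colSeq L F d) D D q := by
    intro F hF
    rw [mem_facets] at hF
    have hcard : #F = D := by
      have := hF.card
      rw [← hLdef, hLl] at this
      omega
    refine ⟨hF.subset, hcard, lead_mul_red_pos (E := Edge.ends) hLd hW h.gen_lt' htab
      (by rw [hmap]; exact hmask) (K := K) (by simpa [hLl] using hR) (by rw [hmap]; exact hpos)
          hF hcard⟩
  have hli : ∀ F ∈ facets k n m P, LinearIndepOn ℝ p (F : Set (Edge n)) := by
    intro F hF
    obtain ⟨h1, h2, h3, -⟩ := hfacet F hF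
    have h4 : LinearIndependent ℝ fun e : F => v e := linearIndepOn_of_lead_ne_zero hLn h1 h2 h3
    have h5 : ∀ e : F, (M D e : ℝ)⁻¹ ≠ 0 := fun e =>
      inv_ne_zero (hheight' e (List.mem_toFinset.1 (h1 e.2))).ne'
    exact h4.units_smul fun e => Units.mk0 _ (h5 e)
  have hcoord : ∀ F ∈ facets k n m P, ∃ c : Edge n → (Fin D → ℝ) →ₗ[ℝ] ℝ,
      ∀ x, ∑ e ∈ F, c e x • p e = x := fun F hF =>
    exists_coordinates (hli F hF) (by rw [(hfacet F hF).2.1]; simp)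
  have hsupp : ∀ F ∈ facets k n m P, ∃ a : (Fin D → ℝ) →ₗ[ℝ] ℝ, (∀ e ∈ F, a (p e) = 1) ∧
      ∀ e ∈ L, e ∉ F → a (p e) < 1 := by
    intro F hF
    obtain ⟨h1, h2, h3, h4⟩ := hfacet F hF
    obtain ⟨y, hy⟩ := isReduction_red (M := M) (c := colSeq L F d) D D
    set ℓ := lead M (colSeq L F d) D with hℓ
    have hℓ0 : (ℓ : ℝ) ≠ 0 := by exact_mod_cast h3
    -- The coefficients of the reduction of the height row, divided by the minor. The defect from
    -- one is the reduced entry times `ℓ`, divided by `ℓ ^ 2` and the height, so it has the sign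
    -- certified by the check.
    refine ⟨∑ b : Fin D, ((y b : ℝ) / ℓ) • LinearMap.proj b, ?_⟩
    have h5 : ∀ e ∈ L, (∑ b : Fin D, ((y b : ℝ) / ℓ) • LinearMap.proj b : (Fin D → ℝ) →ₗ[ℝ] ℝ)
        (p e) =
        1 - (ℓ * red M (colSeq L F d) D D e : ℤ) / (ℓ ^ 2 * M D e) := by
      intro e he
      have h6 := (hheight' e he).ne'
      have h7 : (red M (colSeq L F d) D D e : ℝ) = ℓ * M D e - ∑ b : Fin D, (y b : ℝ) * M b e := by
        rw [hy e, sum_range]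
        push_cast
        rfl
      have h8 : (∑ b : Fin D, ((y b : ℝ) / ℓ) • LinearMap.proj b : (Fin D → ℝ) →ₗ[ℝ] ℝ) (p e) =
          (∑ b : Fin D, (y b : ℝ) * M b e) / (ℓ * M D e) := by
        rw [LinearMap.sum_apply, sum_div]
        refine sum_congr rfl fun b _ => ?_
        simp only [hp, hv, LinearMap.smul_apply, LinearMap.proj_apply, Pi.smul_apply, smul_eq_mul]
        field_simp
      rw [h8]
      push_cast
      rw [h7]
      field_simp
      ring
    refine ⟨fun e he => ?_, fun e he heF => ?_⟩
    · have h6 : red M (colSeq L F d) D D e = 0 := by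
        obtain ⟨i, hi, rfl⟩ := (colSeq_bijOn hLn d h1 h2).2.2 e he
        exact red_apply_of_lt hi D
      rw [h5 e (List.mem_toFinset.1 (h1 he)), h6]
      simp
    · rw [h5 e he]
      have h6 : (0 : ℝ) < (ℓ * red M (colSeq L F d) D D e : ℤ) := by exact_mod_cast h4 e he heF
      have h7 := hheight' e he
      have h8 : (0 : ℝ) < ℓ ^ 2 * M D e := by positivity
      have := div_pos h6 h8
      linarith
  choose! c hc using hcoord
  choose! a ha ha' using hsupp
  have hflips : SupportingFlips p L.toFinset (facets k n m P) c a :=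
    { nonempty := h.facets_nonempty
      facet_nonempty := fun F hF => card_pos.1 (by rw [(hfacet F hF).2.1]; exact hD)
      subset := fun F hF => (hfacet F hF).1
      sum_coord := hc
      linearIndepOn := hli
      support_eq := ha
      support_lt := fun F hF e he heF => ha' F hF e (List.mem_toFinset.1 he) heF
      exists_flip := fun F hF e he => h.exists_flip hF he }
  exact hflips.isPolytopalSphere h.mem_faces_iff

end Multiassoc

/-! ### Gale duality -/

section GaleDual

open Matrix

variable {ι : Type*} {r D : ℕ} {M : Matrix (Fin r) ι ℝ} {S : Finset ι}

/-- The linear map whose kernel consists of the vectors that agree on `S` with a combination of the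
rows of `M`. -/
theorem exists_galeDual [Finite ι] (hM : ∀ y : Fin r → ℝ, (∀ e ∈ S, (y ᵥ* M) e = 0) → y = 0)
    (hS : #S = D + r) : ∃ π : (ι → ℝ) →ₗ[ℝ] (Fin D → ℝ), Function.Surjective π ∧
      ∀ x, π x = 0 ↔ ∃ y : Fin r → ℝ, ∀ e ∈ S, x e = (y ᵥ* M) e := by
  let res : (ι → ℝ) →ₗ[ℝ] (S → ℝ) := LinearMap.funLeft ℝ ℝ Subtype.val
  have hres : Function.Surjective res :=
    LinearMap.funLeft_surjective_of_injective _ _ _ Subtype.val_injective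
  let T : (Fin r → ℝ) →ₗ[ℝ] (S → ℝ) := res ∘ₗ M.vecMulLinear
  have hT : Function.Injective T := by
    rw [injective_iff_map_eq_zero]
    exact fun y hy => hM y fun e he => congrFun hy ⟨e, he⟩
  have hdim : Module.finrank ℝ ((S → ℝ) ⧸ LinearMap.range T) = Module.finrank ℝ (Fin D → ℝ) := by
    have h1 := (LinearMap.range T).finrank_quotient_add_finrank
    rw [LinearMap.finrank_range_of_inj hT] at h1
    simp only [Module.finrank_fintype_fun_eq_card, Fintype.card_coe, Fintype.card_fin] at h1 ⊢
    omega
  let φ := LinearEquiv.ofFinrankEq _ _ hdim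
  refine ⟨φ.toLinearMap ∘ₗ (LinearMap.range T).mkQ ∘ₗ res, ?_, fun x => ?_⟩
  · exact φ.surjective.comp ((Submodule.mkQ_surjective _).comp hres)
  · rw [LinearMap.comp_apply, LinearEquiv.coe_coe, LinearEquiv.map_eq_zero_iff,
        LinearMap.comp_apply,
      Submodule.mkQ_apply, Submodule.Quotient.mk_eq_zero, LinearMap.mem_range]
    refine exists_congr fun y => ⟨fun h e he => (congrFun h ⟨e, he⟩).symm, fun h => ?_⟩
    ext e
    exact (h e e.2).symm

/-- The entry at `e` of a vector, after subtracting the combination of the rows of `M` that agrees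
with the vector on the columns `c`. -/
noncomputable def cofacetCoord (M : Matrix (Fin r) ι ℝ) (c : Fin r → ι) (e : ι) : (ι → ℝ) →ₗ[ℝ] ℝ :=
  LinearMap.proj e ∘ₗ (LinearMap.id -
    M.vecMulLinear ∘ₗ (M.submatrix id c)⁻¹.vecMulLinear ∘ₗ LinearMap.funLeft ℝ ℝ c)

theorem cofacetCoord_apply (c : Fin r → ι) (e : ι) (x : ι → ℝ) :
    cofacetCoord M c e x = x e - (((x ∘ c) ᵥ* (M.submatrix id c)⁻¹) ᵥ* M) e := rfl

theorem vecMul_comp (c : Fin r → ι) (y : Fin r → ℝ) : (y ᵥ* M) ∘ c = y ᵥ* M.submatrix id c := rfl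

theorem cofacetCoord_apply_self {c : Fin r → ι} (hc : (M.submatrix id c).det ≠ 0) (i : Fin r)
    (x : ι → ℝ) : cofacetCoord M c (c i) x = 0 := by
  have h := congrFun (vecMul_comp (M := M) c ((x ∘ c) ᵥ* (M.submatrix id c)⁻¹)) i
  rw [vecMul_vecMul _ _ (M.submatrix id c), nonsing_inv_mul _ (isUnit_iff_ne_zero.2 hc),
    vecMul_one] at h
  rw [cofacetCoord_apply, sub_eq_zero]
  exact h.symm

theorem cofacetCoord_of_eqOn {c : Fin r → ι} (hc : (M.submatrix id c).det ≠ 0) {x : ι → ℝ}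
    {y : Fin r → ℝ} (hxc : ∀ i, x (c i) = (y ᵥ* M) (c i)) (e : ι) :
    cofacetCoord M c e x = x e - (y ᵥ* M) e := by
  have h : x ∘ c = y ᵥ* M.submatrix id c := funext hxc
  rw [cofacetCoord_apply, h, vecMul_vecMul y, mul_nonsing_inv _ (isUnit_iff_ne_zero.2 hc),
      vecMul_one]

theorem cofacetCoord_single_of_ne [DecidableEq ι] {c : Fin r → ι} {f : ι} (hf : ∀ i, c i ≠ f)
    (e : ι) : cofacetCoord M c e (Pi.single f 1) = if f = e then 1 else 0 := by
  have h : (Pi.single f 1 : ι → ℝ) ∘ c = 0 := funext fun i => Pi.single_eq_of_ne (hf i) _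
  rw [cofacetCoord_apply, h, zero_vecMul, zero_vecMul, Pi.zero_apply, sub_zero, Pi.single_apply]
  simp only [eq_comm]

/-- Cramer's rule: the combination of rows that agrees with the unit vector on the columns `c` has
at `e` the value given by the quotient of two minors, the column `c i` being replaced in place by
`e`. -/
theorem cofacetCoord_single [DecidableEq ι] {c : Fin r → ι}
    (hinj : Function.Injective c) {e : ι} (i : Fin r) (he : e ≠ c i) :
    cofacetCoord M c e (Pi.single (c i) 1) =
      -((M.submatrix id (Function.update c i e)).det / (M.submatrix id c).det) := by
  have h : (Pi.single (c i) 1 : ι → ℝ) ∘ c = Pi.single i 1 := by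
    ext j
    rw [Function.comp_apply, Pi.single_apply, Pi.single_apply]
    simp only [hinj.eq_iff]
  have h1 : M.submatrix id (Function.update c i e) =
      (M.submatrix id c).updateCol i fun b => M b e := by
    ext a b
    rw [submatrix_apply, updateCol_apply, Function.update_apply]
    split_ifs <;> rfl
  have h2 : ((Pi.single i 1 ᵥ* (M.submatrix id c)⁻¹) ᵥ* M) e =
      ((M.submatrix id c)⁻¹ *ᵥ fun b => M b e) i := by
    rw [single_one_vecMul]
    rfl
  rw [cofacetCoord_apply, h, h2, Pi.single_eq_of_ne he, zero_sub, h1, Matrix.inv_def, smul_mulVec,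
    ← cramer_eq_adjugate_mulVec, Pi.smul_apply, cramer_apply, Ring.inverse_eq_inv', smul_eq_mul,
    div_eq_inv_mul]

/-- A Gale dual of `M` is the vector configuration of a fan if the signs of the minors of `M` are
coherent under flips. -/
theorem SignedFlips.exists_of_minors [Finite ι] [DecidableEq ι] {𝓕 : Finset (Finset ι)}
    {col : Finset ι → Fin r → ι} (hne : 𝓕.Nonempty) (hS : #S = D + r) (h𝓕 : ∀ F ∈ 𝓕, F ⊆ S)
    (hcol : ∀ F ∈ 𝓕, ∀ q, q ∈ S \ F ↔ ∃ i, col F i = q)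
    (hinj : ∀ F ∈ 𝓕, Function.Injective (col F))
    (hdet : ∀ F ∈ 𝓕, (M.submatrix id (col F)).det ≠ 0)
    (hflip : ∀ F ∈ 𝓕, ∀ e ∈ F, ∃ p, p ∉ F ∧ insert p (F.erase e) ∈ 𝓕)
    (hsign : ∀ F ∈ 𝓕, ∀ e ∈ F, ∀ i, insert (col F i) (F.erase e) ∈ 𝓕 →
      0 < (M.submatrix id (col F)).det * (M.submatrix id (Function.update (col F) i e)).det)
    (u : ι → ℝ) : ∃ (v : ι → Fin D → ℝ) (c : Finset ι → ι → (Fin D → ℝ) →ₗ[ℝ] ℝ) (x₀ : Fin D → ℝ),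
      SignedFlips v 𝓕 c ∧ ∀ F ∈ 𝓕, ∀ e ∈ F, c F e x₀ = cofacetCoord M (col F) e u := by
  have hcolS : ∀ F ∈ 𝓕, ∀ i, col F i ∈ S ∧ col F i ∉ F := fun F hF i =>
    mem_sdiff.1 ((hcol F hF _).2 ⟨i, rfl⟩)
  obtain ⟨π, hπ, hker⟩ := exists_galeDual (M := M) (S := S) (D := D) (fun y hy => by
    obtain ⟨F, hF⟩ := hne
    exact eq_zero_of_vecMul_eq_zero (hdet F hF) (funext fun i => hy _ (hcolS F hF i).1)) hS
  -- The coordinates on a facet vanish on the kernel of `π`, so composing them with any section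
  -- gives the coordinates on the quotient.
  obtain ⟨σ, hσ⟩ := π.exists_rightInverse_of_surjective (LinearMap.range_eq_top.2 hπ)
  have hψ : ∀ F ∈ 𝓕, ∀ e ∈ F, ∀ x, cofacetCoord M (col F) e (σ (π x)) =
      cofacetCoord M (col F) e x := by
    intro F hF e he x
    obtain ⟨y, hy⟩ := (hker (σ (π x) - x)).1 (by
      rw [map_sub, ← LinearMap.comp_apply π σ, hσ, LinearMap.id_apply, sub_self])
    rw [← sub_eq_zero, ← map_sub]
    rw [cofacetCoord_of_eqOn (hdet F hF) (fun i => hy _ (hcolS F hF i).1), hy e (h𝓕 F hF he),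
        sub_self]
  refine ⟨fun e => π (Pi.single e 1), fun F e => cofacetCoord M (col F) e ∘ₗ σ, π u,
      ⟨?_, ?_, hflip, ?_⟩,
    fun F hF e he => hψ F hF e he u⟩
  · intro F hF X
    obtain ⟨x, rfl⟩ := hπ X
    have h1 : ∑ e ∈ F, (cofacetCoord M (col F) e ∘ₗ σ) (π x) • π (Pi.single e 1) =
        π (∑ e ∈ F, cofacetCoord M (col F) e x • Pi.single e 1) := by
      rw [map_sum]
      refine sum_congr rfl fun e he => ?_
      rw [LinearMap.comp_apply, hψ F hF e he, map_smul]
    rw [h1, ← sub_eq_zero, ← map_sub, hker]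
    refine ⟨-((x ∘ col F) ᵥ* (M.submatrix id (col F))⁻¹), fun q hq => ?_⟩
    have h2 : (∑ e ∈ F, cofacetCoord M (col F) e x • (Pi.single e 1 : ι → ℝ)) q =
        cofacetCoord M (col F) q x := by
      rw [Finset.sum_apply]
      simp only [Pi.smul_apply, Pi.single_apply, smul_eq_mul, mul_ite, mul_one, mul_zero]
      rw [sum_ite_eq]
      split_ifs with hqF
      · rfl
      · obtain ⟨i, rfl⟩ := (hcol F hF q).1 (mem_sdiff.2 ⟨hq, hqF⟩)
        exact (cofacetCoord_apply_self (hdet F hF) i x).symm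
    rw [Pi.sub_apply, h2, cofacetCoord_apply, neg_vecMul, Pi.neg_apply]
    ring
  · intro F hF e he f hf
    rw [LinearMap.comp_apply, hψ F hF e he]
    exact cofacetCoord_single_of_ne (fun i hi => (hcolS F hF i).2 (by rwa [hi])) e
  · intro F hF e he p hp hpF
    obtain ⟨i, rfl⟩ := (hcol F hF p).1 (mem_sdiff.2 ⟨h𝓕 _ hpF (mem_insert_self _ _), hp⟩)
    rw [LinearMap.comp_apply, hψ F hF e he, cofacetCoord_single (hinj F hF) i
      fun h => hp (h ▸ he), neg_lt_zero]
    have h1 := hsign F hF e he i hpF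
    rw [mul_comm] at h1
    exact div_pos_iff.2 (mul_pos_iff.1 h1)

end GaleDual

/-! ### Signs of minors under flips -/

namespace Bareiss

variable {ι : Type*} {M : ℕ → ι → ℤ} {r : ℕ} {d : ι}

theorem lead_swap {a b : List ι} {s t : ι} (h : a.length + 1 < r) :
    lead M (fun i => (a ++ t :: s :: b).getD i d) r =
        -lead M (fun i => (a ++ s :: t :: b).getD i d) r := by
  have h1 : block M (fun i => (a ++ t :: s :: b).getD i d) r =
      (block M (fun i => (a ++ s :: t :: b).getD i d) r).submatrix id
        (Equiv.swap (⟨a.length, by omega⟩ : Fin r) ⟨a.length + 1, h⟩) := by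
    ext x y
    simp only [block, Matrix.of_apply, Matrix.submatrix_apply, id]
    congr 1
    rcases lt_trichotomy (y : ℕ) a.length with hy | hy | hy
    · rw [Equiv.swap_apply_of_ne_of_ne (Fin.ne_of_val_ne hy.ne)
        (Fin.ne_of_val_ne (show (y : ℕ) ≠ a.length + 1 by omega)), List.getD_append _ _ _ _ hy,
        List.getD_append _ _ _ _ hy]
    · rw [show y = ⟨a.length, by omega⟩ from Fin.ext hy, Equiv.swap_apply_left]
      simp
    · rcases Nat.lt_or_ge (a.length + 1) y with hy' | hy'
      · rw [Equiv.swap_apply_of_ne_of_ne (Fin.ne_of_val_ne hy.ne') (Fin.ne_of_val_ne hy'.ne'),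
          List.getD_append_right _ _ _ _ hy.le, List.getD_append_right _ _ _ _ hy.le]
        obtain ⟨z, hz⟩ := Nat.exists_eq_add_of_lt hy'
        rw [show (y : ℕ) - a.length = z + 1 + 1 by omega]
        rfl
      · rw [show y = ⟨a.length + 1, h⟩ from Fin.ext (by dsimp only; omega), Equiv.swap_apply_right]
        simp
  rw [lead, h1, Matrix.det_permute', Equiv.Perm.sign_swap (by simp [Fin.ext_iff])]
  simp [lead]

/-- The column `e` passes the columns of `b` one at a time, each exchange changing the sign. -/
theorem lead_move {a b c : List ι} {e : ι} (h : a.length + b.length < r) :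
    lead M (fun i => (a ++ e :: (b ++ c)).getD i d) r =
      (-1) ^ b.length * lead M (fun i => (a ++ (b ++ e :: c)).getD i d) r := by
  induction b generalizing a with
  | nil => simp
  | cons f b ih =>
    rw [List.length_cons] at h
    have h1 := ih (a := a ++ [f]) (by rw [List.length_append, List.length_singleton]; omega)
    simp only [List.append_assoc, List.singleton_append] at h1
    rw [List.cons_append, lead_swap (by omega), h1, List.length_cons, pow_succ]
    simp only [List.cons_append]
    ring

end Bareiss

namespace Bareiss

open Subword

variable {ι : Type*} {M : ℕ → ι → ℤ} {r : ℕ} {d : ι}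

theorem update_getD_append (a b : List ι) (p e : ι) :
    Function.update (fun i => (a ++ p :: b).getD i d) a.length e = fun i =>
        (a ++ e :: b).getD i d := by
  ext i
  rw [Function.update_apply]
  rcases lt_trichotomy i a.length with hi | rfl | hi
  · rw [if_neg hi.ne, List.getD_append _ _ _ _ hi, List.getD_append _ _ _ _ hi]
  · simp
  · rw [if_neg hi.ne', List.getD_append_right _ _ _ _ hi.le, List.getD_append_right _ _ _ _ hi.le]
    obtain ⟨z, hz⟩ := Nat.exists_eq_add_of_lt hi
    rw [show i - a.length = z + 1 by omega]
    rfl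

theorem eq_length_of_getD_eq {l a b : List ι} {p : ι} (hl : l.Nodup) (h : l = a ++ p :: b) {i : ℕ}
    (hi : i < l.length) (hp : l.getD i d = p) : i = a.length := by
  subst h
  rw [List.getD_eq_getElem _ _ hi] at hp
  refine (List.Nodup.getElem_inj_iff hl (hj := by simp)).1 (hp.trans ?_)
  simp

variable {L a b c : List ι} {e p : ι} {i : ℕ}

theorem exists_split (he : e ∈ L) (hp : p ∈ L) (hep : e ≠ p) :
    ∃ a b c, L = a ++ e :: (b ++ p :: c) ∨ L = a ++ p :: (b ++ e :: c) := by
  obtain ⟨a, b, rfl⟩ := List.append_of_mem he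
  rcases List.mem_append.1 hp with h | h
  · obtain ⟨a, c, rfl⟩ := List.append_of_mem h
    exact ⟨a, c, b, Or.inr (by simp)⟩
  · obtain ⟨c, b, rfl⟩ := List.append_of_mem ((List.mem_cons.1 h).resolve_left hep.symm)
    exact ⟨a, c, b, Or.inl rfl⟩

variable [DecidableEq ι] {F F' : Finset ι}

/-- Replacing `p` in place puts `e` at the position of `p`, while in the order of `L` it stands
before the common letters of `b`. Moving it there costs one sign for each letter of `b` outside `F`.
-/
theorem lead_update_left (hL : L.Nodup) (hlen : (L.filter (· ∉ F)).length = r)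
    (hs : L = a ++ e :: (b ++ p :: c)) (ha : ∀ q ∈ a, q ∈ F ↔ q ∈ F') (hb : ∀ q ∈ b, q ∈ F ↔ q ∈ F')
    (hc : ∀ q ∈ c, q ∈ F ↔ q ∈ F') (he : e ∈ F) (he' : e ∉ F') (hp : p ∉ F) (hp' : p ∈ F')
    (hi : i < r) (hip : (L.filter (· ∉ F)).getD i d = p) :
    lead M (Function.update (fun j => (L.filter (· ∉ F)).getD j d) i e) r =
      (-1) ^ (b.filter (· ∉ F)).length * lead M (fun j => (L.filter (· ∉ F')).getD j d) r := by
  have ha' : a.filter (· ∉ F') = a.filter (· ∉ F) := List.filter_congr fun q hq => by simp [ha q hq]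
  have hb' : b.filter (· ∉ F') = b.filter (· ∉ F) := List.filter_congr fun q hq => by simp [hb q hq]
  have hc' : c.filter (· ∉ F') = c.filter (· ∉ F) := List.filter_congr fun q hq => by simp [hc q hq]
  have h1 : L.filter (· ∉ F) =
      (a.filter (· ∉ F) ++ b.filter (· ∉ F)) ++ p :: c.filter (· ∉ F) := by
    rw [hs, List.filter_append, List.filter_cons_of_neg (by simpa using he), List.filter_append,
      List.filter_cons_of_pos (by simpa using hp), List.append_assoc]
  have h2 : L.filter (· ∉ F') =
      a.filter (· ∉ F) ++ e :: (b.filter (· ∉ F) ++ c.filter (· ∉ F)) := by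
    rw [hs, List.filter_append, List.filter_cons_of_pos (by simpa using he'), List.filter_append,
      List.filter_cons_of_neg (by simpa using hp'), ha', hb', hc']
  have h3 := eq_length_of_getD_eq (hL.filter _) h1 (hlen.symm ▸ hi) hip
  rw [h1, List.length_append, List.length_append, List.length_cons] at hlen
  rw [h3, h1, update_getD_append, h2, lead_move (by omega), ← mul_assoc, ← mul_pow, neg_one_mul,
    neg_neg, one_pow, one_mul, List.append_assoc]

theorem lead_update_right (hL : L.Nodup) (hlen : (L.filter (· ∉ F)).length = r)
    (hs : L = a ++ p :: (b ++ e :: c)) (ha : ∀ q ∈ a, q ∈ F ↔ q ∈ F') (hb : ∀ q ∈ b, q ∈ F ↔ q ∈ F')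
    (hc : ∀ q ∈ c, q ∈ F ↔ q ∈ F') (he : e ∈ F) (he' : e ∉ F') (hp : p ∉ F) (hp' : p ∈ F')
    (hi : i < r) (hip : (L.filter (· ∉ F)).getD i d = p) :
    lead M (Function.update (fun j => (L.filter (· ∉ F)).getD j d) i e) r =
      (-1) ^ (b.filter (· ∉ F')).length * lead M (fun j => (L.filter (· ∉ F')).getD j d) r := by
  have ha' : a.filter (· ∉ F') = a.filter (· ∉ F) := List.filter_congr fun q hq => by simp [ha q hq]
  have hb' : b.filter (· ∉ F') = b.filter (· ∉ F) := List.filter_congr fun q hq => by simp [hb q hq]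
  have hc' : c.filter (· ∉ F') = c.filter (· ∉ F) := List.filter_congr fun q hq => by simp [hc q hq]
  have h1 : L.filter (· ∉ F) =
      a.filter (· ∉ F) ++ p :: (b.filter (· ∉ F) ++ c.filter (· ∉ F)) := by
    rw [hs, List.filter_append, List.filter_cons_of_pos (by simpa using hp), List.filter_append,
      List.filter_cons_of_neg (by simpa using he)]
  have h2 : L.filter (· ∉ F') =
      a.filter (· ∉ F) ++ (b.filter (· ∉ F) ++ e :: c.filter (· ∉ F)) := by
    rw [hs, List.filter_append, List.filter_cons_of_neg (by simpa using hp'), List.filter_append,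
      List.filter_cons_of_pos (by simpa using he'), ha', hb', hc']
  have h3 := eq_length_of_getD_eq (hL.filter _) h1 (hlen.symm ▸ hi) hip
  rw [h1, List.length_append, List.length_cons, List.length_append] at hlen
  rw [h3, h1, update_getD_append, h2, lead_move (by omega), hb']

theorem colSeq_sdiff : colSeq L (L.toFinset \ F) d = fun j => (L.filter (· ∉ F)).getD j d := by
  have h : L.filter (· ∈ L.toFinset \ F) = L.filter (· ∉ F) :=
    List.filter_congr fun q hq => by simp [hq]
  ext j
  rw [colSeq, h]

/-- Minors with coherent signs change their signs in flips as the minors of a complete fan do. -/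
theorem lead_mul_lead_update_pos {m k n b₀ : ℕ} {tabs nus H : List ℕ} {E : ι → ℕ × ℕ}
    (hL : L.Nodup) (hg : ∀ e ∈ L, edgeGen k (E e) + 1 < m) (htab : tableCheck m n tabs = true)
    (hflip : flipCheck m n tabs nus H = true) (hF : IsFacet (fun e => edgeGen k (E e)) m L F)
    (he : e ∈ F) (hp : p ∉ F) (hF' : IsFacet (fun e => edgeGen k (E e)) m L (insert p (F.erase e)))
    (hrm : maxLength m = r)
    (hs : 0 < (-1) ^ (b₀ + signSum m k E nus F L 1) * lead M (colSeq L (L.toFinset \ F) d) r)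
    (hs' : 0 < (-1) ^ (b₀ + signSum m k E nus (insert p (F.erase e)) L 1) *
      lead M (colSeq L (L.toFinset \ insert p (F.erase e)) d) r)
    (hi : i < r) (hip : colSeq L (L.toFinset \ F) d i = p) :
    0 < lead M (colSeq L (L.toFinset \ F) d) r *
      lead M (Function.update (colSeq L (L.toFinset \ F) d) i e) r := by
  have hep : e ≠ p := fun h => hp (h ▸ he)
  have heL : e ∈ L := List.mem_toFinset.1 (hF.subset he)
  have hpL : p ∈ L := List.mem_toFinset.1 (hF'.subset (mem_insert_self _ _))
  have he' : e ∉ insert p (F.erase e) := by simp [hep]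
  have hp' : p ∈ insert p (F.erase e) := mem_insert_self _ _
  have hagree : ∀ q, q ≠ e → q ≠ p → (q ∈ F ↔ q ∈ insert p (F.erase e)) := by
    intro q h1 h2
    simp [h1, h2]
  have hlen : (L.filter (· ∉ F)).length = r := by
    have h1 := length_filter_notMem hL hF.subset
    have h2 := hF.card
    omega
  rw [colSeq_sdiff] at hs hs' hip ⊢
  obtain ⟨-, hR⟩ := (isFacet_iff hg hL).1 hF
  obtain ⟨-, hR'⟩ := (isFacet_iff hg hL).1 hF'
  generalize insert p (F.erase e) = F' at *
  have hone : ∀ i, m ≤ i → (1 : Equiv.Perm ℕ) i = i := fun _ _ => rfl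
  -- The same exponent arises twice: from the coherence of the local signs and from restoring the
  -- order of the columns. Both count the letters outside the facet strictly between the two flipped
  -- ones.
  have key : ∃ t, (signSum m k E nus F L 1 + signSum m k E nus F' L 1) % 2 = t % 2 ∧
      lead M (Function.update (fun j => (L.filter (· ∉ F)).getD j d) i e) r =
        (-1) ^ t * lead M (fun j => (L.filter (· ∉ F')).getD j d) r := by
    obtain ⟨a, b, c, h | h⟩ := exists_split heL hpL hep
    · have hag : ∀ q, q ∈ a ∨ q ∈ b ∨ q ∈ c → (q ∈ F ↔ q ∈ F') := by
        intro q hq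
        rw [h] at hL
        refine hagree q ?_ ?_ <;> rintro rfl <;> simp [List.nodup_append] at hL <;> grind
      refine ⟨_, ?_, lead_update_left hL hlen h (fun q hq => hag q (Or.inl hq))
        (fun q hq => hag q (Or.inr (Or.inl hq))) (fun q hq => hag q (Or.inr (Or.inr hq)))
        he he' hp hp' hi hip⟩
      rw [h] at hR hR' hg ⊢
      exact signSum_flip htab hflip (fun q hq => hag q (Or.inl hq))
        (fun q hq => hag q (Or.inr (Or.inl hq))) (fun q hq => hag q (Or.inr (Or.inr hq)))
        he he' hp hp' hg hone hR hR'
    · have hag : ∀ q, q ∈ a ∨ q ∈ b ∨ q ∈ c → (q ∈ F ↔ q ∈ F') := by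
        intro q hq
        rw [h] at hL
        refine hagree q ?_ ?_ <;> rintro rfl <;> simp [List.nodup_append] at hL <;> grind
      refine ⟨_, ?_, lead_update_right hL hlen h (fun q hq => hag q (Or.inl hq))
        (fun q hq => hag q (Or.inr (Or.inl hq))) (fun q hq => hag q (Or.inr (Or.inr hq)))
        he he' hp hp' hi hip⟩
      rw [h] at hR hR' hg ⊢
      rw [add_comm]
      exact signSum_flip htab hflip (fun q hq => (hag q (Or.inl hq)).symm)
        (fun q hq => (hag q (Or.inr (Or.inl hq))).symm)
            (fun q hq => (hag q (Or.inr (Or.inr hq))).symm)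
        hp' hp he' he hg hone hR' hR
  obtain ⟨t, ht, h1⟩ := key
  rw [h1]
  -- The product of the two predicted signs is `(-1) ^ t`, as `b₀` occurs twice; the claim becomes
  -- the product of the two certified positive numbers.
  have h2 : ((-1) ^ t : ℤ) = (-1) ^ (b₀ + signSum m k E nus F L 1) * (-1)
      ^ (b₀ + signSum m k E nus F' L 1) := by
    rw [← pow_add, neg_one_pow_eq_pow_mod_two, neg_one_pow_eq_pow_mod_two (n := _ + _)]
    congr 1
    omega
  rw [h2]
  have := mul_pos hs hs'
  linarith

end Bareiss

/-! ### The complete fan from the certificate. -/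

namespace Multiassoc

open Subword Bareiss

/-- The first `r` rows are the Gale dual of the required vectors. The last row is a vector `u` whose
image `x₀` serves as the base point of the degree: its coordinates on a facet are the entries of `u`
reduced by the complementary columns, and some coordinate is negative on every facet other than
`F₀`. -/
theorem isRealizableAsCompleteFan_of_negativeCheck {k n m D r K W s b₀ : ℕ} {P : List (ℕ × ℕ)}
    {cmasks tabs nus masks acc₀ H : List ℕ} {R : List (List ℤ)} (h : IsRelevantWord k n m P cmasks)
    (hW : W ≠ 0) (htab : tableCheck m s tabs = true) (hflip : flipCheck m s tabs nus H = true)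
    (hmask : maskCheck k s (stateIdx m (reversal m)) tabs P masks = true)
    (hR : sizeCheck (P.length + 1) r K (2 ^ (W - 1)) R = true)
    (hneg : negativeCheck k W tabs nus masks (stateIdx m id) (stateIdx m (reversal m))
        P R b₀ acc₀ = true)
    (hrm : maxLength m = r) (hlen : P.length = D + r) (d : Edge n) (hd : ¬k + 1 ≤ d.length) :
    IsRealizableAsCompleteFan (multiassociahedron k n) D := by
  set L := edgesOf n P with hLdef
  have hLn : L.Nodup := h.nodup_edgesOf
  have hdL : d ∉ L := fun h' => hd ((h.mem_edgesOf d).1 h')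
  have hLd : (L ++ [d]).Nodup := List.nodup_append.2 ⟨hLn, List.nodup_singleton d,
    fun a ha b hb hab => hdL (by rw [List.mem_singleton] at hb; rwa [← hb, ← hab])⟩
  have hmap : L.map Edge.ends = P := map_ends_edgesOf h.lt
  have hLl : L.length = P.length := h.length_edgesOf
  set M := matrixOf R (L ++ [d]) with hM
  have hfacet := fun F (hF : F ∈ facets k n m P) => lead_sign (E := Edge.ends) hLd hW h.gen_lt' htab
    (by rw [hmap]; exact hmask) (K := K) (by simpa [hLl] using hR) (by rw [hmap]; exact hneg) hrm
    (mem_facets.1 hF)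
  have hcard : ∀ F ∈ facets k n m P, #(L.toFinset \ F) = r := by
    intro F hF
    have h1 := (mem_facets.1 hF).card
    have h2 := (mem_facets.1 hF).subset
    rw [← hLdef] at h1
    rw [card_sdiff_of_subset h2, List.toFinset_card_of_nodup hLn, ← hrm]
    omega
  have hbij := fun F (hF : F ∈ facets k n m P) =>
    colSeq_bijOn hLn d (sdiff_subset : L.toFinset \ F ⊆ L.toFinset) (hcard F hF)
  have hdet : ∀ c : ℕ → Edge n, ((Matrix.of fun (b : Fin r) e => (M b e : ℝ)).submatrix id
      fun i : Fin r => c i).det = (lead M c r : ℤ) := by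
    intro c
    rw [lead, Int.cast_det]
    rfl
  have hdet' : ∀ F ∈ facets k n m P, ((Matrix.of fun (b : Fin r) e => (M b e : ℝ)).submatrix id
      fun i : Fin r => colSeq L (L.toFinset \ F) d i).det ≠ 0 := by
    intro F hF
    rw [hdet]
    have := (hfacet F hF).1
    exact_mod_cast right_ne_zero_of_mul this.ne'
  have hsign : ∀ F ∈ facets k n m P, ∀ e ∈ F, ∀ i : Fin r,
      insert (colSeq L (L.toFinset \ F) d i) (F.erase e) ∈ facets k n m P →
      0 < ((Matrix.of fun (b : Fin r) e => (M b e : ℝ)).submatrix id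
          fun i : Fin r => colSeq L (L.toFinset \ F) d i).det *
        ((Matrix.of fun (b : Fin r) e => (M b e : ℝ)).submatrix id
          (Function.update (fun i : Fin r => colSeq L (L.toFinset \ F) d i) i e)).det := by
    intro F hF e he i hF'
    have h1 : Function.update (fun i : Fin r => colSeq L (L.toFinset \ F) d i) i e =
        fun j : Fin r => Function.update (colSeq L (L.toFinset \ F) d) i e j := by
      funext j
      simp only [Function.update_apply, Fin.ext_iff]
    rw [h1, hdet, hdet]
    exact_mod_cast lead_mul_lead_update_pos hLn h.gen_lt' htab hflip (mem_facets.1 hF) he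
      (mem_sdiff.1 ((hbij F hF).1 i i.2)).2 (mem_facets.1 hF')
          hrm (hfacet F hF).1 (hfacet _ hF').1 i.2 rfl
  obtain ⟨v, c, x₀, hv, hx⟩ := SignedFlips.exists_of_minors (D := D) (S := L.toFinset)
    (𝓕 := facets k n m P) (M := Matrix.of fun (b : Fin r) e => (M b e : ℝ))
    (col := fun F i => colSeq L (L.toFinset \ F) d i) h.facets_nonempty
    (by rw [List.toFinset_card_of_nodup hLn, hLl, hlen]) (fun F hF => (mem_facets.1 hF).subset)
    (fun F hF q => ⟨fun hq => by
        obtain ⟨i, hi, hq⟩ := (hbij F hF).2.2 q hq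
        exact ⟨⟨i, hi⟩, hq⟩,
      fun ⟨i, hi⟩ => hi ▸ (hbij F hF).1 i i.2⟩)
    (fun F hF i j hij => Fin.ext ((hbij F hF).2.1 i i.2 j j.2 hij))
    hdet' (fun F hF e he => h.exists_flip hF he) hsign (fun e => (M r e : ℝ))
  refine ⟨v, hv.realizesAsCompleteFan h.facets_nonempty (x₀ := x₀)
    (F₀ := {q ∈ L.toFinset | shift W (L ++ [d]) q ∈ acc₀}) (fun F hF hne => ?_) h.mem_faces_iff⟩
  obtain ⟨q, hq, hlt⟩ := (hfacet F hF).2.resolve_right hne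
  refine ⟨q, hq, ?_⟩
  obtain ⟨y, hy⟩ := isReduction_red (M := M) (c := colSeq L (L.toFinset \ F) d) r r
  have hℓ : lead M (colSeq L (L.toFinset \ F) d) r ≠ 0 := right_ne_zero_of_mul (hfacet F hF).1.ne'
  rw [← hM] at hlt
  set ℓ := lead M (colSeq L (L.toFinset \ F) d) r
  have hℓ' : (ℓ : ℝ) ≠ 0 := by exact_mod_cast hℓ
  -- The reduction divided by the minor; multiplying numerator and denominator by `ℓ` exposes the
  -- sign certified by `lead_sign`.
  have hred : ∀ e, (M r e : ℝ) - Matrix.vecMul (fun b : Fin r => (y b : ℝ) / ℓ)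
      (Matrix.of fun (b : Fin r) e => (M b e : ℝ)) e =
        (ℓ * red M (colSeq L (L.toFinset \ F) d) r r e : ℤ) / ℓ ^ 2 := by
    intro e
    have h1 : Matrix.vecMul (fun b : Fin r => (y b : ℝ) / ℓ)
        (Matrix.of fun (b : Fin r) e => (M b e : ℝ)) e = (∑ b : Fin r, (y b : ℝ) * M b e) / ℓ := by
      rw [Matrix.vecMul, dotProduct, sum_div]
      exact sum_congr rfl fun b _ => by rw [Matrix.of_apply, div_mul_eq_mul_div]
    rw [h1, hy e, sum_range]
    push_cast
    field_simp
  rw [hx F hF q hq, cofacetCoord_of_eqOn (hdet' F hF) (y := fun b : Fin r => (y b : ℝ) / ℓ)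
      fun i => ?_,
    hred q]
  · exact div_neg_of_neg_of_pos (by exact_mod_cast hlt) (by positivity)
  · rw [← sub_eq_zero, hred, red_apply_of_lt i.2]
    simp

end Multiassoc

/-! ### The four multiassociahedra -/

namespace Multiassoc

open Subword Bareiss

set_option maxRecDepth 100000

/-! ### Transition tables of the symmetric groups on four, five and six letters. -/

/-- The codes of the sets of subsets of `{0, …, 3}` that contain `a + 1` but not `a`. -/
def descentsFour : List ℕ :=
  [17476, 12336, 3840]

/-- The tables of the action of the adjacent transpositions on the permutations of `{0, …, 3}`. -/
def transitionsFour : List ℕ :=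
  [39722146008477382390590487465342253037907655166523498420888838040722438,
  39722149299491207915306961302545630210202844797836258963496825025204226,
  39723831006751018873345411728662088062622490500346738018024170795828225]

theorem stateIdx_id_four : stateIdx 4 id = 0 := by decide +kernel

theorem stateIdx_reversal_four : stateIdx 4 (reversal 4) = 23 := by decide +kernel

theorem maxLength_four : maxLength 4 = 6 := by decide +kernel

theorem tableCheck_four : tableCheck 4 24 transitionsFour = true := by decide +kernel

/-- The codes of the sets of subsets of `{0, …, 4}` that contain `a + 1` but not `a`. -/
def descentsFive : List ℕ :=
  [1145324612, 808464432, 251662080, 16711680]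

/-- The tables of the action of the adjacent transpositions on the permutations of `{0, …, 4}`. -/
def transitionsFive : List ℕ :=
  [2002915174928335227443339163278479271218557458810928045292693577608800682091248397637203512600484615412679078699993650697093676273016670921311311328014427398073893902684053041206130936666457329090602201232750868792262020802914309474149865288431341968155260421639604698692630082057293199528652372476626292521982197316059469581651555872316055984235293395770172440,
  2002915174928335227530932336439863333547131131272541111923358908783098282536902766333210660890038219760334396751074655705732559697673429101409946585134431853151468021186800493843176994105944818993428697503109511599361584531193959753565581309259909221886403793920844170736303373963764104295981236964500350998868678017094712188731418909712151516064133660610141190,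
  2002915207000298373128063719368229769150725090510386514340870042307067141149517301462887047399214548236746833098378725393474258033458031121595995993578348964631111105772522020746879355895411802889419591836379272061552497675748412510253477050986046231076497174794131947901154780240052067812697601419101033530581461880916999672794878870786707282187350342245552130,
  2002931595765620481956004511372507883988729911830259470026185920299420237679505334017700301400313675574748072227061138104185719998830369986270821206537476063568979102242680143040034593060808943911536575865251677948964261829152277757742833587784157291252037903527737147199494349323048473087015971261102092757451429461847019851829962582546964012174222957189530625]

theorem stateIdx_id_five : stateIdx 5 id = 0 := by decide +kernel

theorem stateIdx_reversal_five : stateIdx 5 (reversal 5) = 119 := by decide +kernel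

theorem maxLength_five : maxLength 5 = 10 := by decide +kernel

theorem tableCheck_five : tableCheck 5 120 transitionsFive = true := by decide +kernel

/-- The codes of the sets of subsets of `{0, …, 5}` that contain `a + 1` but not `a`. -/
def descentsSix : List ℕ :=
  [4919131752989213764, 3472328296227680304, 1080880403494997760, 71776119077928960,
  281470681743360]

/-- The tables of the action of the adjacent transpositions on the permutations of `{0, …, 5}`. -/
def transitionsSix : List ℕ :=
  [1831561250944770435514857036135036825084350904732826570909319085699270490432872166924037517463027467433753219451111667908255056555937309779854053868236530469625645626862097214403920898777928151336608373109563620556130918653042275603531042793599342456211774694249798473961845770216325016237137218983634304115714209071139585676281830352343409285892661766091738042660746732331004313556730513024684346364315681275667868474781507389113657123494179355353401017204299008574378503018044197162443894654747296985190743637626929125770926471951245459043394659077048528833717172953895084471201861239601949590331179809400544715187094971860165626532537181566537758649730388893900210258565637682812280322044558747990019615592447200168586927275521662874030139097901384273771006006236434850232675069285123259691474723727882150831214900440897627167036933517765540019225941221094027921376076036954144529510284111181122906797843993204279782880141225713779693219474147443459504839639399452295058840440260403745418155853451873968903437011837052564520716388596318965148972370900282563566543748740514086504285595753672574774214175776793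1800699309587578604466998861433196231545449131271417616292721233931504699532006877702370064734321398338319598253853598468605379829811982388560685372916478565087218190791683340516476488480261319424172509774636735476910760739095090837561098607985851816771332172921422880671783307519584951876159219820747054246821141436047200963809844421917580607418719007230823831803579081796511583716278749908471967676583907019664255909797865416834286399958891069931379659079559521113352479301048017519793706763267492773865279163799095342780086565834346649250290184019212784451702827320383278101199838094703213996155719704283433371030733244737817627122458853470194227503704982913411286270004329325986084203701119739668651752071476837363882273054821375261027221944864628492052842279600024811809761052559808708653757181598937273474488849551481264559776889102888590388781646433685071194850666659165980864670636875107511577284320367326232680425905482004461004945030899794686305131807342417629787959734241731011317120432908269523099376742152165049878838019298884984092351965291640,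
  1831561250944770435514857036135036825084350904732826570909319085699270490467474503748837979716871970343636457415626144494693586332502900039142408161692108654208644920604720394744935914262834631904870089052202877978761351320157902162509510947519213684741378409186936258915730203522432146915331037540610710937401452726837358941190773070889858196744930351855727023038089442323267405446451721538953261236187144416377378479138707146742945729160022869327946700706013093153036397838979604484077312427581008244499893260313604429831626986914241874473192424538391825083618749640384981233286653783366009690511656991197402267651909989658155205493510975916734037787819209425474820710282082003083712948837557659793638204593609228432314770631643349971672478964748588442185169963250330457108848092750577858312296703498061035444619299262000534773513277435845215053067662403527936911858013629444872898678878087470618469252166076745514896977438653108705572588345613820366209875481053111834509766901401983840656415885083910598095598727804744531687100658374214574186628155139135153124772779951711456113629684799361178253697841280661599717236475583966610494347723102108057779507313491214190423792890956391385782587161839799875633628074983382023965434639889797209123554186515235902909300563137081146860913012619116942410636661025799661008601404673946079098584384142733532081929680895302952327681240266476896958120652729568370916871198129010193340881017830627320062641069828683209195587262792542528179554269429850856286859371064505820191635386890802633283877594930484909904395983072987271609740291060860606781288408124483397823583221145163034725673170751114644941606989460693524729658533110707930270624140154103193407494224278868439931770980373639304441319356206164202658547658523943956231289983741254091381678210333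8470706550228365382919546718533008074896819873594851089505526502598630714107479021176586699564311850647002787634149687239261400086209141227630959070799392718929837119861432524820083484823538086949316443343039643296229343222903791783273914805869036519974816734021950343103819110040580286921471391717244124677044735185893638798360312636499939455071470882932413201245120040559640,
  1831561250944770435528114005214080405815623940613931264559373806198453855091846088753016551843462533094371043571422300271205023337348491534513586526768972896241888959512812477838148079720527293583268111997965950227048390814952428390446312617445874304910865361714940931756200905864266511914095304743425118449684697221932421713469403816444806506096833383986773536924247026024444222279904319072884302979385938890094606745628334162068426222941644855568244302890023890728860114250077752279637323057145168607548944887897034150033807042615261156610923044465985310843518631286535049301259853743241633808307041656836499961205885452490428836115285662577528186077391481704970332397767606684502053079182951193332246325766702816528485662679585817232063641689620467967520225166021167734023490147469273191295576353483989382029089555706157720639129072455019256028004323955249652215527560404224700615658858831767206573869937762880389923508236018536850171620362926255535336344249281365796568166177980133395803487675153080507445891599323796816885179093906391154625408720592320223788537207032767392426206471818342293706212027394367491079021146898938689941403854227568035891799940522197277034517634770549205514548286443638791343424122993032094310525438929161181983163829814488895769548756615435345931314501212872619918314558584233953872441055806005965400834888749945498132283080954621652148742203866659746541428769324472047011535521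9029075459420040946528363502993568216279169041465329636322657420742542689373950162273221252184820116493201995853041761809117396751234969761546950545575420321059603159728832857745650305243152707215615913227239722880299632322645133269878624171404272574200712154742364057729943702858628489045868155024784286315611078535938404961847947895137538312122774781377865079509840152256481214327425497495582721012948098051692223528594647152756413194104862005221689659318372005599798761033274409417465385461693941321899602167628726429390272863705754217355873617319779356053883936989911587761918033475070169677882512097889621241855863444411071299979651161445503240344687131717214137130881306279398370412722856133269103639289643265492895522609147596521001106714008240528390,
  1831561255798767709288806140096631337326671390014496733296431404827324962144178609656160875714140283209500305014131097915804639595469941895464441936325725447700845449959903919361394465145154187231688443691288457769843182685131655575411492011041733432750551633001842273943761778567173106697315895781865716163294670969867038510223779920239637744653895648807074295607130414124364887730852944409806294746992111073072825994596063017308571497529745912200062206169938582185610572413797342067290455537166830171647907183249505934171624627587012739624130612850304086169806276098260012442356217819766812326616390579542207514245929794550622826001554427882852441243507080247987418037928139656315443067850071315823592555702645061038688931413583146314981610189496149363074098985744653854052014965012757721225840925478813749422988665056828004180949692598229258229530737944023598962247498474718920907160452740388485016239804425995005357373955932601897341824100037925635748247539275741102395825991869246125401679557933645688707941287839658724161698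5525242321886280703048212754576590699668185076580296586347388622513971392434001013892595753175292337091415807626370328555127203516364938725186981584521323021510375822627941482862264451384842112278314745643537816265226655032631507678459863583711314448932561699366569926446672862117476994973776087053013958573670953569922478235695027418101114607715374257428705249865726878417967564020096074741546470473905495955357512759806431012274863886235306198248845382246460478056977042742265193783862150257892044278162218265899220398111232603137277306425378761973236847747824499032513270505129240604746986503786882348618767033313270146041517349156241363345745270780611606230275405746101826859160957552301882549009740072796956680616844740116451457298543910983884524779337314639160089220376153142152261224513001283191380272777239337766970702778098437167102437425224322268902243703829918379007891390960018235298312794650278082728282895564550470717749194885700240471804647539933869719972225512774552242893934865704673644939439929011379770103410796968434877078160151969252901411499861788550759161159340056904916700153527819017376538998396421031465354006530,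
  1831563736190187239242333599698635464606658527739822420468747113540556261729983273592327817246905485809467262834696943152346201695851678811905417096031130572727057952866503332478160617257764391973599054602781894276392298868259851878085815675677144755921576770751782250510049891170923290680160432705560561254882420599557925467109858781072404457434661823647889179080569412417614900037689080653430022759606698069286222448393585934788109555627176005970415534016038818194659980610181884228564726305032910636565353786783497180504376551160263316375425122469705306116971292492169997988792882691408020113678337951925230611732176398438477453192062863447737801656402996308949426931133800834830512945150783573308444585645300571250187249162702245824260991415576459113429689754559349410676395127349228645061967303079622255278707290461365807241668624295207643043082918367489207615105057537690634118765991877194935205779073221567768068926311867155386500638360105100493168793516696606033970425579378548668995228470418743267115544678309210756816198948288908198795089139496397326970956689666334307336233831564579228948653164691647051647204926555345664537733843420639430123083384476722776918896107915712277114417047440976775248982184046928374294900428872038502383520619916345723581692447574920450071560905233777135263511580404855947990461001119941032276882284902698009738049904080377614462649589388869849297419641257523507884942976961248215242145344700209750850729287932588669490332640469425141388394649223328301123918049484169534261181109433430430067147512349885187560558483080133780749924289994233736015315663723046323704077712204750747163533781333967647678529673037108955702062321696947053356189869508081319432836556406692934149062385586654669085113996637502222405689873229621530638351265735252797567158984078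6555721255060538590258639139847006052879610397264995965988542265754536294982483272304125714161885723008517775713801835317860208096609971960222270603272988398805228775062186683285501213950057850020948653391247448953542895599972338681943893523998791048126785886180703590026329772940947914882107637252467711058509108547058439133735065464765832069257558610792153495873290475930625]

theorem stateIdx_id_six : stateIdx 6 id = 0 := by decide +kernel

theorem stateIdx_reversal_six : stateIdx 6 (reversal 6) = 719 := by decide +kernel

theorem maxLength_six : maxLength 6 = 15 := by decide +kernel

theorem tableCheck_six : tableCheck 6 720 transitionsSix = true := by decide +kernel

/-! ### The certificate for `k = 2`, `n = 9`. -/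

/-- The relevant edges of the 9-gon for `k = 2`. -/
def pairsTwoNine : List (ℕ × ℕ) :=
  [(0, 3), (0, 4), (0, 5), (0, 6), (1, 4), (1, 5), (1, 6), (1, 7), (2, 5), (2, 6), (2, 7), (2, 8),
  (3, 6), (3, 7), (3, 8), (4, 7), (4, 8), (5, 8)]

/-- The permutations from which the reversal is reached by each suffix of the word for `k = 2` and
`n = 9`. -/
def aliveTwoNine : List ℕ :=
  [1329227995784915872903807060280344575, 1329227995784915872903807060280344575,
  1329227995784915872903807060280344575, 1329227995784915872903807060280344575,
  1329227995784915872903807060280344575, 1329227995784915872903807060280344575,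
  1329227995784915872903807060280344575, 1329227995784915872903807060280344575,
  1329227995784915872903807060280344575, 1329227995784915872903807060263567360,
  1329223004410379965144384954756497408, 1265926670867028538232747575958568960,
  843951113911352358821831717305712640, 843951113911352358821653003716526080,
  843748289803226583200691299077324800, 674998631842581266560553039261859840,
  674998631842578868483823457020149760, 664614037506539193584072326912147456,
  664613997892457936451903530140172288]

/-- Multiples of the vertices of a polytope for `k = 2` and `n = 9`, their factors, and an
additional column. -/
def rowsTwoNine : List (List ℤ) :=
  [[-1, -3, 1, 3, 2, 7, 7, 3, 3, -5, -8, -6, -4, -2, 1, 3, 0, -4, 8], [-4, 2, -2, 3, 3, -2, -1, -2,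
  1, 3, 9, 10, -5, 3, 1, 11, 3, -9, -3], [2, 0, -4, 2, -2, -4, 5, 3, -1, 5, 2, -2, 4, 1, -3, 1, -3,
  -5, 0], [-1, 0, 0, 3, 3, 2, 3, 0, -2, -3, -3, -1, -1, 2, 2, 5, 1, -5, 11], [-5, 2, -6, 0, 3, -5,
  0, -2, -2, 6, 7, 8, 0, -1, 0, 3, 6, 0, 9], [-3, 5, 1, 2, 8, 0, 4, 0, -5, 2, -3, -3, 3, -5, -4,
  -5, 1, 3, 5], [-5, -5, 3, 4, 5, 11, 10, 4, 4, -3, -6, -3, 1, 3, 4, 1, -4, -5, -11], [-7, -2, 0,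
  -4, 7, 4, -2, 6, -2, -1, 5, 3, 4, 8, 2, -1, -6, -1, 3], [3, 3, 4, 3, 3, 3, 5, 3, 3, 4, 3, 2, 4,
  4, 3, 3, 4, 3, 4]]

theorem isRelevantWord_two_nine :
    IsRelevantWord 2 9 5 pairsTwoNine descentsFive where
  lt := by decide +kernel
  relevant := by decide +kernel
  nodup := by decide +kernel
  gen_lt := by decide +kernel
  code := by decide +kernel
  fill := by decide +kernel
  cross := by decide +kernel

theorem maskCheck_two_nine :
    maskCheck 2 120 119 transitionsFive pairsTwoNine aliveTwoNine = true := by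
  decide +kernel

theorem positiveCheck_two_nine :
    positiveCheck 2 80 transitionsFive aliveTwoNine 0 119 pairsTwoNine rowsTwoNine = true := by
  decide +kernel

theorem isPolytopalSphere_two_nine : IsPolytopalSphere (multiassociahedron 2 9) 8 :=
  -- `K` bounds the entries of the matrix. With 80 bits per digit the offset is `2 ^ 79`, above the
  -- bound on all intermediate entries. The irrelevant edge `{0, 1}` labels the additional column.
  isPolytopalSphere_of_positiveCheck (K := 11) isRelevantWord_two_nine (W := 80)
    (by decide) tableCheck_five (by rw [stateIdx_reversal_five]; exact maskCheck_two_nine)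
    (R := rowsTwoNine) (by decide +kernel)
    (by rw [stateIdx_id_five, stateIdx_reversal_five]; exact positiveCheck_two_nine)
    (by decide +kernel) (by decide) (by rw [maxLength_five]; decide) ⟨(0, 1), by decide⟩ (by decide)

/-! ### The certificate for `k = 2`, `n = 10`. -/

/-- The relevant edges of the 10-gon for `k = 2`. -/
def pairsTwoTen : List (ℕ × ℕ) :=
  [(0, 3), (0, 4), (0, 5), (0, 6), (0, 7), (1, 4), (1, 5), (1, 6), (1, 7), (1, 8), (2, 5), (2, 6),
  (2, 7), (2, 8), (2, 9), (3, 6), (3, 7), (3, 8), (3, 9), (4, 7), (4, 8), (4, 9), (5, 8), (5, 9),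
  (6, 9)]

/-- The permutations from which the reversal is reached by each suffix of the word for `k = 2` and
`n = 10`. -/
def aliveTwoTen : List ℕ :=
  [5515652263101987298728728207430913795608113109085112352897269396216198887424215820128660001943808587833784893551335930816647064191168732319583111500951066614122648616177179922993422016587311577585463592732098692120575,
  5515652263101987298728728207430913795608113109085112352897269396216198887424215820128660001943808587833784893551335930816647064191168732319583111500951066614122648616177179922993422016587311577585463592732098692120575,
  5515652263101987298728728207430913795608113109085112352897269396216198887424215820128660001943808587833784893551335930816647064191168732319583111500951066614122648616177179922993422016587311577585463592732098692120575,
  5515652263101987298728728207430913795608113109085112352897269396216198887424215820128660001943808587833784893551335930816647064191168732319583111500951066614122648616177179922993422016587311577585463592732098692120575,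
  5515652263101987298728728207430913795608113109085112352897269396216198887424215820128660001943808587833784893551335930816647064191168732319583111500951066614122648616177179922993422016587311577585463592732098692120575,
  5515652263101987298728728207430913795608113109085112352897269396216198887424215820128660001943808587833784893551335930816647064191168732319583111500951066614122648616177179922993422016587311577585463592732098692120575,
  5515652263101987298728728207430913795608113109085112352897269396216198887424215820128660001943808587833784893551335930816647064191168732319583111500951066614122648616177179922993422016587311577585463592732098692120575,
  5515652263101987298728728207430913795608113109085112352897269396216198887424215820128660001943808587833784893551335930816647064191168732319583111500951066614122648616177179922993422016587311577585463592732098692120575,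
  5515652263101987298728728207430913795608113109085112352897269396216198887424215820128660001943808587833784893551335930816647064191168732319583111500951066614122648616177179922993422016587311577585463592732098692120575,
  5515652263101987298728728207430913795608113109085112352897269396216198887424215820128660001943808587833784893551335930816647064191168732319583111500951066614122648616177179922993422016587311577585463592732098692120575,
  5515652263101987298728728207430913795608113109085112352897269396216198887424215820128660001943808587833784893551335930816647064191168732319583111500951066614122648616177179922993422016587311577585463592732098692120575,
  5515652263101987298728728207430913795608113109085112352897269396216198887424215820128660001943808587833784893551335930816647064191168732319583111500951066614122648616177179922993420687359315792669590688925038411776000,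
  5515652263101987298728728207361296480763149380806663606000432091933641362705354804529280556089618265444654108967993779314238656966035666250871157700112868582986355321501500912901841756309906751825699213457864051916800,
  5515631551315640433340174749002619920816919444645567093867329069338902496963582380598807867703909812286563030489899233609954793581356572596353777736696109179788582142795425167043097452441198654318135233437911524311040,
  5252982429824419460323975951431066591254208994900540089397456256513240473298649886284578921622771249796726695704665936771385517696530069139384550225424865885512935374090881111469616621372570146969652603274201451724800,
  3501988286549612973549317300954044394169472663267026726264970837675493648865766590856385947748514166531151130469777291180923678464353379426256366816949910590341956916060587407646411080915046764646435068849467634483200,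
  3501988286549612973549317300954044394169472663267026726264970837675493648865766590856385947748514166531151130469777291180923678464353379426256365695146462905507827996927208877530668296256752504290820374189195195842560,
  3501988286549612973548575726133344161579442744710334581256487910513362282014861908642344239835622404480763674346586078552172936836995414550874552463360288922070355683436877974150455182631718578765909087677824966328320,
  3501146664755200665696244898032855494393290511414321523198026846367600839505365426568649852851763807411674329555827466180494933247272512504599408374808652226823523105767222391844723277997584544019750493809120850739200,
  2800917331804160532556995918426284395514632409131457218558421477094080671604292341254919882281411045929339463644661972944395946597818010003679526699846921781458818484613777913475778622398067635215800395047296680591360,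
  2800917331804160532556995918426284395514632409131457218558421477094080671604292341254919882281411045929339462452042621543905968077472826609212497795906861929371143057404572447329851560778836345985140273254824956395520,
  2800917331804150581700271145699459345193504562051003046582558906550065919492878362380357010627403604360891821098969834684951246300882438955636482689252190143416569044384120986873715447808648489870844823533306280673280,
  2757826295930240572751036204996390739882835261096372230481288769526218751500680233728351518156212779678416562312831837228259688665484247587088229109417541064287083366778211433229504440919284666949754903171255414816768,
  2757826295930240572751036204996390739882835261096372230481288769526218749939805865534998692627732174468385999773952368629679945259194051743656864577705852489199846082577734491579647102613207617154991571098104298995712,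
  2757826131550993649364364103715456899878814338983052655704838629953680019218331026185548450969732958762218852482122038608177056569136263303890499056125927898258899845794477615440148425350637632323322698066804107902976,
  2757826131550993649364364103715456897804056554542556176448634698108099443712107910064330000971904293916892446775667965408323532095584366159791555750475533307061324308088589961496711008293655788792731796366049346060288]

/-- Multiples of the vertices of a polytope for `k = 2` and `n = 10`, their factors, and an
additional column. -/
def rowsTwoTen : List (List ℤ) :=
  [[-9, -6, -9, -11, -2, -1, -1, 2, 12, 12, 2, 7, 11, -1, -2, 3, 4, -9, -5, 0, -9, 0, -7, 4, 3, 5],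
  [-4, -1, 5, 1, 3, 8, 9, 3, 2, -2, -1, -3, -3, -7, -2, 4, -2, -4, 0, -9, -6, -1, 8, 9, 0, -6], [0,
  4, 2, 4, -6, -1, -5, 0, -6, 2, 1, 9, 2, 9, 2, 6, -8, -3, -9, -7, -2, -3, 0, -2, 3, 9], [-8, -4,
  0, -8, -3, -1, 2, -6, 3, 3, 3, 0, 9, 6, 7, -1, 7, -4, -2, 1, -9, -2, -4, 7, 3, -3], [-3, 1, 3, 1,
  -9, 7, 8, 2, -3, 9, 1, -5, -6, 0, -7, -8, -4, 0, -6, 3, 1, -3, -4, -2, 4, 11], [-2, 2, -1, -1,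
  -1, 9, -2, -2, -1, 4, -9, -4, 1, 6, 2, 9, 9, 5, -2, 1, 0, -4, -1, -6, -2, 8], [-7, -3, -8, -5,
  -7, 4, -2, 1, -3, 0, -2, 1, -3, 2, 8, -1, -7, 1, 6, -1, 8, 9, 6, 5, 2, 12], [-4, -1, -1, -7, 10,
  6, 6, -3, 9, 1, 1, -8, 3, -3, -1, -12, 4, 1, 1, 8, 7, 2, 8, -1, -12, 9], [-9, 1, 1, 13, 0, 5, 0,
  9, -5, -4, 3, 14, 2, 11, 10, 6, -11, -3, -9, -5, -1, -4, -7, -10, 4, 6], [-1, -9, -1, 1, -3, -9,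
  5, 4, -1, 6, 3, 0, -3, 5, 0, 3, 3, 9, 4, -4, 1, -7, 4, -5, -3, 2], [6, 6, 7, 7, 7, 8, 8, 8, 7, 7,
  4, 7, 7, 9, 8, 7, 9, 7, 8, 5, 7, 7, 7, 9, 5, 14]]

theorem isRelevantWord_two_ten :
    IsRelevantWord 2 10 6 pairsTwoTen descentsSix where
  lt := by decide +kernel
  relevant := by decide +kernel
  nodup := by decide +kernel
  gen_lt := by decide +kernel
  code := by decide +kernel
  fill := by decide +kernel
  cross := by decide +kernel

theorem maskCheck_two_ten :
    maskCheck 2 720 719 transitionsSix pairsTwoTen aliveTwoTen = true := by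
  decide +kernel

theorem positiveCheck_two_ten :
    positiveCheck 2 80 transitionsSix aliveTwoTen 0 719 pairsTwoTen rowsTwoTen = true := by
  decide +kernel

theorem isPolytopalSphere_two_ten : IsPolytopalSphere (multiassociahedron 2 10) 10 :=
  isPolytopalSphere_of_positiveCheck (K := 14) isRelevantWord_two_ten (W := 80)
    (by decide) tableCheck_six (by rw [stateIdx_reversal_six]; exact maskCheck_two_ten)
    (R := rowsTwoTen) (by decide +kernel)
    (by rw [stateIdx_id_six, stateIdx_reversal_six]; exact positiveCheck_two_ten)
    (by decide +kernel) (by decide) (by rw [maxLength_six]; decide) ⟨(0, 1), by decide⟩ (by decide)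

/-! ### The certificate for `k = 3`, `n = 10`. -/

/-- The relevant edges of the 10-gon for `k = 3`. -/
def pairsThreeTen : List (ℕ × ℕ) :=
  [(0, 4), (0, 5), (0, 6), (1, 5), (1, 6), (1, 7), (2, 6), (2, 7), (2, 8), (3, 7), (3, 8), (3, 9),
  (4, 8), (4, 9), (5, 9)]

/-- The permutations from which the reversal is reached by each suffix of the word for `k = 3` and
`n = 10`. -/
def aliveThreeTen : List ℕ :=
  [16777215, 16777215, 16777215, 16777215, 16777215, 16777215, 16777215, 16777215, 16777215,
  16777215, 16777152, 15978240, 10652160, 10649600, 8519680, 8388608]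

/-- Multiples of the vertices of a polytope for `k = 3` and `n = 10`, their factors, and an
additional column. -/
def rowsThreeTen : List (List ℤ) :=
  [[2, 2, -1, -3, -4, 1, -1, -2, -3, -1, 3, 1, 4, -1, 0, 3], [-3, 4, 4, 2, -1, -5, 3, -1, -1, -6,
  -2, 4, 2, 0, 1, -2], [-1, -1, 0, -1, -2, 0, 0, 2, -3, 2, -3, 4, -3, 4, 3, 5], [-2, -2, -6, -2, 0,
  5, 2, 2, 2, 2, 5, -1, -3, -5, 3, -1], [4, 1, -2, -5, -6, 0, 1, 0, -1, -5, -1, -1, 6, 3, 1, 6],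
  [1, -1, -2, 2, 4, 0, 0, -4, -2, -3, -1, 0, 0, 3, 4, 5], [1, 1, 2, 4, -1, -1, -4, 0, -1, 0, -4,
  -1, 2, 3, -2, 5], [-3, -4, -1, 0, 1, 0, 0, 0, 1, 0, 2, 3, 4, 2, -3, 4], [3, 4, 2, 0, 1, 4, 2, 1,
  -5, -2, -5, -3, -3, -3, 0, 2], [3, 3, 2, 2, 3, 3, 2, 3, 3, 3, 4, 3, 4, 4, 3, 6]]

theorem isRelevantWord_three_ten :
    IsRelevantWord 3 10 4 pairsThreeTen descentsFour where
  lt := by decide +kernel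
  relevant := by decide +kernel
  nodup := by decide +kernel
  gen_lt := by decide +kernel
  code := by decide +kernel
  fill := by decide +kernel
  cross := by decide +kernel

theorem maskCheck_three_ten :
    maskCheck 3 24 23 transitionsFour pairsThreeTen aliveThreeTen = true := by
  decide +kernel

theorem positiveCheck_three_ten :
    positiveCheck 3 80 transitionsFour aliveThreeTen 0 23 pairsThreeTen rowsThreeTen = true := by
  decide +kernel

theorem isPolytopalSphere_three_ten : IsPolytopalSphere (multiassociahedron 3 10) 9 :=
  isPolytopalSphere_of_positiveCheck (K := 6) isRelevantWord_three_ten (W := 80)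
    (by decide) tableCheck_four (by rw [stateIdx_reversal_four]; exact maskCheck_three_ten)
    (R := rowsThreeTen) (by decide +kernel)
    (by rw [stateIdx_id_four, stateIdx_reversal_four]; exact positiveCheck_three_ten)
    (by decide +kernel) (by decide) (by rw [maxLength_four]; decide) ⟨(0, 1), by decide⟩ (by decide)

/-! ### The certificate for `k = 4`, `n = 13`. -/

/-- The relevant edges of the 13-gon for `k = 4`. -/
def pairsFourThirteen : List (ℕ × ℕ) :=
  [(0, 5), (0, 6), (0, 7), (0, 8), (1, 6), (1, 7), (1, 8), (1, 9), (2, 7), (2, 8), (2, 9), (2, 10),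
  (3, 8), (3, 9), (3, 10), (3, 11), (4, 9), (4, 10), (4, 11), (4, 12), (5, 10), (5, 11), (5, 12),
  (6, 11), (6, 12), (7, 12)]

/-- The permutations from which the reversal is reached by each suffix of the word for `k = 4` and
`n = 13`. -/
def aliveFourThirteen : List ℕ :=
  [1329227995784915872903807060280344575, 1329227995784915872903807060280344575,
  1329227995784915872903807060280344575, 1329227995784915872903807060280344575,
  1329227995784915872903807060280344575, 1329227995784915872903807060280344575,
  1329227995784915872903807060280344575, 1329227995784915872903807060280344575,
  1329227995784915872903807060280344575, 1329227995784915872903807060280344575,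
  1329227995784915872903807060280344575, 1329227995784915872903807060280344575,
  1329227995784915872903807060280344575, 1329227995784915872903807060280344575,
  1329227995784915872903807060280344575, 1329227995784915872903807060280344575,
  1329227995784915872903807060280344575, 1329227995784915872903807060263567360,
  1329223004410379965144384954756497408, 1265926670867028538232747575958568960,
  843951113911352358821831717305712640, 843951113911352358821653003716526080,
  843748289803226583200691299077324800, 674998631842581266560553039261859840,
  674998631842578868483823457020149760, 664614037506539193584072326912147456,
  664613997892457936451903530140172288]

/-- A Gale dual of the vectors of the rays of a fan for `k = 4` and `n = 13`, the indicator
function of a facet, and an additional column. -/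
def rowsFourThirteen : List (List ℤ) :=
  [[-6, 1, 6, 8, -4, -1, 5, 7, 1, -1, 4, 3, 8, -1, 4, -1, 9, 1, 4, -6, 5, 2, 3, 3, 4, 5, 6], [-3,
  4, -5, -4, 1, 3, -5, -3, 7, 5, -8, 5, 7, 6, -9, 10, 0, 4, -6, 0, 1, 1, 1, 2, -2, -1, -5], [-1,
  -6, -2, 4, 0, -5, -4, 6, 0, -1, -6, 1, -5, 0, -6, -4, -4, 1, -5, -5, -3, 0, -6, 1, 0, 2, 10],
  [-1, -5, 6, -5, -2, -6, 6, -4, -1, -6, 4, 1, -3, -4, 0, 6, -1, -1, -3, 1, 2, 0, -4, 6, 1, 1, -2],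
  [0, 0, -7, -1, -6, 1, -4, -6, -7, -2, -1, -7, -8, -4, 0, -5, -6, -4, -1, 1, -3, -4, -1, -3, -5,
  1, 12], [3, 1, -11, -5, 3, -2, -6, -6, 2, -6, -2, -2, -2, -9, 1, -1, -4, -9, 3, 1, -3, -9, 4, -1,
  -10, -1, 9], [-1, 12, 2, -1, -3, 9, 6, 1, -3, 2, 10, 6, -1, 0, 11, 12, -2, -2, 11, 8, -1, -1, 13,
  -5, -1, -3, 13], [0, -9, -1, 7, 2, -8, -3, 1, 4, -3, -5, -5, 0, 0, -7, -8, -3, 3, -8, -6, -4, 2,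
  -10, 4, 1, 8, 10], [3, -3, -4, 6, 0, -2, -3, 2, -1, -3, -2, 0, 1, -5, -2, 4, 4, -3, -4, 6, 0, -1,
  -5, -1, -2, 3, 7], [3, 3, 4, -9, 6, 4, 2, -3, 1, 7, 1, 0, -7, 10, 1, -3, -8, 5, 3, -1, 0, 2, 4,
  4, 2, -4, 3], [0, 0, 0, 0, 0, 0, 0, 1, 0, 0, 1, 1, 0, 1, 1, 1, 1, 1, 1, 1, 1, 1, 1, 1, 1, 1,
  -13]]

/-- The signs of the transitions. -/
def signsFourThirteen : List ℕ :=
  [223391996602790, 307563741562211559972314776862762, 231706485209686919997263132601622528,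
  437777113859522788804131664031662080]

/-- The signs of the pairs of states of two words related by a flip. -/
def pairSignsFourThirteen : List ℕ :=
  [562949953429544, 3377699720577728, 13510798915863424, 36028797220816896, 144115325516908544,
  864691965986340864, 158456325031987439700958937088, 950737950180395423296958234624,
  3802951800721581692638069260288, 10141204802047196140860296134656,
  40564819208188784565640182628352, 243388915246181228337649470668800,
  44601490397061246283080881278262600412430336, 267608942382367477698485287669575613480435712,
  1070435773517153898148688769389722486932766720, 2854495401362655711536166876654495539216252928,
  11417981541647679048468705607235225568143212544, 68507889930450808132689160570160497697493090304,
  12554203470773361527671578846415390860644052394976745619456,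
  75325220824640169166029473078492151735733176072073474211840,
  301300883298560676675006928055438637773760691528198386614272,
  803469022129495137814537189136465138404531302924224934445056,
  3213880686004603148750499259723421511252428268557357243432960,
  19283274921054373701351235132982808487095843658553344781189120, 237684487545110114788913971200,
  633825300128147917187238068224, 44601490397063781584281393329499255970201600,
  267608942382382689505688174572806076232630272,
  18831305206160042291507368330470266745479177544478457069568,
  50216813883110573082998787066493543333742200603768180965376, 649037107331066669875105250672640,
  3894222682625337537668206219493376, 10384593717221804002180949040168960,
  41538374868885445121292720043720704, 249230249831061958634624654424145920,
  996920999329074093083991395104980992, 182687704669021320767069310356229974496951402496,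
  1096126228014127924602418960009792609468968599552,
  2923003274725608780205667921897595408573001629696,
  11692013098902435120823906000852208170679381524480,
  70152078592904187174549600552492548725012657340416,
  280608314370255619230514609670490468802189965918208,
  51422017416287688817359120508529409410154272156913836140527616,
  308532109095212755501766852947510199827614426892968980746600448,
  822752278660603021077658815850538791553761769896499120485433344,
  3291009114642412084310635263402155131552725979595348784766255104,
  19746054761414258467425082985038679750321485051784770465342423040,
  78984219045657033869705907126454351419386836593914231171114336256,
  44601490397713452516888860572366776811126784,
  12554203470773629136613965163892301571986797732993328742400,
  1070435773527609480299144531902087341166034944, 4281743088793404243599292725970577440035045376,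
  200867255532390911431391536065931557494090282176612384374784,
  803469022129540809741725623874414943812730632164617511501824,
  182687704669039493806035307732042848314704527360,
  51422017416288784943587134947991822021661407551985340670541824,
  4384504912035555588287683895739482714676521861120,
  17538019648141640815902579682263535443117214793728,
  822752278660673173156251721034634309510708857002416072275525632,
  3291009114642599156520217702364088214858793967184985128578318336,
  748288838324364498981588061816481045784065258553344,
  2993155353319959167438999303162439829052686707195904,
  11972621413190172266072329927527160107152475905064960,
  47890485653107096513814835065914355778975443659522048,
  191561942611026422703545073794188319733282889606889472,
  766247770444094801778438825145922450945693741844791296,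
  210624583341711860018434026835416666880104381535602698739490226176,
  842498333360717457910274816827667505178229101629322904318441947136,
  3369993333467389760294943035570091761917723758587251139309249495040,
  13479973333771479326564352467752283021605382554632621172372059193344,
  53919893335478236164719049542817370762093082449889041094315356454912,
  215679573341912944658876131269033887456502905192401346432176907878400,
  18831305206434965878314853791711851583172275334037830107136,
  50216813883844178397049650283097989748749277997449600827392,
  301300884425394138770863807807700635142831213935497857466368,
  803469025140234182598807648386365921807666901226981704073216,
  4820817197814866282724358477816253887982919659299976962375680,
  19283275112803388514984308276581727086352971529121329865293824,
  77133026125559081739214972033769947769506356051238608051372032,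
  205688072734690030096522634417812734622873423198844989359521792,
  1234128418002935613094734879740665612279972341042992534205235200,
  3291009114690489642171575747511929426222506577481761283630956544,
  19746054761701881989649017086191348538086235699570723749453889536,
  78984219046423281640122125996734626965605839397019114461076652032,
  315936875008758999840635263436551599610016426676066727131160248320,
  842498333361052691309835745523996123180552366807259402194934300672,
  5054990000140048216478860096931178197071065932493091462903427497984,
  13479973333772628698219990734023452516564174518661198902532943904768,
  80879840002237706472580029773182134459082754301522225928210472763392,
  323519360008946228403697521426153462795249566278538047495475340247040,
  862718293348881773250979118338962515437474633888643068960202872061952,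
  3450873173396360770578147516894797002532668303750460869923279367831552,
  13803492693582500690874127560971139983838544621369295500578524955148288,
  55213970774327648850345740238598121514320475610571143619022425807650816,
  220855883097301179748779880933246732373147090942660420942923007178833920,
  883423532389192164791648750371459257913741948437809479060803100646309888,
  51773535113469342940117591162616832600012227705939356662366208,
  314558122163697346437339079575782579443721236032981697510244352,
  211453361633440947630446822316465819250041016995141697913428639744,
  1267051364641682724381530606265898618137526794161806757121111359488,
  862738058686764859009733648918363977856399644618121847747189734899712,
  5257268584313126177850091380489590734183482333716962045648644731830272,
  211653023685440127172182911106439208703404400717119209923214835712,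
  1294938038906709700904063773059419766648688903139673841361504614481920,
  5078027063893241846090234897371983658376722881345227458293807448064,
  20272616146197258439349220329106558221387305864605703916454863175680,
  20759211589851826920486950576018957453916760652903941085005407047385088,
  83144475521492573126753074528368540997496953399115125531723534008582144,
  867352034182236989644052876002709680578420005718922480290505210986496,
  5277409560094737739806068203284092704364471020712317063176031706284032,
  13904592493582942474099513031130374519928357235925300257129186986033152,
  83144475521492573126753074528368540997496953399115125531723534008582144,
  221071562670635246316269523713560971523824584264832694345049604043571200,
  883423532389192164791648750371459257913741948437809479060803100646309888,
  25881548800464614202880334483538845446691658645638949581859465839247360,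
  386497795420271572096346328287513425337262102441541647089101356532760576,
  303676839258784806647129257940189119907848794775497008427151065847169024,
  1325135298583788247187473125557188886870612922656714218591204650969464832,
  1325135298583788247187473125557188886870612922656714218591204650969464832, 0]

/-- The positions of a facet for `k = 4` and `n = 13`. -/
def facetFourThirteen : List ℕ :=
  [80, 160, 240, 320, 400, 480, 560, 640, 720, 800, 880, 960, 1040, 1200, 1280, 1520]

theorem isRelevantWord_four_thirteen :
    IsRelevantWord 4 13 5 pairsFourThirteen descentsFive where
  lt := by decide +kernel
  relevant := by decide +kernel
  nodup := by decide +kernel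
  gen_lt := by decide +kernel
  code := by decide +kernel
  fill := by decide +kernel
  cross := by decide +kernel

theorem maskCheck_four_thirteen :
    maskCheck 4 120 119 transitionsFive pairsFourThirteen aliveFourThirteen = true := by
  decide +kernel

theorem flipCheck_four_thirteen :
    flipCheck 5 120 transitionsFive signsFourThirteen pairSignsFourThirteen = true := by
  decide +kernel

theorem negativeCheck_four_thirteen :
    negativeCheck 4 80 transitionsFive signsFourThirteen aliveFourThirteen 0 119 pairsFourThirteen
      rowsFourThirteen 1 facetFourThirteen = true := by
  decide +kernel

theorem isRealizableAsCompleteFan_four_thirteen :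
    IsRealizableAsCompleteFan (multiassociahedron 4 13) 16 :=
  -- The ten rows match the length of the reversal on five letters, leaving dimension 26 - 10 = 16.
  -- The last row is the indicator of the positions in `facetFourThirteen`, so the base point is the
  -- sum of the vectors of that facet.
  isRealizableAsCompleteFan_of_negativeCheck (r := 10) (K := 13) isRelevantWord_four_thirteen (W := 80)
    (by decide) tableCheck_five flipCheck_four_thirteen (by rw [stateIdx_reversal_five]; exact maskCheck_four_thirteen)
    (R := rowsFourThirteen) (by decide +kernel)
    (by rw [stateIdx_id_five, stateIdx_reversal_five]; exact negativeCheck_four_thirteen)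
    maxLength_five (by decide) ⟨(0, 1), by decide⟩ (by decide)

end Multiassoc

/-- For `(k, n) ∈ {(2, 9), (2, 10), (3, 10)}` the multiassociahedron is a polytopal sphere (of
dimension `k (n - 2k - 1) - 1`), and for `(k, n) = (4, 13)` it can be realized as a complete
simplicial fan (in dimension `k (n - 2k - 1) = 16`). -/
theorem theorem1p2 :
    (∀ p ∈ ({(2, 9), (2, 10), (3, 10)} : Set (ℕ × ℕ)),
      Multiassoc.IsPolytopalSphere (Multiassoc.multiassociahedron p.1 p.2)
        (p.1 * (p.2 - 2 * p.1 - 1))) ∧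
    Multiassoc.IsRealizableAsCompleteFan (Multiassoc.multiassociahedron 4 13)
      (4 * (13 - 2 * 4 - 1)) := by
  refine ⟨?_, Multiassoc.isRealizableAsCompleteFan_four_thirteen⟩
  rintro p (rfl | rfl | rfl)
  · exact Multiassoc.isPolytopalSphere_two_nine
  · exact Multiassoc.isPolytopalSphere_two_ten
  · exact Multiassoc.isPolytopalSphere_three_ten
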